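/- **Model.** Let $G=(V,E)$ be a finite simple connected undirected graph with maximum degree $\Delta$. Nodes are anonymous and have no memory; at every node $v$ of degree $\delta_v$ the incident edges are numbered by distinct ports $0,\dots,\delta_v-1$, independently of the numbering at the other endpoints. There are $k$ agents, $1\le k\le |V|$, with distinct positive integer identifiers at most $\mathrm{id}_{\max}$, where $\mathrm{id}_{\max}$ is known to the agents and is bounded by a polynomial in $k$; nothing else about the network ($k$, $\Delta$, $|V|$, $|E|$) is known to them. The *incoming port* of an agent is the port through which it entered its current node if it moved in the preceding step, and $\bot$ otherwise (in particular at time $0$). An *algorithm* is a set of agent-states with one initial state, common to all agents, and a deterministic rule that the agents apply synchronously: in each step every agent learns the degree of its current node, its own identifier, and the identifiers, states and incoming ports of all agents at its current node; from these and $\mathrm{id}_{\max}$ it determines its new state and either stays or leaves through a port of its current node. Initially all agents are in the initial state and are placed at arbitrary nodes (the general setting). A configuration is *legitimate* if all agents are at pairwise different nodes and no agent changes its location in the execution starting from it. The *time* of an algorithm on a network is the maximum, over all initial placements, of the number of steps until a legitimate configuration is reached. Its *space per agent* for given $k,\Delta,\mathrm{id}_{\max}$ is $\log_2|\mathcal M'|+\log_2\mathrm{id}_{\max}$,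 where $\mathcal M'$ is the set of all agent-states that occur in some execution from some initial placement on some network with these parameters. **Theorem 3.** Let $\tau=\min(k,\Delta)$. There is an algorithm such that for every $c\in\mathbb N$ there is a constant $K$ with the following property. On every network with $\mathrm{id}_{\max}\le c\,k^c$, the algorithm solves the dispersion problem, that is, it reaches a legitimate configuration from every initial placement of the $k$ agents, within at most $$K\cdot k\cdot \log_2\max(2,\tau)\cdot\log_2 k$$ steps (time $O(k\log\tau\cdot\log k)$), and its space per agent (in particular $\mathcal M'$ is finite) is at most $$K\cdot\log_2\max(2,k+\Delta)$$ bits (space $O(\log(k+\Delta))$). -/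

import Mathlib

/-- A port-labelled network together with the agents that live in it: a simple connected
undirected graph on anonymous nodes, an independent local numbering `0, …, δ_v - 1` of the edges
at every node `v`, and `k ≥ 1` agents, `k` at most the number of nodes, carrying distinct positive
identifiers that are bounded by a number `idMax`. -/
structure Network where
  Node : Type
  Agent : Type
  [nodeFintype : Fintype Node]
  [agentFintype : Fintype Agent]
  [agentNonempty : Nonempty Agent]
  graph : SimpleGraph Node
  [adjDecidable : DecidableRel graph.Adj]
  connected : graph.Connected
  /-- `port v u` is the port number assigned at `v` to the edge `{v, u}`. -/
  port : (v : Node) → graph.neighborSet v ≃ Fin (graph.degree v)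
  card_agent_le : Fintype.card Agent ≤ Fintype.card Node
  ident : Agent → ℕ
  ident_pos : ∀ a, 0 < ident a
  ident_injective : Function.Injective ident
  idMax : ℕ
  ident_le : ∀ a, ident a ≤ idMax

attribute [instance] Network.nodeFintype Network.agentFintype Network.agentNonempty
  Network.adjDecidable

namespace Network

/-- The number `k` of agents. -/
def k (N : Network) : ℕ := Fintype.card N.Agent

/-- The maximum degree `Δ` of the graph. -/
def Δ (N : Network) : ℕ := N.graph.maxDegree

/-- `τ = min (k, Δ)`. -/
def τ (N : Network) : ℕ := min N.k N.Δ

end Network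

/-- A deterministic synchronous algorithm for mobile agents. All agents start in the same state
`init`. In every step an agent is given the bound `idMax`, the degree `deg` of its current node,
its own identifier `self`, and the triples (identifier, state, incoming port) of all agents at its
current node, itself included. It answers with its new state and with the port through which it
leaves (`none`: it stays). Nothing else about the network is known to it. -/
structure Algorithm where
  State : Type
  init : State
  step : (idMax deg self : ℕ) → Finset (ℕ × State × Option ℕ) → State × Option (Fin deg)

/-- A configuration: the state, the location and the incoming port of every agent. -/
structure Configuration (𝒜 : Algorithm) (N : Network) where
  state : N.Agent → 𝒜.State
  loc : N.Agent → N.Node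
  pin : N.Agent → Option ℕ

namespace Algorithm

variable (𝒜 : Algorithm) {N : Network}

/-- The triples (identifier, state, incoming port) of the agents located at `v`. -/
noncomputable def agentsAt (C : Configuration 𝒜 N) (v : N.Node) :
    Finset (ℕ × 𝒜.State × Option ℕ) :=
  open Classical in
  (Finset.univ.filter fun b => C.loc b = v).image fun b => (N.ident b, C.state b, C.pin b)

/-- The new state and the outgoing port that agent `a` computes in configuration `C`. -/
noncomputable def action (C : Configuration 𝒜 N) (a : N.Agent) :
    𝒜.State × Option (Fin (N.graph.degree (C.loc a))) :=
  𝒜.step N.idMax (N.graph.degree (C.loc a)) (N.ident a) (𝒜.agentsAt C (C.loc a))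

/-- Leaving `v` through an outgoing port: the node reached, and the incoming port there. -/
def move (v : N.Node) : Option (Fin (N.graph.degree v)) → N.Node × Option ℕ
  | none => (v, none)
  | some p =>
      let u := (N.port v).symm p
      (u.1, some (N.port u.1 ⟨v, (show N.graph.Adj v u.1 from u.2).symm⟩ : ℕ))

/-- One synchronous step of all agents. -/
noncomputable def next (C : Configuration 𝒜 N) : Configuration 𝒜 N where
  state a := (𝒜.action C a).1
  loc a := (move (C.loc a) (𝒜.action C a).2).1
  pin a := (move (C.loc a) (𝒜.action C a).2).2

/-- The configuration after `t` steps of the execution that starts in `C`. -/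
noncomputable def exec (C : Configuration 𝒜 N) (t : ℕ) : Configuration 𝒜 N :=
  𝒜.next^[t] C

/-- The initial configuration in which the agents are placed according to `place`. -/
def initial (place : N.Agent → N.Node) : Configuration 𝒜 N where
  state _ := 𝒜.init
  loc := place
  pin _ := none

/-- A configuration is legitimate if all agents are at different nodes and no agent changes its
location in the execution that starts from it. -/
def Legitimate (C : Configuration 𝒜 N) : Prop :=
  Function.Injective C.loc ∧ ∀ t a, (𝒜.exec C t).loc a = C.loc a

/-- On the network `N` (agents, identifiers and ports as given), for every initial placement of
the agents, the execution reaches a legitimate configuration within `B` steps. -/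
def DispersesWithin (N : Network) (B : ℝ) : Prop :=
  ∀ place : N.Agent → N.Node, ∃ T : ℕ, (T : ℝ) ≤ B ∧ 𝒜.Legitimate (𝒜.exec (𝒜.initial place) T)

/-- All agent-states that appear in some execution from some initial configuration, on any network
with `k` agents, maximum degree `Δ` and identifier bound `idMax`. -/
def reachableStates (k Δ idMax : ℕ) : Set 𝒜.State :=
  {s | ∃ N : Network, N.k = k ∧ N.Δ = Δ ∧ N.idMax = idMax ∧
    ∃ (place : N.Agent → N.Node) (t : ℕ) (a : N.Agent), (𝒜.exec (𝒜.initial place) t).state a = s}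

/-- With `k` agents, maximum degree `Δ` and identifier bound `idMax`, every agent needs at most
`B` bits of memory: the set of the states that can appear is finite, and the number of bits for
a state plus the number of bits for an identifier is at most `B`. -/
def UsesMemoryAtMost (k Δ idMax : ℕ) (B : ℝ) : Prop :=
  (𝒜.reachableStates k Δ idMax).Finite ∧
    Real.logb 2 ((𝒜.reachableStates k Δ idMax).ncard : ℝ) + Real.logb 2 (idMax : ℝ) ≤ B

end Algorithm

/-!
# Dispersion of mobile agents by synchronized group searches

All agents run the same list of instructions, `program idMax`, by a common clock, and then stay.
The program is a sequence of rounds. In a round, the agents of every crowded node form a group that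
explores the graph depth first and leaves one settled agent at each new node; the settled agents
help with probing, so that a new neighbour is found in logarithmically many cycles of constant
length. Groups that are blocked by each other follow the exit ports of the settled agents to a
common node. A long enough round at least halves the number of crowded nodes, and round lengths are
doubled until they suffice.
-/

/-! In a round, the agents of each crowded node form a group, labelled by the least identifier
there. The free agents of a group move together in a depth-first search; one of them settles on
every node that is new, that is, not yet settled by the own group. Settled agents keep the search
tree (`parent`) and the port last used by the group (`exit`). Groups that meet on a node without a
settled agent merge. A group that enters a node settled by another group is blocked, and its free
agents become inert.

Speed: with `h` helpers and `f ≥ 1` free agents at the head, the next `h + f` ports are inspected at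
once. Either a new node is found, or the inspected nodes belong to the group and their settled
agents become helpers, so `h + 1` at least doubles. Hence every move costs at most `W = log τ + 2`
cycles, and the search makes at most two moves per settled agent. `Inv.decided_search` is this
amortized count; the search cannot run out of nodes because `k ≤ |V|`. By `Inv.not_active`, no group
has free agents left after more than `2 * W * k` cycles.

Halving: the exit ports of a group lead from each of its nodes to its last head, and an inert agent
on a settled node sits where a second, inactive group has ended. Exit ports define a map `follow` on
the settled nodes. The free agents walk to the node of largest identifier on the cycle of `follow`
that they reach (`Conf.flow_free`). A node that is still crowded then attracts at least two groups,
and distinct nodes attract distinct groups; there are at most as many groups as there were crowded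
nodes. This is `Inv.crowded_flow`, and it gives `crowded_round`.

Schedule: `k` and `τ` are unknown, so phase `i` uses rounds with `2 ^ i` cycles. Every round starts
from an arbitrary placement, so phases that are too short do no harm, and the lengths form a
geometric sum. Memory consists of a clock polynomial in `idMax`, of identifiers, and of ports. -/

noncomputable section

/-! ### The algorithm: memory, instructions and schedule -/

namespace Dispersion

open scoped Classical

/-- The memory of an agent, apart from its clock. Label `0` means that the agent belongs to no
group; `settled` agents occupy a node for their group. A settled agent stores the port towards the
parent of its node in the search tree, the port `exit` through which its group left last, and, while
it assists its group, the port `help` from its node towards the group. -/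
structure Mem where
  label : ℕ := 0
  settled : Bool := false
  parent : Option ℕ := none
  exit : Option ℕ := none
  help : Option ℕ := none
  home : Option ℕ := none
  fresh : Bool := false
  best : ℕ := 0

instance : Inhabited Mem := ⟨{}⟩

/-- What an agent sees of an agent at its node. -/
structure Obs where
  id : ℕ
  mem : Mem
  pin : Option ℕ

instance : Inhabited Obs := ⟨⟨0, {}, none⟩⟩

inductive Instr where
  | reset | resolve | gather | probe | back | decide | walk | record | seek | nop

/-- The observed agent with the least identifier among those that satisfy `P`. -/
def pick (V : Finset Obs) (P : Obs → Prop) : Obs :=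
  if h : ∃ x ∈ V, P x ∧ ∀ y ∈ V, P y → x.id ≤ y.id then h.choose else default

/-- Free agents and helpers of the group `ℓ`. -/
def Team (ℓ : ℕ) (m : Mem) : Prop :=
  m.label = ℓ ∧ ℓ ≠ 0 ∧ (m.settled = false ∨ m.help ≠ none)

def Helper (ℓ : ℕ) (m : Mem) : Prop := m.label = ℓ ∧ m.help ≠ none

/-- Some member of the group `ℓ` has just found a node without a settled agent of the group. -/
def Found (V : Finset Obs) (ℓ : ℕ) : Prop := ∃ x ∈ V, x.mem.label = ℓ ∧ x.mem.fresh = true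

/-- Every neighbour is occupied by a helper of the group `ℓ`. -/
def Full (V : Finset Obs) (deg ℓ : ℕ) : Prop := deg ≤ (V.filter fun x => Helper ℓ x.mem).card

def target (V : Finset Obs) (deg ℓ : ℕ) : Option ℕ :=
  if Found V ℓ then (pick V fun x => x.mem.label = ℓ ∧ x.mem.fresh = true).pin
  else if Full V deg ℓ then
    (pick V fun x => x.mem.settled = true ∧ x.mem.help = none ∧ x.mem.label = ℓ).mem.parent
  else none

/-- The new memory and the outgoing port of the agent `self` with memory `m` and incoming port `pin`
at a node of degree `deg` where it observes `V`. -/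
def act (deg self : ℕ) (V : Finset Obs) (m : Mem) (pin : Option ℕ) : Instr → Mem × Option ℕ
  | .reset =>
      if ∀ x ∈ V, x.id = self then ({}, none)
      else ({ label := (pick V fun _ => True).id }, none)
  | .resolve =>
      if m.settled = true then (m, none)
      else if ∃ x ∈ V, x.mem.settled = true then
        if ∃ x ∈ V, x.mem.settled = true ∧ x.mem.label = m.label then (m, none)
        else ({ m with label := 0 }, none)
      else if ∃ x ∈ V, x.mem.label ≠ 0 then
        if (pick V fun x => x.mem.label ≠ 0).id = self then
          ({ label := m.label, settled := true, parent := pin }, none)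
        else ({ m with label := (pick V fun x => x.mem.label ≠ 0).mem.label }, none)
      else (m, none)
  | .gather => (m, m.help)
  | .probe =>
      -- The inspecting move overwrites the incoming port, which for a helper is the way home.
      ({ m with home := if m.help = none then none else pin },
        if Team m.label m then
          some ((V.filter fun x => Helper m.label x.mem).card +
            (V.filter fun x => Team m.label x.mem ∧ x.id < self).card)
        else none)
  | .back =>
      -- Here an incoming port marks the agents that inspect a neighbour. A helper is itself settled
      -- for its group, so it has to disregard itself.
      if pin ≠ none then
        ({ m with fresh :=
            !decide (∃ x ∈ V, x.mem.settled = true ∧ x.mem.label = m.label ∧ x.id ≠ self) }, pin)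
      else if m.settled = true ∧ m.help = none ∧ ∃ x ∈ V, x.mem.label = m.label ∧ x.pin ≠ none then
        ({ m with
            fresh := false
            help := (pick V fun x => x.mem.label = m.label ∧ x.pin ≠ none).pin },
          (pick V fun x => x.mem.label = m.label ∧ x.pin ≠ none).pin)
      else ({ m with fresh := false }, none)
  | .decide =>
      if m.help ≠ none then
        ({ m with help := if Found V m.label ∨ Full V deg m.label then none else m.help },
          if m.home ≠ none then m.home else pin)
      else if m.settled = false then
        (m, if m.label ≠ 0 then target V deg m.label else none)
      else if ∃ x ∈ V, x.mem.settled = false ∧ x.mem.label = m.label then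
        ({ m with
            exit := if target V deg m.label = none then m.exit else target V deg m.label }, none)
      else (m, none)
  | .walk =>
      ({ m with best := 0 }, if m.settled = false ∧ ∃ x ∈ V, x.mem.settled = true then
          (pick V fun x => x.mem.settled = true).mem.exit else none)
  | .record =>
      if m.settled = false ∧ ∃ x ∈ V, x.mem.settled = true then
        ({ m with best := max m.best (pick V fun x => x.mem.settled = true).id },
          (pick V fun x => x.mem.settled = true).mem.exit)
      else (m, none)
  | .seek =>
      (m, if m.settled = false ∧ (∃ x ∈ V, x.mem.settled = true) ∧
            (pick V fun x => x.mem.settled = true).id ≠ m.best then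
          (pick V fun x => x.mem.settled = true).mem.exit else none)
  | .nop => (m, none)

/-- One attempt of the search: four steps away and back, then the arrivals are settled. -/
def cycle : List Instr := [.gather, .probe, .back, .decide, .resolve]

/-- A round with `R` search cycles. -/
def round (R : ℕ) : List Instr :=
  [.reset, .resolve] ++ (List.replicate R cycle).flatten ++
    (List.replicate R .walk ++ (List.replicate R .record ++ List.replicate R .seek))

/-- There are at most `k / 2` crowded nodes and `k ≤ idMax < 2 ^ idMax.size`, so `idMax.size`
halvings remove all of them. -/
def phase (idMax i : ℕ) : List Instr :=
  (List.replicate idMax.size (round (2 ^ i))).flatten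

/-- The number of phases ensures that a sufficiently long phase occurs and is followed by another
one, whose `.reset` stops the agents. -/
def program (idMax : ℕ) : List Instr :=
  (List.range (2 * idMax.size + 4)).flatMap (phase idMax)

def instr (idMax t : ℕ) : Instr := (program idMax).getD t .nop

/-- The state of an agent: a saturating clock and the memory. -/
structure St where
  clock : ℕ
  mem : Mem

def obsOf (x : ℕ × St × Option ℕ) : Obs := ⟨x.1, x.2.1.mem, x.2.2⟩

/-- A port outside the range means staying; so team members in excess of the degree wait at the
head. -/
def toPort (deg : ℕ) : Option ℕ → Option (Fin deg)
  | none => none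
  | some p => if h : p < deg then some ⟨p, h⟩ else none

/-- The own triple of the agent `self`. -/
def own (S : Finset (ℕ × St × Option ℕ)) (self : ℕ) : ℕ × St × Option ℕ :=
  if h : ∃ x ∈ S, x.1 = self then h.choose else (0, ⟨0, {}⟩, none)

abbrev algorithm : Algorithm where
  State := St
  init := ⟨0, {}⟩
  step idMax deg self S :=
    let me := own S self
    let r := act deg self (S.image obsOf) me.2.1.mem me.2.2 (instr idMax me.2.1.clock)
    (⟨min (me.2.1.clock + 1) (program idMax).length, r.1⟩, toPort deg r.2)

/-! ### Ports, configurations without clocks, and the link to executions -/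

variable {N : Network}

/-- The neighbour of `v` behind port `p`. -/
def nbr (v : N.Node) (p : ℕ) : N.Node :=
  if h : p < N.graph.degree v then ((N.port v).symm ⟨p, h⟩).1 else v

/-- The port at `v` that leads to `u`. -/
def prt (v u : N.Node) : ℕ :=
  if h : N.graph.Adj v u then (N.port v ⟨u, h⟩ : ℕ) else 0

theorem adj_nbr {v : N.Node} {p : ℕ} (h : p < N.graph.degree v) : N.graph.Adj v (nbr v p) := by
  unfold nbr; rw [dif_pos h]; exact ((N.port v).symm ⟨p, h⟩).2

theorem prt_lt {v u : N.Node} (h : N.graph.Adj v u) : prt v u < N.graph.degree v := by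
  unfold prt; rw [dif_pos h]; exact (N.port v ⟨u, h⟩).2

theorem nbr_prt {v u : N.Node} (h : N.graph.Adj v u) : nbr v (prt v u) = u := by
  have := prt_lt h
  unfold nbr; rw [dif_pos this]
  unfold prt; simp only [dif_pos h, Fin.eta, Equiv.symm_apply_apply]

theorem prt_nbr {v : N.Node} {p : ℕ} (h : p < N.graph.degree v) : prt v (nbr v p) = p := by
  have h1 := adj_nbr h
  unfold prt; rw [dif_pos h1]
  have : (⟨nbr v p, h1⟩ : N.graph.neighborSet v) = (N.port v).symm ⟨p, h⟩ := by
    apply Subtype.ext; unfold nbr; simp only [dif_pos h]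
  rw [this]; simp

theorem nbr_injOn {v : N.Node} {p q : ℕ} (hp : p < N.graph.degree v) (hq : q < N.graph.degree v)
    (h : nbr v p = nbr v q) : p = q := by
  rw [← prt_nbr hp, ← prt_nbr hq, h]

/-- The result of leaving `v` through an optional port. -/
def goto (v : N.Node) (o : Option ℕ) : N.Node × Option ℕ :=
  Algorithm.move v (toPort (N.graph.degree v) o)

@[simp] theorem goto_none (v : N.Node) : goto v none = (v, none) := rfl

theorem goto_some {v : N.Node} {p : ℕ} (h : p < N.graph.degree v) :
    goto v (some p) = (nbr v p, some (prt (nbr v p) v)) := by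
  have h1 := adj_nbr h
  unfold goto toPort Algorithm.move
  simp only [dif_pos h]
  have h2 : ((N.port v).symm ⟨p, h⟩).1 = nbr v p := by unfold nbr; rw [dif_pos h]
  refine Prod.ext h2 ?_
  unfold prt; rw [dif_pos h1.symm]
  have h3 : ∀ (x y : N.Node) (_ : x = y) (hx : N.graph.Adj x v) (hy : N.graph.Adj y v),
      some (N.port x ⟨v, hx⟩ : ℕ) = some (N.port y ⟨v, hy⟩ : ℕ) := by
    rintro x _ rfl _ _; rfl
  exact h3 _ _ h2 _ _

theorem goto_ge {v : N.Node} {p : ℕ} (h : ¬ p < N.graph.degree v) :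
    goto v (some p) = (v, none) := by
  unfold goto toPort Algorithm.move
  simp only [dif_neg h]

theorem goto_prt {v u : N.Node} (h : N.graph.Adj v u) :
    goto v (some (prt v u)) = (u, some (prt u v)) := by
  rw [goto_some (prt_lt h), nbr_prt h]

/-- A configuration without the clocks. -/
structure Conf (N : Network) where
  mem : N.Agent → Mem
  loc : N.Agent → N.Node
  pin : N.Agent → Option ℕ

namespace Conf

def obs (C : Conf N) (a : N.Agent) : Obs := ⟨N.ident a, C.mem a, C.pin a⟩

def view (C : Conf N) (v : N.Node) : Finset Obs :=
  (Finset.univ.filter fun b => C.loc b = v).image C.obs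

def act (C : Conf N) (I : Instr) (a : N.Agent) : Mem × Option ℕ :=
  Dispersion.act (N.graph.degree (C.loc a)) (N.ident a) (C.view (C.loc a)) (C.mem a) (C.pin a) I

def next (C : Conf N) (I : Instr) : Conf N where
  mem a := (C.act I a).1
  loc a := (goto (C.loc a) (C.act I a).2).1
  pin a := (goto (C.loc a) (C.act I a).2).2

def run (C : Conf N) (l : List Instr) : Conf N := l.foldl next C

@[simp] theorem run_nil (C : Conf N) : C.run [] = C := rfl
@[simp] theorem run_cons (C : Conf N) (I : Instr) (l : List Instr) :
    C.run (I :: l) = (C.next I).run l := rfl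
theorem run_append (C : Conf N) (l l' : List Instr) : C.run (l ++ l') = (C.run l).run l' :=
  List.foldl_append

theorem obs_injective (C : Conf N) : Function.Injective C.obs := fun _ _ h =>
  N.ident_injective (congrArg Obs.id h)

theorem exists_view {C : Conf N} {v : N.Node} {P : Obs → Prop} :
    (∃ x ∈ C.view v, P x) ↔ ∃ b, C.loc b = v ∧ P (C.obs b) := by
  simp [view]

theorem forall_view {C : Conf N} {v : N.Node} {P : Obs → Prop} :
    (∀ x ∈ C.view v, P x) ↔ ∀ b, C.loc b = v → P (C.obs b) := by
  simp [view]

/-- Distinct identifiers keep observations distinct, so an agent counts correctly what stands at its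
node. -/
theorem card_view (C : Conf N) (v : N.Node) (P : Obs → Prop) [DecidablePred P] :
    ((C.view v).filter P).card = (Finset.univ.filter fun b => C.loc b = v ∧ P (C.obs b)).card := by
  rw [← Finset.card_image_of_injective _ C.obs_injective]
  congr 1
  ext x
  simp only [view, Finset.mem_filter, Finset.mem_image, Finset.mem_univ, true_and]
  constructor
  · rintro ⟨⟨b, h1, rfl⟩, h2⟩
    exact ⟨b, ⟨h1, h2⟩, rfl⟩
  · rintro ⟨b, ⟨h1, h2⟩, rfl⟩
    exact ⟨⟨b, h1, rfl⟩, h2⟩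

/-- The effect of one step on an agent whose memory, node and incoming port are known. -/
theorem next_of {C : Conf N} {I : Instr} {a : N.Agent} {v : N.Node} {m : Mem} {q : Option ℕ}
    {r : Mem × Option ℕ} (hm : C.mem a = m) (hl : C.loc a = v) (hq : C.pin a = q)
    (h : Dispersion.act (N.graph.degree v) (N.ident a) (C.view v) m q I = r) :
    (C.next I).mem a = r.1 ∧ (C.next I).loc a = (goto v r.2).1 ∧
      (C.next I).pin a = (goto v r.2).2 := by
  subst hm hl hq h
  exact ⟨rfl, rfl, rfl⟩

theorem exists_pick {C : Conf N} {v : N.Node} {P : Obs → Prop}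
    (h : ∃ b, C.loc b = v ∧ P (C.obs b)) :
    ∃ b, C.loc b = v ∧ P (C.obs b) ∧ pick (C.view v) P = C.obs b := by
  have h1 : ∃ x ∈ C.view v, P x ∧ ∀ y ∈ C.view v, P y → x.id ≤ y.id := by
    obtain ⟨x, hx, hP⟩ := exists_view.2 h
    obtain ⟨y, hy, hmin⟩ := Finset.exists_min_image ((C.view v).filter P) Obs.id
      ⟨x, Finset.mem_filter.2 ⟨hx, hP⟩⟩
    rw [Finset.mem_filter] at hy
    exact ⟨y, hy.1, hy.2, fun z hz hPz => hmin z (Finset.mem_filter.2 ⟨hz, hPz⟩)⟩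
  have h2 : pick (C.view v) P = h1.choose := by unfold pick; rw [dif_pos h1]
  have h3 := h1.choose_spec
  rw [← h2] at h3
  obtain ⟨hm, hP, -⟩ := h3
  obtain ⟨b, hb, hb2⟩ := Finset.mem_image.1 hm
  refine ⟨b, (Finset.mem_filter.1 hb).2, hb2 ▸ hP, hb2.symm⟩

end Conf

/-- The placement `place` with empty memories. -/
def start (place : N.Agent → N.Node) : Conf N := ⟨fun _ => {}, place, fun _ => none⟩

/-- The configuration after `t` steps. -/
def conf (place : N.Agent → N.Node) : ℕ → Conf N
  | 0 => start place
  | t + 1 => (conf place t).next (instr N.idMax t)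

/-- A saturated clock loses nothing: past the end of the program every instruction is `.nop`. -/
theorem instr_min (m t : ℕ) : instr m (min t (program m).length) = instr m t := by
  unfold instr
  rcases le_total t (program m).length with h | h
  · rw [min_eq_left h]
  · rw [min_eq_right h, List.getD_eq_default _ _ le_rfl, List.getD_eq_default _ _ h]

/-- All clocks agree because the steps are synchronous, and every agent recognizes its own triple by
its identifier. So the clocks can be dropped in favour of one global list of instructions. -/
theorem exec_eq (place : N.Agent → N.Node) (t : ℕ) :
    (algorithm.exec (algorithm.initial place) t) =
      ⟨fun a => (⟨min t (program N.idMax).length, (conf place t).mem a⟩ : St),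
        (conf place t).loc, (conf place t).pin⟩ := by
  induction t with
  | zero => simp [Algorithm.exec, Algorithm.initial, conf, start, algorithm]
  | succ t ih =>
    have h1 : algorithm.exec (algorithm.initial place) (t + 1) =
        algorithm.next (algorithm.exec (algorithm.initial place) t) := by
      unfold Algorithm.exec; rw [Function.iterate_succ_apply']
    rw [h1, ih]
    set C := conf place t with hC
    have hact : ∀ a, algorithm.action (N := N)
        ⟨fun a => (⟨min t (program N.idMax).length, C.mem a⟩ : St), C.loc, C.pin⟩ a =
        ((⟨min (t + 1) (program N.idMax).length, (C.act (instr N.idMax t) a).1⟩ : St),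
          toPort (N.graph.degree (C.loc a)) (C.act (instr N.idMax t) a).2) := by
      intro a
      unfold Algorithm.action
      set S : Finset (ℕ × St × Option ℕ) := algorithm.agentsAt (N := N)
        ⟨fun a => (⟨min t (program N.idMax).length, C.mem a⟩ : St), C.loc, C.pin⟩ (C.loc a) with hS
      have hmem : ∀ x : ℕ × St × Option ℕ, x ∈ S ↔ ∃ b, C.loc b = C.loc a ∧
          (N.ident b, (⟨min t (program N.idMax).length, C.mem b⟩ : St), C.pin b) = x := by
        intro x; simp only [hS, Algorithm.agentsAt]; simp
      have himg : S.image obsOf = C.view (C.loc a) := by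
        ext o
        simp only [Finset.mem_image, hmem, Conf.view, Finset.mem_filter, Finset.mem_univ, true_and]
        constructor
        · rintro ⟨x, ⟨b, hb, rfl⟩, rfl⟩
          exact ⟨b, hb, rfl⟩
        · rintro ⟨b, hb, rfl⟩
          exact ⟨_, ⟨b, hb, rfl⟩, rfl⟩
      have hown : own S (N.ident a) =
          (N.ident a, (⟨min t (program N.idMax).length, C.mem a⟩ : St), C.pin a) := by
        have h : ∃ x ∈ S, x.1 = N.ident a := ⟨_, (hmem _).2 ⟨a, rfl, rfl⟩, rfl⟩
        have h2 : own S (N.ident a) = h.choose := by unfold own; rw [dif_pos h]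
        have h3 := h.choose_spec
        rw [← h2] at h3
        obtain ⟨b, hb, hb2⟩ := (hmem _).1 h3.1
        have : b = a := N.ident_injective (by rw [← h3.2, ← hb2])
        rw [← hb2, this]
      show (algorithm.step N.idMax (N.graph.degree (C.loc a)) (N.ident a) S) = _
      simp only [algorithm, hown, himg, instr_min]
      refine Prod.ext ?_ rfl
      simp only [Conf.act, St.mk.injEq, and_true]
      omega
    unfold Algorithm.next
    simp only [hact]
    rfl

theorem conf_eq_run (place : N.Agent → N.Node) {l l' : List Instr}
    (h : program N.idMax = l ++ l') : conf place l.length = (start place).run l := by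
  have : ∀ t ≤ l.length, conf place t = (start place).run (l.take t) := by
    intro t
    induction t with
    | zero => intro _; rfl
    | succ t ih =>
      intro ht
      rw [conf, ih (by omega), List.take_add_one, Conf.run_append]
      have h1 : l[t]? = some (l[t]) := List.getElem?_eq_getElem (by omega)
      have h2 : instr N.idMax t = l[t] := by
        unfold instr
        rw [h, List.getD_eq_getElem?_getD, List.getElem?_append_left (by omega), h1]; rfl
      rw [h1, h2]; rfl
  simpa using this l.length le_rfl

end Dispersion

/-! ### Stability of dispersed configurations -/

namespace Dispersion

open scoped Classical

variable {N : Network}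

/-- All agents are at different nodes, and none of them belongs to a group. -/
structure Calm (C : Conf N) : Prop where
  inj : Function.Injective C.loc
  mem : ∀ a, (C.mem a).label = 0 ∧ (C.mem a).settled = false ∧ (C.mem a).help = none
  pin : ∀ a, C.pin a = none

theorem Calm.reset {C : Conf N} (h : Function.Injective C.loc) :
    Calm (C.next .reset) ∧ (C.next .reset).loc = C.loc := by
  have h1 : ∀ a, C.act .reset a = ({}, none) := by
    intro a
    have : ∀ x ∈ C.view (C.loc a), x.id = N.ident a :=
      Conf.forall_view.2 fun b hb => by rw [h hb]; rfl
    simp only [Conf.act, act]; rw [if_pos this]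
  have h2 : (C.next .reset).loc = C.loc := by
    funext a; simp [Conf.next, h1]
  exact ⟨⟨h2 ▸ h, fun a => by simp [Conf.next, h1], fun a => by simp [Conf.next, h1]⟩, h2⟩

/-- Every move requires a label, an incoming port, a help port, or a settled agent at the node, and
a calm configuration has none of these. -/
theorem Calm.next {C : Conf N} (h : Calm C) (I : Instr) :
    Calm (C.next I) ∧ (C.next I).loc = C.loc := by
  rcases eq_or_ne I .reset with rfl | hI
  · exact Calm.reset h.inj
  have hs : ∀ a, ¬ ∃ x ∈ C.view (C.loc a), x.mem.settled = true := by
    intro a; rw [Conf.exists_view]; rintro ⟨b, -, hb⟩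
    have := (h.mem b).2.1
    simp [Conf.obs, this] at hb
  have hl : ∀ a, ¬ ∃ x ∈ C.view (C.loc a), x.mem.label ≠ 0 := by
    intro a; rw [Conf.exists_view]; rintro ⟨b, -, hb⟩
    exact hb (h.mem b).1
  have h1 : ∀ a, (C.act I a).2 = none ∧ (C.act I a).1.label = 0 ∧
      (C.act I a).1.settled = false ∧ (C.act I a).1.help = none := by
    intro a
    obtain ⟨ha, hb, hc⟩ := h.mem a
    have hd := h.pin a
    have h3 := hs a
    have h4 := hl a
    cases I <;> simp only [Conf.act, act, if_neg h3, if_neg h4, ha, hb, hc, hd, Team]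
    case reset => exact absurd rfl hI
    all_goals simp [ha, hb, hc, h3]
  have h2 : (C.next I).loc = C.loc := by
    funext a; simp [Conf.next, h1]
  exact ⟨⟨h2 ▸ h.inj, fun a => (h1 a).2, fun a => by simp [Conf.next, h1]⟩, h2⟩

/-- Distinct locations alone do not suffice, since leftover memories could still move the agents;
the next instruction has to be the `.reset` that erases them. -/
theorem legitimate_of_injective (place : N.Agent → N.Node) {l l' : List Instr}
    (hl : program N.idMax = l ++ .reset :: l')
    (h : Function.Injective ((start place).run l).loc) :
    algorithm.Legitimate (algorithm.exec (algorithm.initial place) l.length) := by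
  have h0 := conf_eq_run place hl
  have hI : instr N.idMax l.length = .reset := by
    unfold instr; rw [hl]; simp
  have h1 : ∀ t, Calm (conf place (l.length + (t + 1))) ∧
      (conf place (l.length + (t + 1))).loc = (conf place l.length).loc := by
    intro t
    induction t with
    | zero =>
      have := Calm.reset (C := conf place l.length) (by rw [h0]; exact h)
      rw [zero_add, conf, hI]; exact this
    | succ t ih =>
      have := ih.1.next (instr N.idMax (l.length + (t + 1)))
      rw [← add_assoc, conf]
      exact ⟨this.1, this.2.trans ih.2⟩
  refine ⟨by rw [exec_eq, h0]; exact h, fun t a => ?_⟩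
  have h2 : algorithm.exec (algorithm.exec (algorithm.initial place) l.length) t =
      algorithm.exec (algorithm.initial place) (l.length + t) := by
    unfold Algorithm.exec; rw [add_comm, Function.iterate_add_apply]
  rw [h2, exec_eq, exec_eq]
  cases t with
  | zero => rfl
  | succ t => exact congrFun (h1 t).2 a

end Dispersion

/-! ### The search invariant, and how arrivals are settled -/

namespace Dispersion

open scoped Classical

variable {N : Network}

namespace Conf

variable (C : Conf N)

/-- The group `ℓ` still has free agents. -/
def Active (ℓ : ℕ) : Prop := ℓ ≠ 0 ∧ ∃ a, (C.mem a).settled = false ∧ (C.mem a).label = ℓ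

/-- The node `x` is occupied by a settled agent of the group `ℓ`. -/
def Occ (ℓ : ℕ) (x : N.Node) : Prop :=
  ∃ a, (C.mem a).settled = true ∧ (C.mem a).label = ℓ ∧ C.loc a = x

/-- The exit port of the settled agent of group `ℓ` at `x` leads to `y`. -/
def ExitStep (ℓ : ℕ) (x y : N.Node) : Prop :=
  ∃ a p, (C.mem a).settled = true ∧ (C.mem a).label = ℓ ∧ C.loc a = x ∧
    (C.mem a).exit = some p ∧ p < N.graph.degree x ∧ nbr x p = y

def Reach (ℓ : ℕ) : N.Node → N.Node → Prop := Relation.ReflTransGen (C.ExitStep ℓ)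

def groupSize (ℓ : ℕ) : ℕ :=
  (Finset.univ.filter fun a => (C.mem a).settled = true ∧ (C.mem a).label = ℓ).card

/-- The settled agents at the nodes of the list store the port to the next node of the list. -/
def Stack (ℓ : ℕ) : List N.Node → Prop
  | [] => True
  | x :: l => (∃ a, (C.mem a).settled = true ∧ (C.mem a).label = ℓ ∧ C.loc a = x ∧
      ∀ y ∈ l.head?, N.graph.Adj x y ∧ (C.mem a).parent = some (prt x y)) ∧ Stack ℓ l

/-- Outside of the list, all neighbours of the nodes of the group are nodes of the group. -/
def Explored (ℓ : ℕ) (l : List N.Node) : Prop :=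
  ∀ x, C.Occ ℓ x → x ∉ l → ∀ y, N.graph.Adj x y → C.Occ ℓ y

/-- The group `ℓ` searches around its head `v` after `n` search cycles; its helpers come from the
nodes behind the first `h` ports of `v`. -/
def Search (W n ℓ : ℕ) (v : N.Node) : Prop :=
  ∃ (h : ℕ) (l : List N.Node) (j : ℕ),
    (∀ a p, (C.mem a).settled = true → (C.mem a).label = ℓ → (C.mem a).help = some p →
      N.graph.Adj v (C.loc a) ∧ prt v (C.loc a) < h ∧ p = prt (C.loc a) v) ∧
    (∀ i < h, i < N.graph.degree v ∧ ∃ a, (C.mem a).settled = true ∧ (C.mem a).label = ℓ ∧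
      (C.mem a).help ≠ none ∧ C.loc a = nbr v i) ∧
    C.Stack ℓ (v :: l) ∧ C.Explored ℓ (v :: l) ∧
    -- The potential: a settled agent contributes `2 * W` cycles. They pay for the `n` cycles used
    -- so far, for `W` per stack node kept for backtracking, and for the `W - j` cycles left to the
    -- present search, in which the helpers have doubled `j` times.
    2 ^ j ≤ h + 1 ∧ n + W * (l.length + 1) + W ≤ 2 * W * C.groupSize ℓ + j

/-- The free agents of the group `ℓ` have just arrived at `v`. -/
def Arrival (W n ℓ : ℕ) (v : N.Node) : Prop :=
  ¬ C.Occ ℓ v ∧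
    (∀ a, (C.mem a).settled = true → (C.mem a).label = ℓ → (C.mem a).help = none) ∧
    ∃ l : List N.Node, C.Stack ℓ l ∧ C.Explored ℓ l ∧
      n + W * l.length ≤ 2 * W * C.groupSize ℓ ∧
      -- The stack is empty only at the start of a round. Hence a group that gets blocked owns a
      -- settled agent.
      (l = [] → ∀ s, C.loc s = v → (C.mem s).settled = false) ∧
      ∀ y ∈ l.head?, N.graph.Adj v y ∧
        ∀ a, (C.mem a).settled = false → (C.mem a).label = ℓ → C.pin a = some (prt v y)

end Conf

/-- What holds at the end of every search cycle, before and after the arrivals are settled.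
`hd ℓ` is the node where the group `ℓ` is, or has been last. -/
structure Base (C : Conf N) (Λ : Finset ℕ) (hd : ℕ → N.Node) : Prop where
  settled_inj : ∀ a b, (C.mem a).settled = true → (C.mem b).settled = true →
    C.loc a = C.loc b → a = b
  settled_label : ∀ a, (C.mem a).settled = true → (C.mem a).label ≠ 0
  label_mem : ∀ a, (C.mem a).label ≠ 0 → (C.mem a).label ∈ Λ
  free_help : ∀ a, (C.mem a).settled = false → (C.mem a).help = none
  free_loc : ∀ a, (C.mem a).settled = false → (C.mem a).label ≠ 0 → C.loc a = hd (C.mem a).label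
  reach : ∀ a, (C.mem a).settled = true → C.Reach (C.mem a).label (C.loc a) (hd (C.mem a).label)
  inert : ∀ a s, (C.mem a).settled = false → (C.mem a).label = 0 → (C.mem s).settled = true →
    C.loc s = C.loc a → ∃ y, (C.mem y).settled = true ∧ (C.mem y).label ≠ (C.mem s).label ∧
      ¬ C.Active (C.mem y).label ∧ C.Reach (C.mem y).label (C.loc y) (C.loc a)
  help_active : ∀ a, (C.mem a).settled = true → ¬ C.Active (C.mem a).label →
    (C.mem a).help = none

/-- The state just before `.resolve`. The head of an active group may still lack a settled agent,
which is why `alone` ignores labelled agents and `exit_settled` admits heads. -/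
structure Pre (C : Conf N) (Λ : Finset ℕ) (hd : ℕ → N.Node) (W n : ℕ) : Prop
    extends Base C Λ hd where
  search : ∀ ℓ, C.Active ℓ → C.Search W n ℓ (hd ℓ) ∨ C.Arrival W n ℓ (hd ℓ)
  alone : ∀ a, (C.mem a).settled = false → (C.mem a).label = 0 →
    (∃ s, (C.mem s).settled = true ∧ C.loc s = C.loc a) ∨
      ∀ b, C.loc b = C.loc a → (C.mem b).label = 0 → b = a
  exit_settled : ∀ a p, (C.mem a).settled = true → (C.mem a).exit = some p →
    p < N.graph.degree (C.loc a) ∧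
      ((∃ s, (C.mem s).settled = true ∧ C.loc s = nbr (C.loc a) p) ∨
        ∃ ℓ, C.Active ℓ ∧ hd ℓ = nbr (C.loc a) p)

/-- The state just after `.resolve`: every active group again has a settled agent under its head. -/
structure Inv (C : Conf N) (Λ : Finset ℕ) (hd : ℕ → N.Node) (W n : ℕ) : Prop
    extends Base C Λ hd where
  search : ∀ ℓ, C.Active ℓ → C.Search W n ℓ (hd ℓ)
  alone : ∀ a, (C.mem a).settled = false → (C.mem a).label = 0 →
    (∃ s, (C.mem s).settled = true ∧ C.loc s = C.loc a) ∨ ∀ b, C.loc b = C.loc a → b = a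
  exit_settled : ∀ a p, (C.mem a).settled = true → (C.mem a).exit = some p →
    p < N.graph.degree (C.loc a) ∧ ∃ s, (C.mem s).settled = true ∧ C.loc s = nbr (C.loc a) p

namespace Conf

theorem Search.occ {C : Conf N} {W n ℓ : ℕ} {v : N.Node} (h : C.Search W n ℓ v) : C.Occ ℓ v := by
  obtain ⟨h, l, j, -, -, ⟨⟨a, h1, h2, h3, -⟩, -⟩, -⟩ := h
  exact ⟨a, h1, h2, h3⟩

theorem Stack.mono {C C' : Conf N} {ℓ : ℕ} {l : List N.Node}
    (h : ∀ a, (C.mem a).settled = true → (C.mem a).label = ℓ → (C'.mem a).settled = true ∧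
      (C'.mem a).label = ℓ ∧ C'.loc a = C.loc a ∧ (C'.mem a).parent = (C.mem a).parent)
    (hl : C.Stack ℓ l) : C'.Stack ℓ l := by
  induction l with
  | nil => trivial
  | cons x l ih =>
    obtain ⟨⟨a, h1, h2, h3, h4⟩, h5⟩ := hl
    obtain ⟨g1, g2, g3, g4⟩ := h a h1 h2
    exact ⟨⟨a, g1, g2, g3.trans h3, fun y hy => ⟨(h4 y hy).1, g4.trans (h4 y hy).2⟩⟩, ih h5⟩

theorem Stack.occ {C : Conf N} {ℓ : ℕ} {l : List N.Node} (hl : C.Stack ℓ l) :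
    ∀ x ∈ l.head?, C.Occ ℓ x := by
  cases l with
  | nil => simp
  | cons y l =>
    obtain ⟨⟨a, h1, h2, h3, -⟩, -⟩ := hl
    intro x hx
    obtain rfl : y = x := by simpa using hx
    exact ⟨a, h1, h2, h3⟩

/-- The free agent that settles at its node when the arrivals are settled. -/
def Winner (C : Conf N) (a : N.Agent) : Prop :=
  (C.mem a).settled = false ∧ (C.mem a).label ≠ 0 ∧
    (∀ s, C.loc s = C.loc a → (C.mem s).settled = false) ∧
    pick (C.view (C.loc a)) (fun x => x.mem.label ≠ 0) = C.obs a

theorem Winner.unique {C : Conf N} {a b : N.Agent} (ha : C.Winner a) (hb : C.Winner b)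
    (h : C.loc a = C.loc b) : a = b := by
  have h1 := ha.2.2.2
  rw [h, hb.2.2.2] at h1
  exact (C.obs_injective h1).symm

theorem exists_winner {C : Conf N} {v : N.Node} (h : ∀ s, C.loc s = v → (C.mem s).settled = false)
    (hl : ∃ b, C.loc b = v ∧ (C.mem b).label ≠ 0) : ∃ w, C.Winner w ∧ C.loc w = v := by
  obtain ⟨w, rfl, h2, h3⟩ := exists_pick (C := C) (v := v) (P := fun x => x.mem.label ≠ 0) hl
  exact ⟨w, ⟨h _ rfl, h2, h, h3⟩, rfl⟩

section Resolve

variable (C : Conf N)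

theorem resolve_act_snd (a : N.Agent) : (C.act .resolve a).2 = none := by
  simp only [act, Dispersion.act]
  split_ifs <;> rfl

@[simp] theorem resolve_loc : (C.next .resolve).loc = C.loc := by
  funext a; simp [next, resolve_act_snd]

variable {C}

theorem resolve_settled {a : N.Agent} (h : (C.mem a).settled = true) :
    (C.next .resolve).mem a = C.mem a := by
  simp [next, act, Dispersion.act, h]

theorem resolve_winner {a : N.Agent} (h : C.Winner a) :
    (C.next .resolve).mem a =
      { label := (C.mem a).label, settled := true, parent := C.pin a } := by
  obtain ⟨h1, h2, h3, h4⟩ := h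
  have h5 : ¬ ∃ x ∈ C.view (C.loc a), x.mem.settled = true := by
    rw [exists_view]; rintro ⟨b, hb, hb2⟩
    have := h3 b hb
    simp [obs, this] at hb2
  have h6 : ∃ x ∈ C.view (C.loc a), x.mem.label ≠ 0 := exists_view.2 ⟨a, rfl, h2⟩
  simp only [next, act, Dispersion.act, h1, if_neg h5, if_pos h6, h4]
  simp [obs]

theorem resolve_blocked {a s : N.Agent} (h : (C.mem a).settled = false)
    (hs : (C.mem s).settled = true) (hl : C.loc s = C.loc a) :
    (C.next .resolve).mem a = { C.mem a with
      label := if C.Occ (C.mem a).label (C.loc a) then (C.mem a).label else 0 } := by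
  have h5 : ∃ x ∈ C.view (C.loc a), x.mem.settled = true := exists_view.2 ⟨s, hl, hs⟩
  have h6 : (∃ x ∈ C.view (C.loc a), x.mem.settled = true ∧ x.mem.label = (C.mem a).label) ↔
      C.Occ (C.mem a).label (C.loc a) := by
    rw [exists_view]; unfold Occ
    exact ⟨fun ⟨b, h1, h2, h3⟩ => ⟨b, h2, h3, h1⟩, fun ⟨b, h1, h2, h3⟩ => ⟨b, h3, h1, h2⟩⟩
  have h7 : ¬ (C.mem a).settled = true := by simp [h]
  simp only [next, act, Dispersion.act, if_neg h7, if_pos h5, h6]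
  split_ifs <;> rfl

theorem resolve_join {a w : N.Agent} (hw : C.Winner w) (hl : C.loc w = C.loc a) (hne : w ≠ a) :
    (C.next .resolve).mem a = { C.mem a with label := (C.mem w).label } := by
  obtain ⟨h1, h2, h3, h4⟩ := hw
  rw [hl] at h3 h4
  have h5 : ¬ ∃ x ∈ C.view (C.loc a), x.mem.settled = true := by
    rw [exists_view]; rintro ⟨b, hb, hb2⟩
    have := h3 b hb
    simp [obs, this] at hb2
  have h6 : ∃ x ∈ C.view (C.loc a), x.mem.label ≠ 0 := exists_view.2 ⟨w, hl, h2⟩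
  have h7 : N.ident w ≠ N.ident a := fun h => hne (N.ident_injective h)
  simp only [next, act, Dispersion.act, h3 a rfl, if_neg h5, if_pos h6, h4]
  simp [obs, h7]

theorem resolve_idle {a : N.Agent} (h : ∀ s, C.loc s = C.loc a → (C.mem s).settled = false)
    (hl : ∀ s, C.loc s = C.loc a → (C.mem s).label = 0) :
    (C.next .resolve).mem a = C.mem a := by
  have h5 : ¬ ∃ x ∈ C.view (C.loc a), x.mem.settled = true := by
    rw [exists_view]; rintro ⟨b, hb, hb2⟩
    have := h b hb
    simp [obs, this] at hb2
  have h6 : ¬ ∃ x ∈ C.view (C.loc a), x.mem.label ≠ 0 := by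
    rw [exists_view]; rintro ⟨b, hb, hb2⟩
    exact hb2 (hl b hb)
  simp only [next, act, Dispersion.act, h a rfl, if_neg h5, if_neg h6]
  simp

/-- The five possibilities of an agent when the arrivals are settled. -/
theorem resolve_cases (C : Conf N) (a : N.Agent) :
    (C.mem a).settled = true ∨ C.Winner a ∨
    ((C.mem a).settled = false ∧ ∃ s, (C.mem s).settled = true ∧ C.loc s = C.loc a) ∨
    (∃ w, C.Winner w ∧ C.loc w = C.loc a ∧ w ≠ a) ∨
    ((∀ s, C.loc s = C.loc a → (C.mem s).settled = false) ∧
      ∀ s, C.loc s = C.loc a → (C.mem s).label = 0) := by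
  by_cases h1 : (C.mem a).settled = true
  · exact .inl h1
  rw [Bool.not_eq_true] at h1
  by_cases h2 : ∃ s, (C.mem s).settled = true ∧ C.loc s = C.loc a
  · exact .inr (.inr (.inl ⟨h1, h2⟩))
  have h3 : ∀ s, C.loc s = C.loc a → (C.mem s).settled = false := by
    intro s hs; by_contra h; exact h2 ⟨s, by simpa using h, hs⟩
  by_cases h4 : ∃ b, C.loc b = C.loc a ∧ (C.mem b).label ≠ 0
  · obtain ⟨w, hw, hwl⟩ := exists_winner h3 h4
    by_cases h5 : w = a
    · exact .inr (.inl (h5 ▸ hw))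
    · exact .inr (.inr (.inr (.inl ⟨w, hw, hwl, h5⟩)))
  · push Not at h4
    exact .inr (.inr (.inr (.inr ⟨h3, h4⟩)))

theorem resolve_settled_iff (C : Conf N) (a : N.Agent) :
    ((C.next .resolve).mem a).settled = true ↔ (C.mem a).settled = true ∨ C.Winner a := by
  rcases resolve_cases C a with h | h | ⟨h, s, hs, hl⟩ | ⟨w, hw, hl, hne⟩ | ⟨h, hl⟩
  · simp [resolve_settled h, h]
  · simp [resolve_winner h, h]
  · rw [resolve_blocked h hs hl]
    simp only [h, Bool.false_eq_true, false_or, false_iff]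
    intro hw
    simp [hw.2.2.1 s hl] at hs
  · have h1 := hw.2.2.1 a hl.symm
    rw [resolve_join hw hl hne]
    simp only [h1, Bool.false_eq_true, false_or, false_iff]
    intro h2
    exact hne (hw.unique h2 hl)
  · rw [resolve_idle h hl]
    simp only [h a rfl, Bool.false_eq_true, false_or, false_iff]
    intro h2
    exact h2.2.1 (hl a rfl)

theorem resolve_label_of_settled (C : Conf N) {a : N.Agent}
    (h : ((C.next .resolve).mem a).settled = true) :
    ((C.next .resolve).mem a).label = (C.mem a).label := by
  rcases (resolve_settled_iff C a).1 h with h | h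
  · rw [resolve_settled h]
  · rw [resolve_winner h]

theorem Occ.resolve {ℓ : ℕ} {x : N.Node} (h : C.Occ ℓ x) : (C.next .resolve).Occ ℓ x := by
  obtain ⟨a, h1, h2, h3⟩ := h
  exact ⟨a, by rw [resolve_settled h1, h1], by rw [resolve_settled h1, h2], by simp [h3]⟩

theorem Reach.resolve {ℓ : ℕ} {x y : N.Node} (h : C.Reach ℓ x y) :
    (C.next .resolve).Reach ℓ x y := by
  refine Relation.ReflTransGen.mono ?_ _ _ h
  rintro x y ⟨a, p, h1, h2, h3, h4, h5⟩
  exact ⟨a, p, by rw [resolve_settled h1, h1], by rw [resolve_settled h1, h2], by simp [h3],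
    by rw [resolve_settled h1, h4], h5⟩

end Resolve

end Conf

end Dispersion

/-! ### Settling the arrivals restores the invariant -/

namespace Dispersion

open scoped Classical

variable {N : Network} {C : Conf N} {Λ : Finset ℕ} {hd : ℕ → N.Node} {W n : ℕ}

open Conf

/-- If no agent settles for the group `ℓ`, its settled agents stay the same. -/
theorem Conf.resolve_settled_label {ℓ : ℕ} (h : ∀ a, C.Winner a → (C.mem a).label ≠ ℓ) (a : N.Agent) :
    ((C.next .resolve).mem a).settled = true ∧ ((C.next .resolve).mem a).label = ℓ ↔
      (C.mem a).settled = true ∧ (C.mem a).label = ℓ := by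
  constructor
  · rintro ⟨h1, h2⟩
    rw [resolve_label_of_settled C h1] at h2
    rcases (resolve_settled_iff C a).1 h1 with h3 | h3
    · exact ⟨h3, h2⟩
    · exact absurd h2 (h a h3)
  · rintro ⟨h1, h2⟩
    rw [resolve_settled h1]; exact ⟨h1, h2⟩

theorem Conf.Search.resolve {ℓ : ℕ} {v : N.Node} (h : ∀ a, C.Winner a → (C.mem a).label ≠ ℓ)
    (hs : C.Search W n ℓ v) : (C.next .resolve).Search W n ℓ v := by
  have h0 := resolve_settled_label h
  have hocc : ∀ x, (C.next .resolve).Occ ℓ x → C.Occ ℓ x := by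
    rintro x ⟨a, h1, h2, h3⟩
    obtain ⟨h4, h5⟩ := (h0 a).1 ⟨h1, h2⟩
    exact ⟨a, h4, h5, by simpa using h3⟩
  obtain ⟨k, l, j, h1, h2, h3, h4, h5, h6⟩ := hs
  refine ⟨k, l, j, ?_, ?_, ?_, ?_, h5, ?_⟩
  · intro a p ha hb hc
    obtain ⟨h4, h5⟩ := (h0 a).1 ⟨ha, hb⟩
    rw [resolve_settled h4] at hc
    simpa using h1 a p h4 h5 hc
  · intro i hi
    obtain ⟨g1, a, g2, g3, g4, g5⟩ := h2 i hi
    refine ⟨g1, a, ?_⟩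
    rw [resolve_settled g2]
    exact ⟨g2, g3, g4, by simpa using g5⟩
  · refine Stack.mono (fun a g1 g2 => ?_) h3
    rw [resolve_settled g1]; exact ⟨g1, g2, by simp, rfl⟩
  · intro x hx hxl y hy
    exact (h4 x (hocc x hx) hxl y hy).resolve
  · have : (C.next .resolve).groupSize ℓ = C.groupSize ℓ := by
      unfold groupSize; congr 1; ext a; simp only [Finset.mem_filter]; rw [h0]
    rw [this]; exact h6

/-- The winner becomes the top of the stack, and its incoming port is the edge to the previous head.
Its contribution of `2 * W` covers one further stack node and a new search with `j = 0`. -/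
theorem Conf.Arrival.resolve (hB : Base C Λ hd) {ℓ : ℕ} {w : N.Agent}
    (hA : C.Arrival W n ℓ (hd ℓ)) (hw : C.Winner w) (hwl : (C.mem w).label = ℓ) :
    (C.next .resolve).Search W n ℓ (hd ℓ) := by
  obtain ⟨h1, h2, l, h3, h4, h5, -, h6⟩ := hA
  have hloc : C.loc w = hd ℓ := by rw [← hwl]; exact hB.free_loc w hw.1 hw.2.1
  have hset : ∀ a, ((C.next .resolve).mem a).settled = true →
      ((C.next .resolve).mem a).label = ℓ → a ≠ w →
      (C.mem a).settled = true ∧ (C.mem a).label = ℓ := by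
    intro a ha hb hne
    rw [resolve_label_of_settled C ha] at hb
    rcases (resolve_settled_iff C a).1 ha with h | h
    · exact ⟨h, hb⟩
    · refine absurd (h.unique hw ?_) hne
      rw [hloc, hB.free_loc a h.1 h.2.1, hb]
  have hmono : ∀ a, (C.mem a).settled = true → (C.mem a).label = ℓ →
      ((C.next .resolve).mem a).settled = true ∧ ((C.next .resolve).mem a).label = ℓ ∧
      (C.next .resolve).loc a = C.loc a ∧
      ((C.next .resolve).mem a).parent = (C.mem a).parent := by
    intro a ha hb
    rw [resolve_settled ha]; exact ⟨ha, hb, by simp, rfl⟩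
  refine ⟨0, l, 0, ?_, by simp, ⟨⟨w, ?_⟩, h3.mono hmono⟩, ?_, by simp, ?_⟩
  · intro a p ha hb hc
    by_cases hne : a = w
    · subst hne; rw [resolve_winner hw] at hc; simp at hc
    · obtain ⟨g1, g2⟩ := hset a ha hb hne
      rw [resolve_settled g1, h2 a g1 g2] at hc; simp at hc
  · rw [resolve_winner hw]
    refine ⟨rfl, hwl, by simpa using hloc, fun y hy => ⟨(h6 y hy).1, (h6 y hy).2 w hw.1 hwl⟩⟩
  · intro x hx hxl y hy
    obtain ⟨a, g1, g2, g3⟩ := hx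
    by_cases hne : a = w
    · subst hne; simp [hloc] at g3; simp [g3] at hxl
    · obtain ⟨g4, g5⟩ := hset a g1 g2 hne
      exact (h4 x ⟨a, g4, g5, by simpa using g3⟩ (fun h => hxl (List.mem_cons_of_mem _ h)) y
        hy).resolve
  · have : C.groupSize ℓ + 1 ≤ (C.next .resolve).groupSize ℓ := by
      unfold groupSize
      rw [← Finset.card_insert_of_notMem (a := w)]
      · refine Finset.card_le_card fun a ha => ?_
        rw [Finset.mem_insert, Finset.mem_filter] at ha
        rw [Finset.mem_filter]
        refine ⟨Finset.mem_univ _, ?_⟩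
        rcases ha with rfl | ⟨-, ha, hb⟩
        · rw [resolve_winner hw]; exact ⟨rfl, hwl⟩
        · exact ⟨(hmono a ha hb).1, (hmono a ha hb).2.1⟩
      · simp [hw.1]
    have h7 := Nat.mul_le_mul_left (2 * W) this
    rw [Nat.mul_add, mul_one] at h7
    rw [Nat.mul_add, mul_one]
    omega

/-- A group that is still active has a winner or has been there before. -/
theorem Pre.active_resolve (hP : Pre C Λ hd W n) {ℓ : ℕ} (hA : (C.next .resolve).Active ℓ) :
    C.Active ℓ ∧ (C.Occ ℓ (hd ℓ) ∨ ∃ w, C.Winner w ∧ (C.mem w).label = ℓ) := by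
  obtain ⟨h0, a, h1, h2⟩ := hA
  have hlab : ∀ b, (C.mem b).settled = false → (C.mem b).label = ℓ → C.Active ℓ :=
    fun b hb hb2 => ⟨h0, b, hb, hb2⟩
  rcases resolve_cases C a with h | h | ⟨h, s, hs, hl⟩ | ⟨w, hw, hl, hne⟩ | ⟨h, hl⟩
  · rw [resolve_settled h, h] at h1; simp at h1
  · rw [resolve_winner h] at h1; simp at h1
  · rw [resolve_blocked h hs hl] at h2
    simp only at h2
    split_ifs at h2 with h3
    · refine ⟨hlab a h h2, .inl ?_⟩
      rw [hB_loc hP h (by rw [h2]; exact h0), h2] at h3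
      exact h3
    · exact absurd h2.symm h0
  · rw [resolve_join hw hl hne] at h2
    exact ⟨hlab w hw.1 h2, .inr ⟨w, hw, h2⟩⟩
  · rw [resolve_idle h hl, hl a rfl] at h2
    exact absurd h2.symm h0
where
  hB_loc (hP : Pre C Λ hd W n) {a : N.Agent} (h : (C.mem a).settled = false)
      (h2 : (C.mem a).label ≠ 0) : C.loc a = hd (C.mem a).label := hP.free_loc a h h2

/-- A group in `Search` stands on a node of its own and is unaffected. A group in `Arrival` provides
the winner, joins the group of the winner, or is blocked; in the last two cases it is no longer
active. -/
theorem Pre.resolve (hP : Pre C Λ hd W n) : Inv (C.next .resolve) Λ hd W n where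
  settled_inj a b ha hb hab := by
    simp only [resolve_loc] at hab
    rcases (resolve_settled_iff C a).1 ha with h | h <;>
      rcases (resolve_settled_iff C b).1 hb with h' | h'
    · exact hP.settled_inj a b h h' hab
    · have := h'.2.2.1 a hab; simp [h] at this
    · have := h.2.2.1 b hab.symm; simp [h'] at this
    · exact h.unique h' hab
  settled_label a ha := by
    rw [resolve_label_of_settled C ha]
    rcases (resolve_settled_iff C a).1 ha with h | h
    · exact hP.settled_label a h
    · exact h.2.1
  label_mem a ha := by
    rcases resolve_cases C a with h | h | ⟨h, s, hs, hl⟩ | ⟨w, hw, hl, hne⟩ | ⟨h, hl⟩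
    · rw [resolve_settled h] at ha ⊢; exact hP.label_mem a ha
    · rw [resolve_winner h] at ha ⊢; exact hP.label_mem a ha
    · rw [resolve_blocked h hs hl] at ha ⊢
      simp only at ha ⊢
      split_ifs at ha ⊢
      · exact hP.label_mem a ha
      · exact absurd rfl ha
    · rw [resolve_join hw hl hne] at ha ⊢; exact hP.label_mem w ha
    · rw [resolve_idle h hl] at ha ⊢; exact hP.label_mem a ha
  free_help a ha := by
    rcases resolve_cases C a with h | h | ⟨h, s, hs, hl⟩ | ⟨w, hw, hl, hne⟩ | ⟨h, hl⟩
    · rw [resolve_settled h] at ha ⊢; exact hP.free_help a ha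
    · rw [resolve_winner h]
    · rw [resolve_blocked h hs hl] at ha ⊢; exact hP.free_help a ha
    · rw [resolve_join hw hl hne] at ha ⊢; exact hP.free_help a ha
    · rw [resolve_idle h hl] at ha ⊢; exact hP.free_help a ha
  free_loc a ha hb := by
    simp only [resolve_loc]
    rcases resolve_cases C a with h | h | ⟨h, s, hs, hl⟩ | ⟨w, hw, hl, hne⟩ | ⟨h, hl⟩
    · rw [resolve_settled h] at ha hb ⊢; exact hP.free_loc a ha hb
    · rw [resolve_winner h] at ha; simp at ha
    · rw [resolve_blocked h hs hl] at ha hb ⊢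
      simp only at hb ⊢
      split_ifs at hb ⊢
      · exact hP.free_loc a ha hb
      · exact absurd rfl hb
    · rw [resolve_join hw hl hne] at ha hb ⊢
      rw [← hl]; exact hP.free_loc w hw.1 hb
    · rw [resolve_idle h hl] at ha hb ⊢; exact hP.free_loc a ha hb
  reach a ha := by
    rw [resolve_label_of_settled C ha]
    simp only [resolve_loc]
    rcases (resolve_settled_iff C a).1 ha with h | h
    · exact (hP.reach a h).resolve
    · rw [hP.free_loc a h.1 h.2.1]; exact .refl
  inert a s ha hb hs hl := by
    simp only [resolve_loc] at hl ⊢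
    have key : ∀ y, (C.mem y).settled = true → (C.mem y).label ≠ (C.mem s).label →
        ¬ (C.next .resolve).Active (C.mem y).label → C.Reach (C.mem y).label (C.loc y) (C.loc a) →
        ∃ y, ((C.next .resolve).mem y).settled = true ∧
          ((C.next .resolve).mem y).label ≠ ((C.next .resolve).mem s).label ∧
          ¬ (C.next .resolve).Active ((C.next .resolve).mem y).label ∧ (C.next .resolve).Reach ((C.next .resolve).mem y).label (C.loc y) (C.loc a) := by
      intro y h1 h2 h3 h4
      refine ⟨y, ?_⟩
      rw [resolve_label_of_settled C hs, resolve_settled h1]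
      exact ⟨h1, h2, h3, h4.resolve⟩
    rcases resolve_cases C a with h | h | ⟨h, s', hs', hl'⟩ | ⟨w, hw, hl', hne⟩ | ⟨h, hl'⟩
    · rw [resolve_settled h, h] at ha; simp at ha
    · rw [resolve_winner h] at ha; simp at ha
    · have hs2 : (C.mem s).settled = true := by
        rcases (resolve_settled_iff C s).1 hs with h1 | h1
        · exact h1
        · have := h1.2.2.1 s' (hl'.trans hl.symm); simp [hs'] at this
      by_cases h0 : (C.mem a).label = 0
      · obtain ⟨y, h1, h2, h3, h4⟩ := hP.inert a s h h0 hs2 hl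
        exact key y h1 h2 (fun h5 => h3 (hP.active_resolve h5).1) h4
      rw [resolve_blocked h hs' hl'] at hb
      simp only at hb
      split_ifs at hb with hocc
      · exact absurd hb h0
      have hloc := hP.free_loc a h h0
      rcases hP.search _ ⟨h0, a, h, rfl⟩ with h1 | ⟨h1, -, l, h3, -, -, h4, -⟩
      · rw [hloc] at hocc; exact absurd h1.occ hocc
      -- The settled agent at the top of the stack of the blocked group is the witness: its exit
      -- path ends at the head, which is this node.
      · cases l with
        | nil =>
          have := h4 rfl s (hl.trans hloc)
          rw [this] at hs2; simp at hs2
        | cons x l =>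
          obtain ⟨y, g1, g2, g3⟩ := h3.occ x (by simp)
          refine key y g1 ?_ ?_ ?_
          · intro h5
            exact hocc ⟨s, hs2, h5.symm.trans g2, hl⟩
          · intro h5
            rw [g2] at h5
            rcases (hP.active_resolve h5).2 with h6 | ⟨w, hw, hwl⟩
            · exact h1 h6
            · have h6 := hw.2.2.1 s (by rw [hl, hloc, hP.free_loc w hw.1 hw.2.1, hwl])
              simp [hs2] at h6
          · rw [hloc, ← g2]; exact hP.reach y g1
    · rw [resolve_join hw hl' hne] at hb
      exact absurd hb hw.2.1
    · rcases (resolve_settled_iff C s).1 hs with h1 | h1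
      · rw [h s hl] at h1; simp at h1
      · exact absurd (hl' s hl) h1.2.1
  help_active a ha hb := by
    rcases (resolve_settled_iff C a).1 ha with h | h
    · rw [resolve_settled h] at hb ⊢
      -- A group in `Search` keeps its free agents and stays active; in `Arrival` the help ports
      -- have already been cleared.
      by_cases hact : C.Active (C.mem a).label
      · rcases hP.search _ hact with h1 | h1
        · exfalso
          obtain ⟨g1, b, g2, g3⟩ := hact
          obtain ⟨s, g4, g5, g6⟩ := h1.occ
          have g7 : C.loc b = hd (C.mem a).label := by
            rw [← g3]; exact hP.free_loc b g2 (by rw [g3]; exact g1)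
          refine hb ⟨g1, b, ?_⟩
          rw [resolve_blocked g2 g4 (g6.trans g7.symm), if_pos]
          · exact ⟨g2, g3⟩
          · rw [g3, g7]; exact ⟨s, g4, g5, g6⟩
        · exact h1.2.1 a h rfl
      · exact hP.help_active a h hact
    · rw [resolve_winner h]
  search ℓ hA := by
    obtain ⟨h1, h2⟩ := hP.active_resolve hA
    rcases hP.search ℓ h1 with h3 | h3
    · refine h3.resolve fun a ha hal => ?_
      obtain ⟨s, g1, g2, g3⟩ := h3.occ
      have := ha.2.2.1 s (by rw [g3, hP.free_loc a ha.1 ha.2.1, hal])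
      simp [g1] at this
    · rcases h2 with h2 | ⟨w, hw, hwl⟩
      · exact absurd h2 h3.1
      · exact h3.resolve hP.toBase hw hwl
  alone a ha hb := by
    simp only [resolve_loc]
    rcases resolve_cases C a with h | h | ⟨h, s, hs, hl⟩ | ⟨w, hw, hl, hne⟩ | ⟨h, hl⟩
    · rw [resolve_settled h, h] at ha; simp at ha
    · rw [resolve_winner h] at ha; simp at ha
    · exact .inl ⟨s, by rw [resolve_settled hs, hs], hl⟩
    · exact .inl ⟨w, by rw [resolve_winner hw], hl⟩
    · right
      intro b hbl
      rcases hP.alone a (h a rfl) (hl a rfl) with ⟨s, h1, h2⟩ | h1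
      · rw [h s h2] at h1; simp at h1
      · exact h1 b hbl (hl b hbl)
  exit_settled a p ha hb := by
    rw [resolve_loc]
    rcases (resolve_settled_iff C a).1 ha with h | h
    · rw [resolve_settled h] at hb
      obtain ⟨h1, h2⟩ := hP.exit_settled a p h hb
      refine ⟨h1, ?_⟩
      rcases h2 with ⟨s, hs, hl⟩ | ⟨ℓ, ⟨g1, b, g2, g3⟩, g4⟩
      · exact ⟨s, by rw [resolve_settled hs, hs], hl⟩
      · have g5 : C.loc b = hd ℓ := by rw [← g3]; exact hP.free_loc b g2 (by rw [g3]; exact g1)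
        -- If nobody is settled at this head, the arrivals elect a winner there, so the exit port
        -- leads to a settled node after all.
        by_cases g6 : ∃ s, (C.mem s).settled = true ∧ C.loc s = C.loc b
        · obtain ⟨s, hs, hl⟩ := g6
          exact ⟨s, by rw [resolve_settled hs, hs], by rw [hl, g5, g4]⟩
        · push Not at g6
          obtain ⟨w, hw, hwl⟩ := exists_winner (C := C) (v := C.loc b)
            (fun s hs => by
              by_contra h; exact g6 s (by simpa using h) hs) ⟨b, rfl, by rw [g3]; exact g1⟩
          exact ⟨w, by rw [resolve_winner hw], by rw [hwl, g5, g4]⟩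
    · rw [resolve_winner h] at hb; simp at hb

end Dispersion

/-! ### Gathering at the head and inspecting its neighbours -/

namespace Dispersion

open scoped Classical

variable {N : Network}

theorem card_eq_of_bijOn {α : Type*} {s : Finset α} {m : ℕ} (f : α → ℕ)
    (hinj : ∀ a ∈ s, ∀ b ∈ s, f a = f b → a = b) (hmaps : ∀ a ∈ s, f a < m)
    (hsurj : ∀ i < m, ∃ a ∈ s, f a = i) : s.card = m := by
  have h : s.image f = Finset.range m := by
    ext i; simp only [Finset.mem_image, Finset.mem_range]
    exact ⟨fun ⟨a, ha, hi⟩ => hi ▸ hmaps a ha, hsurj i⟩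
  rw [← Finset.card_image_of_injOn (f := f) (fun a ha b hb => hinj a ha b hb), h,
    Finset.card_range]

namespace Conf

variable (C : Conf N)

def team (ℓ : ℕ) : Finset N.Agent := Finset.univ.filter fun b => Team ℓ (C.mem b)

def helperCount (ℓ : ℕ) : ℕ := (Finset.univ.filter fun b => Helper ℓ (C.mem b)).card

/-- The number of team members of the group with a smaller identifier. -/
def rank (ℓ : ℕ) (a : N.Agent) : ℕ := ((C.team ℓ).filter fun b => N.ident b < N.ident a).card

/-- The port through which a member of the team searches. -/
def probePort (a : N.Agent) : ℕ := C.helperCount (C.mem a).label + C.rank (C.mem a).label a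

variable {C}

theorem mem_team {ℓ : ℕ} {a : N.Agent} : a ∈ C.team ℓ ↔ Team ℓ (C.mem a) := by simp [team]

theorem rank_lt_rank {ℓ : ℕ} {a b : N.Agent} (ha : a ∈ C.team ℓ) (h : N.ident a < N.ident b) :
    C.rank ℓ a < C.rank ℓ b := by
  refine Finset.card_lt_card ⟨fun c hc => ?_, fun hs => ?_⟩
  · rw [Finset.mem_filter] at hc ⊢; exact ⟨hc.1, hc.2.trans h⟩
  · have := hs (Finset.mem_filter.2 ⟨ha, h⟩)
    rw [Finset.mem_filter] at this; exact lt_irrefl _ this.2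

theorem rank_injOn {ℓ : ℕ} {a b : N.Agent} (ha : a ∈ C.team ℓ) (hb : b ∈ C.team ℓ)
    (h : C.rank ℓ a = C.rank ℓ b) : a = b := by
  rcases lt_trichotomy (N.ident a) (N.ident b) with h1 | h1 | h1
  · exact absurd h (rank_lt_rank ha h1).ne
  · exact N.ident_injective h1
  · exact absurd h (rank_lt_rank hb h1).ne'

theorem rank_lt {ℓ : ℕ} {a : N.Agent} (ha : a ∈ C.team ℓ) : C.rank ℓ a < (C.team ℓ).card := by
  refine Finset.card_lt_card ⟨Finset.filter_subset _ _, fun hs => ?_⟩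
  have := hs ha
  rw [Finset.mem_filter] at this; exact lt_irrefl _ this.2

theorem exists_rank {ℓ i : ℕ} (hi : i < (C.team ℓ).card) : ∃ a ∈ C.team ℓ, C.rank ℓ a = i := by
  have h : (C.team ℓ).image (C.rank ℓ) = Finset.range (C.team ℓ).card := by
    refine Finset.eq_of_subset_of_card_le (fun i hi => ?_) ?_
    · obtain ⟨a, ha, rfl⟩ := Finset.mem_image.1 hi
      exact Finset.mem_range.2 (rank_lt ha)
    · rw [Finset.card_image_of_injOn (fun a ha b hb => rank_injOn ha hb), Finset.card_range]
  rw [← Finset.mem_range, ← h, Finset.mem_image] at hi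
  exact hi

end Conf

open Conf

variable {C : Conf N} {Λ : Finset ℕ} {hd : ℕ → N.Node} {W n : ℕ}

section Probing

variable (hI : Inv C Λ hd W n)
include hI

theorem Inv.settled_of_help {a : N.Agent} (h : (C.mem a).help ≠ none) :
    (C.mem a).settled = true := by
  by_contra hs
  exact h (hI.free_help a (by simpa using hs))

theorem Inv.active_of_help {a : N.Agent} (h : (C.mem a).help ≠ none) :
    C.Active (C.mem a).label := by
  by_contra hs
  exact h (hI.help_active a (hI.settled_of_help h) hs)

theorem Inv.team_of_help {a : N.Agent} (h : (C.mem a).help ≠ none) :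
    Team (C.mem a).label (C.mem a) :=
  ⟨rfl, hI.settled_label a (hI.settled_of_help h), .inr h⟩

theorem Inv.active_of_team {ℓ : ℕ} {a : N.Agent} (h : Team ℓ (C.mem a)) : C.Active ℓ := by
  obtain ⟨h1, h2, h3⟩ := h
  by_cases h4 : (C.mem a).help = none
  · exact ⟨h2, a, by simpa [h4] using h3, h1⟩
  · exact h1 ▸ hI.active_of_help h4

/-- Settled agents are at distinct nodes, so helpers correspond bijectively to the first `h` ports
of the head. The existential `h` of `Search` is therefore the number of helpers, which the team can
count on the spot. -/
theorem Inv.search_helperCount {ℓ : ℕ} (hA : C.Active ℓ) :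
    (∀ a, (C.mem a).label = ℓ → (C.mem a).help ≠ none → N.graph.Adj (hd ℓ) (C.loc a) ∧
      prt (hd ℓ) (C.loc a) < C.helperCount ℓ ∧ (C.mem a).help = some (prt (C.loc a) (hd ℓ))) ∧
    (∀ i < C.helperCount ℓ, i < N.graph.degree (hd ℓ) ∧ ∃ a, (C.mem a).settled = true ∧
      (C.mem a).label = ℓ ∧ (C.mem a).help ≠ none ∧ C.loc a = nbr (hd ℓ) i) ∧
    ∃ (l : List N.Node) (j : ℕ), C.Stack ℓ (hd ℓ :: l) ∧ C.Explored ℓ (hd ℓ :: l) ∧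
      2 ^ j ≤ C.helperCount ℓ + 1 ∧ n + W * (l.length + 1) + W ≤ 2 * W * C.groupSize ℓ + j := by
  obtain ⟨h, l, j, h1, h2, h3, h4, h5, h6⟩ := hI.search ℓ hA
  have g1 : ∀ a, (C.mem a).label = ℓ → (C.mem a).help ≠ none → N.graph.Adj (hd ℓ) (C.loc a) ∧
      prt (hd ℓ) (C.loc a) < h ∧ (C.mem a).help = some (prt (C.loc a) (hd ℓ)) := by
    intro a ha hb
    obtain ⟨p, hp⟩ := Option.ne_none_iff_exists'.1 hb
    obtain ⟨f1, f2, f3⟩ := h1 a p (hI.settled_of_help hb) ha hp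
    exact ⟨f1, f2, by rw [hp, f3]⟩
  have hcard : C.helperCount ℓ = h := by
    refine card_eq_of_bijOn (fun a => prt (hd ℓ) (C.loc a)) ?_ ?_ ?_
    · intro a ha b hb hab
      replace ha := (Finset.mem_filter.1 ha).2
      replace hb := (Finset.mem_filter.1 hb).2
      refine hI.settled_inj a b (hI.settled_of_help ha.2) (hI.settled_of_help hb.2) ?_
      rw [← nbr_prt (g1 a ha.1 ha.2).1, ← nbr_prt (g1 b hb.1 hb.2).1]
      rw [hab]
    · intro a ha
      replace ha := (Finset.mem_filter.1 ha).2
      exact (g1 a ha.1 ha.2).2.1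
    · intro i hi
      obtain ⟨f1, a, f2, f3, f4, f5⟩ := h2 i hi
      exact ⟨a, Finset.mem_filter.2 ⟨Finset.mem_univ _, f3, f4⟩, by simp only [f5, prt_nbr f1]⟩
  rw [hcard]
  exact ⟨g1, h2, l, j, h3, h4, h5, h6⟩

theorem Inv.gather_of_help {a : N.Agent} (h : (C.mem a).help ≠ none) :
    (C.next .gather).loc a = hd (C.mem a).label ∧
      (C.next .gather).pin a = some (prt (hd (C.mem a).label) (C.loc a)) := by
  obtain ⟨h1, h2, h3⟩ := (hI.search_helperCount (hI.active_of_help h)).1 a rfl h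
  simp only [next, Conf.act, Dispersion.act, h3, goto_prt h1.symm, and_self]

omit hI in
theorem Conf.gather_of_none {a : N.Agent} (h : (C.mem a).help = none) :
    (C.next .gather).loc a = C.loc a ∧ (C.next .gather).pin a = none := by
  simp [next, Conf.act, Dispersion.act, h]

omit hI in
@[simp] theorem Conf.gather_mem (a : N.Agent) : (C.next .gather).mem a = C.mem a := rfl

theorem Inv.gather_loc_team {ℓ : ℕ} {a : N.Agent} (h : Team ℓ (C.mem a)) :
    (C.next .gather).loc a = hd ℓ := by
  by_cases h1 : (C.mem a).help = none
  · have h2 : (C.mem a).settled = false := by simpa [h1] using h.2.2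
    rw [(gather_of_none h1).1, ← h.1]
    exact hI.free_loc a h2 (by rw [h.1]; exact h.2.1)
  · rw [(hI.gather_of_help h1).1, h.1]

/-- The configuration in which the team members are at the nodes that they inspect. -/
def Conf.probed (C : Conf N) : Conf N := (C.next .gather).next .probe

theorem Inv.probed_mem (a : N.Agent) : C.probed.mem a = { C.mem a with
    home := if (C.mem a).help = none then none else
      some (prt (hd (C.mem a).label) (C.loc a)) } := by
  rw [Conf.probed, (next_of (I := .probe) (gather_mem a) rfl rfl rfl).1]
  simp only [Dispersion.act]
  by_cases h : (C.mem a).help = none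
  · rw [if_pos h, if_pos h]
  · rw [if_neg h, if_neg h, (hI.gather_of_help h).2]

/-- After `.gather` the whole team is at the head, so the locally counted numbers are the global
`helperCount` and `rank`. Ports towards helpers are skipped, and ranks keep the inspected ports
apart. -/
theorem Inv.probed_team {ℓ : ℕ} {a : N.Agent} (h : Team ℓ (C.mem a)) :
    (C.probed.loc a, C.probed.pin a) = goto (hd ℓ) (some (C.probePort a)) := by
  have h1 := hI.gather_loc_team h
  obtain ⟨hl, h2, h3⟩ := h
  subst hl
  have hT : Team (C.mem a).label ((C.next .gather).mem a) := ⟨rfl, h2, h3⟩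
  have e1 : (((C.next .gather).view (hd (C.mem a).label)).filter
      fun x => Helper (C.mem a).label x.mem).card = C.helperCount (C.mem a).label := by
    rw [card_view]; unfold helperCount; congr 1; ext b
    simp only [Finset.mem_filter, Finset.mem_univ, true_and]
    refine ⟨fun h => h.2, fun h => ⟨?_, h⟩⟩
    obtain ⟨h4, h5⟩ := h
    have := hI.gather_loc_team (hI.team_of_help h5)
    rw [h4] at this; exact this
  have e2 : (((C.next .gather).view (hd (C.mem a).label)).filter
      fun x => Team (C.mem a).label x.mem ∧ x.id < N.ident a).card =
      C.rank (C.mem a).label a := by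
    rw [card_view]; unfold rank team; rw [Finset.filter_filter]; congr 1; ext b
    simp only [Finset.mem_filter, Finset.mem_univ, true_and]
    exact ⟨fun h => h.2, fun h => ⟨hI.gather_loc_team h.1, h⟩⟩
  obtain ⟨-, e3, e4⟩ := next_of (I := .probe) (gather_mem a) h1 rfl rfl
  simp only [Dispersion.act] at e3 e4
  rw [if_pos ⟨rfl, h2, h3⟩, e1, e2] at e3 e4
  exact Prod.ext e3 e4

theorem Inv.probed_other {a : N.Agent} (h : ¬ Team (C.mem a).label (C.mem a)) :
    C.probed.loc a = C.loc a ∧ C.probed.pin a = none := by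
  have h1 : (C.mem a).help = none := by
    by_contra h1; exact h (hI.team_of_help h1)
  obtain ⟨-, e3, e4⟩ := next_of (I := .probe) (gather_mem a) (gather_of_none h1).1 rfl rfl
  simp only [Dispersion.act] at e3 e4
  rw [if_neg h] at e3 e4
  exact ⟨e3, e4⟩

omit hI in
/-- The agent `a` inspects a neighbour of the head of its group `ℓ`. -/
def Conf.Prober (C : Conf N) (hd : ℕ → N.Node) (ℓ : ℕ) (a : N.Agent) : Prop :=
  Team ℓ (C.mem a) ∧ C.probePort a < N.graph.degree (hd ℓ)

theorem Inv.probed_prober {ℓ : ℕ} {a : N.Agent} (h : C.Prober hd ℓ a) :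
    C.probed.loc a = nbr (hd ℓ) (C.probePort a) ∧
      C.probed.pin a = some (prt (nbr (hd ℓ) (C.probePort a)) (hd ℓ)) := by
  have := hI.probed_team h.1
  rw [goto_some h.2] at this
  simpa [Prod.ext_iff] using this

theorem Inv.probed_waiting {ℓ : ℕ} {a : N.Agent} (h : Team ℓ (C.mem a)) (h2 : ¬ C.Prober hd ℓ a) :
    C.probed.loc a = hd ℓ ∧ C.probed.pin a = none := by
  have := hI.probed_team h
  rw [goto_ge (fun h3 => h2 ⟨h, h3⟩)] at this
  simpa [Prod.ext_iff] using this

theorem Inv.probed_pin_ne {ℓ : ℕ} {a : N.Agent} (hl : (C.mem a).label = ℓ) :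
    C.probed.pin a ≠ none ↔ C.Prober hd ℓ a := by
  subst hl
  constructor
  · intro h
    by_cases h1 : Team (C.mem a).label (C.mem a)
    · by_contra h2
      exact h (hI.probed_waiting h1 h2).2
    · exact absurd (hI.probed_other h1).2 h
  · intro h; rw [(hI.probed_prober h).2]; simp

omit hI in
theorem Conf.helperCount_le_probePort {ℓ : ℕ} {a : N.Agent} (h : Team ℓ (C.mem a)) :
    C.helperCount ℓ ≤ C.probePort a ∧
      C.probePort a < C.helperCount ℓ + (C.team ℓ).card := by
  have := rank_lt (mem_team.2 h)
  obtain ⟨rfl, -⟩ := h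
  unfold probePort; omega

omit hI in
theorem Conf.probePort_injOn {ℓ : ℕ} {a b : N.Agent} (ha : Team ℓ (C.mem a))
    (hb : Team ℓ (C.mem b)) (h : C.probePort a = C.probePort b) : a = b := by
  refine rank_injOn (mem_team.2 ha) (mem_team.2 hb) ?_
  unfold probePort at h
  rw [ha.1, hb.1] at h; omega

omit hI in
theorem Conf.exists_prober {ℓ i : ℕ} (h1 : C.helperCount ℓ ≤ i)
    (h2 : i < C.helperCount ℓ + (C.team ℓ).card) (h3 : i < N.graph.degree (hd ℓ)) :
    ∃ a, C.Prober hd ℓ a ∧ C.probePort a = i := by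
  obtain ⟨a, ha, hr⟩ := exists_rank (C := C) (ℓ := ℓ) (i := i - C.helperCount ℓ) (by omega)
  rw [mem_team] at ha
  have : C.probePort a = i := by unfold probePort; rw [ha.1, hr]; omega
  exact ⟨a, ⟨ha, this ▸ h3⟩, this⟩

/-- A prober notices exactly the agents that are settled there for its group. -/
theorem Inv.prober_sees {ℓ : ℕ} {a : N.Agent} (h : C.Prober hd ℓ a) :
    (∃ x ∈ C.probed.view (C.probed.loc a),
      x.mem.settled = true ∧ x.mem.label = (C.mem a).label ∧ x.id ≠ N.ident a) ↔
    C.Occ ℓ (nbr (hd ℓ) (C.probePort a)) := by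
  rw [exists_view, h.1.1, (hI.probed_prober h).1]
  have hA := hI.active_of_team h.1
  obtain ⟨g1, g2, -⟩ := hI.search_helperCount hA
  have hport := helperCount_le_probePort h.1
  simp only [obs, hI.probed_mem]
  constructor
  · rintro ⟨b, h1, h2, h3, h4⟩
    by_cases hT : Team ℓ (C.mem b)
    · by_cases hp : C.Prober hd ℓ b
      · rw [(hI.probed_prober hp).1] at h1
        exact absurd (congrArg N.ident (probePort_injOn hT h.1 (nbr_injOn hp.2 h.2 h1))) h4
      · rw [(hI.probed_waiting hT hp).1] at h1
        exact absurd h1 (adj_nbr h.2).ne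
    · rw [(hI.probed_other (by rw [h3]; exact hT)).1] at h1
      exact ⟨b, h2, h3, h1⟩
  · rintro ⟨b, h2, h3, h1⟩
    -- Helpers come from ports below `helperCount`, whereas inspected ports start at `helperCount`.
    have hn : (C.mem b).help = none := by
      by_contra hn
      have := (g1 b h3 hn).2.1
      rw [h1, prt_nbr h.2] at this
      omega
    have hT : ¬ Team (C.mem b).label (C.mem b) := by
      rintro ⟨-, -, h5 | h5⟩
      · simp [h2] at h5
      · exact h5 hn
    refine ⟨b, by rw [(hI.probed_other hT).1, h1], h2, h3, fun he => hT ?_⟩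
    rw [N.ident_injective he]
    obtain ⟨hl, h5⟩ := h.1
    subst hl
    exact ⟨rfl, h5⟩

end Probing

end Dispersion

/-! ### Returning to the head with recruits -/

namespace Dispersion

open scoped Classical
open Conf

variable {N : Network} {C : Conf N} {Λ : Finset ℕ} {hd : ℕ → N.Node} {W n : ℕ}

/-- The configuration in which the team is back at the head, together with the recruits. -/
def Conf.returned (C : Conf N) : Conf N := C.probed.next .back

/-- A settled agent that is found by a member of its group and becomes a helper. -/
def Conf.Recruit (C : Conf N) (hd : ℕ → N.Node) (ℓ : ℕ) (b : N.Agent) : Prop :=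
  (C.mem b).settled = true ∧ (C.mem b).label = ℓ ∧ (C.mem b).help = none ∧
    ∃ y, C.Prober hd ℓ y ∧ nbr (hd ℓ) (C.probePort y) = C.loc b

theorem Conf.not_team_of_settled {ℓ : ℕ} {a : N.Agent} (h1 : (C.mem a).settled = true)
    (h2 : (C.mem a).help = none) : ¬ Team ℓ (C.mem a) := by
  rintro ⟨-, -, h | h⟩
  · simp [h1] at h
  · exact h h2

section Returning

variable (hI : Inv C Λ hd W n)
include hI

theorem Inv.probed_fields (a : N.Agent) :
    (C.probed.mem a).label = (C.mem a).label ∧ (C.probed.mem a).settled = (C.mem a).settled ∧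
    (C.probed.mem a).parent = (C.mem a).parent ∧ (C.probed.mem a).exit = (C.mem a).exit ∧
    (C.probed.mem a).help = (C.mem a).help ∧ (C.probed.mem a).home =
      if (C.mem a).help = none then none else some (prt (hd (C.mem a).label) (C.loc a)) := by
  rw [hI.probed_mem]; exact ⟨rfl, rfl, rfl, rfl, rfl, rfl⟩

theorem Inv.returned_prober {ℓ : ℕ} {a : N.Agent} (h : C.Prober hd ℓ a) :
    C.returned.mem a = { C.probed.mem a with
      fresh := !decide (C.Occ ℓ (nbr (hd ℓ) (C.probePort a))) } ∧
    C.returned.loc a = hd ℓ ∧ C.returned.pin a = some (C.probePort a) := by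
  obtain ⟨h1, h2⟩ := hI.probed_prober h
  have h3 := hI.prober_sees h
  obtain ⟨e1, e2, e3⟩ := next_of (I := .back) (C := C.probed) (a := a) rfl rfl h2 rfl
  rw [← Conf.returned] at e1 e2 e3
  simp only [Dispersion.act] at e1 e2 e3
  rw [if_pos (by simp)] at e1 e2 e3
  have hA := (adj_nbr h.2).symm
  rw [h1] at e2 e3
  rw [goto_prt hA] at e2 e3
  rw [prt_nbr h.2] at e3
  refine ⟨?_, e2, e3⟩
  rw [← (hI.probed_fields a).1] at h3
  rw [e1]
  simp only [h3]

theorem Inv.exists_prober_iff {ℓ : ℕ} {b : N.Agent} (h1 : (C.mem b).settled = true)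
    (h2 : (C.mem b).label = ℓ) (h3 : (C.mem b).help = none) :
    (∃ x ∈ C.probed.view (C.loc b), x.mem.label = (C.probed.mem b).label ∧ x.pin ≠ none) ↔
      C.Recruit hd ℓ b := by
  rw [exists_view]
  have h4 := (hI.probed_fields b).1
  constructor
  · rintro ⟨y, g1, g2, g3⟩
    simp only [obs, h4, (hI.probed_fields y).1] at g2 g3
    have g4 := (hI.probed_pin_ne (g2.trans h2)).1 g3
    exact ⟨h1, h2, h3, y, g4, by rw [← (hI.probed_prober g4).1, g1]⟩
  · rintro ⟨-, -, -, y, g1, g2⟩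
    refine ⟨y, by rw [(hI.probed_prober g1).1, g2], ?_, ?_⟩
    · simp only [obs, h4, (hI.probed_fields y).1]; rw [h2]; exact g1.1.1
    · exact (hI.probed_pin_ne g1.1.1).2 g1

/-- The inspecting agent that is seen here came straight from the head, so its incoming port is the
port back to the head; the recruit uses it and stores it. -/
theorem Inv.returned_recruit {ℓ : ℕ} {b : N.Agent} (h : C.Recruit hd ℓ b) :
    C.returned.mem b = { C.probed.mem b with
      fresh := false, help := some (prt (C.loc b) (hd ℓ)) } ∧
    C.returned.loc b = hd ℓ ∧ C.returned.pin b = some (prt (hd ℓ) (C.loc b)) ∧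
      N.graph.Adj (hd ℓ) (C.loc b) := by
  have hR := h
  obtain ⟨h1, h2, h3, y, h4, h5⟩ := h
  obtain ⟨g1, g2⟩ := hI.probed_other (a := b) (not_team_of_settled h1 h3)
  have g3 := (hI.exists_prober_iff h1 h2 h3).2 hR
  obtain ⟨x, f1, ⟨f2, f3⟩, f4⟩ := exists_pick (exists_view.1 g3)
  obtain ⟨e1, e2, e3⟩ := next_of (I := .back) (C := C.probed) (a := b) rfl g1 g2 rfl
  rw [← Conf.returned] at e1 e2 e3
  simp only [Dispersion.act] at e1 e2 e3
  obtain ⟨p1, p2, p3, p4, p5, p6⟩ := hI.probed_fields b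
  rw [if_neg (by simp), if_pos ⟨by rw [p2, h1], by rw [p5, h3], g3⟩, f4] at e1 e2 e3
  simp only [obs, p1, (hI.probed_fields x).1] at f2 f3
  have f5 := (hI.probed_pin_ne (f2.trans h2)).1 f3
  obtain ⟨f6, f7⟩ := hI.probed_prober f5
  have hadj := adj_nbr f5.2
  rw [← f6, f1] at f7 hadj
  simp only [obs, f7] at e1 e2 e3
  rw [goto_prt hadj.symm] at e2 e3
  exact ⟨e1, e2, e3, hadj⟩

theorem Inv.returned_other {b : N.Agent} (h : ¬ C.Prober hd (C.mem b).label b)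
    (h2 : ¬ C.Recruit hd (C.mem b).label b) :
    C.returned.mem b = { C.probed.mem b with fresh := false } ∧
    C.returned.loc b = C.probed.loc b ∧ C.returned.pin b = none := by
  have g1 : C.probed.pin b = none := by
    by_contra g; exact h ((hI.probed_pin_ne rfl).1 g)
  obtain ⟨e1, e2, e3⟩ := next_of (I := .back) (C := C.probed) (a := b) rfl rfl g1 rfl
  rw [← Conf.returned] at e1 e2 e3
  simp only [Dispersion.act] at e1 e2 e3
  obtain ⟨p1, p2, p3, p4, p5, p6⟩ := hI.probed_fields b
  have hn : ¬ ((C.probed.mem b).settled = true ∧ (C.probed.mem b).help = none ∧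
      ∃ x ∈ C.probed.view (C.probed.loc b), x.mem.label = (C.probed.mem b).label ∧
        x.pin ≠ none) := by
    rintro ⟨f1, f2, f3⟩
    rw [p2] at f1; rw [p5] at f2
    rw [(hI.probed_other (a := b) (not_team_of_settled f1 f2)).1] at f3
    exact h2 ((hI.exists_prober_iff f1 rfl f2).1 f3)
  rw [if_neg (by simp), if_neg hn] at e1 e2 e3
  exact ⟨e1, e2, e3⟩

theorem Inv.returned_fields (a : N.Agent) :
    (C.returned.mem a).label = (C.mem a).label ∧ (C.returned.mem a).settled = (C.mem a).settled ∧
    (C.returned.mem a).parent = (C.mem a).parent ∧ (C.returned.mem a).exit = (C.mem a).exit ∧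
    (C.returned.mem a).home = (C.probed.mem a).home := by
  obtain ⟨p1, p2, p3, p4, -⟩ := hI.probed_fields a
  by_cases h : C.Prober hd (C.mem a).label a
  · rw [(hI.returned_prober h).1]; exact ⟨p1, p2, p3, p4, rfl⟩
  by_cases h2 : C.Recruit hd (C.mem a).label a
  · rw [(hI.returned_recruit h2).1]; exact ⟨p1, p2, p3, p4, rfl⟩
  · rw [(hI.returned_other h h2).1]; exact ⟨p1, p2, p3, p4, rfl⟩

theorem Inv.returned_help {a : N.Agent} (h2 : ¬ C.Recruit hd (C.mem a).label a) :
    (C.returned.mem a).help = (C.mem a).help := by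
  obtain ⟨-, -, -, -, p5, -⟩ := hI.probed_fields a
  by_cases h : C.Prober hd (C.mem a).label a
  · rw [(hI.returned_prober h).1]; exact p5
  · rw [(hI.returned_other h h2).1]; exact p5

theorem Inv.returned_team {ℓ : ℕ} {a : N.Agent} (h : Team ℓ (C.mem a)) :
    C.returned.loc a = hd ℓ := by
  by_cases hp : C.Prober hd ℓ a
  · exact (hI.returned_prober hp).2.1
  have hl := h.1
  subst hl
  have hr : ¬ C.Recruit hd (C.mem a).label a := fun hr => not_team_of_settled hr.1 hr.2.2.1 h
  rw [(hI.returned_other hp hr).2.1, (hI.probed_waiting h hp).1]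

theorem Inv.returned_fresh {ℓ : ℕ} {a : N.Agent} (hl : (C.mem a).label = ℓ) :
    (C.returned.mem a).fresh = true ↔
      C.Prober hd ℓ a ∧ ¬ C.Occ ℓ (nbr (hd ℓ) (C.probePort a)) := by
  subst hl
  by_cases h : C.Prober hd (C.mem a).label a
  · rw [(hI.returned_prober h).1]; simp [h]
  by_cases h2 : C.Recruit hd (C.mem a).label a
  · rw [(hI.returned_recruit h2).1]; simp [h]
  · rw [(hI.returned_other h h2).1]; simp [h]

omit hI in
/-- The helpers of the group after the recruitment. -/
def Conf.Helping (C : Conf N) (hd : ℕ → N.Node) (ℓ : ℕ) (a : N.Agent) : Prop :=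
  Helper ℓ (C.mem a) ∨ C.Recruit hd ℓ a

theorem Inv.returned_help_ne {ℓ : ℕ} {a : N.Agent} :
    (Helper ℓ (C.returned.mem a)) ↔ C.Helping hd ℓ a := by
  unfold Helper Helping Helper
  rw [(hI.returned_fields a).1]
  by_cases h2 : C.Recruit hd (C.mem a).label a
  · rw [(hI.returned_recruit h2).1]
    simp only [ne_eq, reduceCtorEq, not_false_eq_true, and_true]
    exact ⟨fun h => .inr (h ▸ h2), fun h => h.elim (fun h => h.1) fun h => h.2.1⟩
  · rw [hI.returned_help h2]
    exact ⟨.inl, fun h => h.elim id fun h => absurd (h.2.1.symm ▸ h) h2⟩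

/-- The last conjunct is the way home. Old helpers remember it in `home`; recruits were no helpers
during `.probe`, so their `home` is empty and their incoming port serves instead. -/
theorem Inv.helping_spec {ℓ : ℕ} {a : N.Agent} (h : C.Helping hd ℓ a) :
    (C.mem a).settled = true ∧ (C.mem a).label = ℓ ∧ N.graph.Adj (hd ℓ) (C.loc a) ∧
    prt (hd ℓ) (C.loc a) < C.helperCount ℓ + (C.team ℓ).card ∧
    C.returned.loc a = hd ℓ ∧ (C.returned.mem a).help = some (prt (C.loc a) (hd ℓ)) ∧
    (if (C.returned.mem a).home ≠ none then (C.returned.mem a).home else C.returned.pin a) =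
      some (prt (hd ℓ) (C.loc a)) := by
  obtain ⟨-, -, -, -, p5, p6⟩ := hI.probed_fields a
  rw [(hI.returned_fields a).2.2.2.2, p6]
  rcases h with ⟨h1, h2⟩ | h
  · subst h1
    obtain ⟨g1, g2, g3⟩ := (hI.search_helperCount (hI.active_of_help h2)).1 a rfl h2
    have hr : ¬ C.Recruit hd (C.mem a).label a := fun hr => h2 hr.2.2.1
    refine ⟨hI.settled_of_help h2, rfl, g1, by omega, hI.returned_team (hI.team_of_help h2),
      by rw [hI.returned_help hr, g3], ?_⟩
    rw [if_neg h2]; simp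
  · obtain ⟨e1, e2, e3, e4⟩ := hI.returned_recruit h
    refine ⟨h.1, h.2.1, e4, ?_, e2, by rw [e1], ?_⟩
    · obtain ⟨-, -, -, y, h4, h5⟩ := h
      rw [← h5, prt_nbr h4.2]
      exact (helperCount_le_probePort h4.1).2
    · rw [if_pos h.2.2.1]; simp [e3]

end Returning

end Dispersion

/-! ### The decision of a group at the end of a search cycle -/

namespace Dispersion

open scoped Classical
open Conf

variable {N : Network} {C : Conf N} {Λ : Finset ℕ} {hd : ℕ → N.Node} {W n : ℕ}

section Deciding

variable (hI : Inv C Λ hd W n)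
include hI

theorem Inv.returned_settled {a : N.Agent} (hs : (C.mem a).settled = true)
    (h : ¬ C.Helping hd (C.mem a).label a) :
    C.returned.loc a = C.loc a ∧ (C.returned.mem a).help = none ∧ (C.mem a).help = none := by
  have h1 : (C.mem a).help = none := by
    by_contra h1; exact h (.inl ⟨rfl, h1⟩)
  have h2 : ¬ C.Recruit hd (C.mem a).label a := fun h2 => h (.inr h2)
  have h3 : ¬ Team (C.mem a).label (C.mem a) := not_team_of_settled hs h1
  refine ⟨?_, by rw [hI.returned_help h2, h1], h1⟩
  rw [(hI.returned_other (fun h => h3 h.1) h2).2.1, (hI.probed_other h3).1]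

theorem Inv.found_iff {ℓ : ℕ} : Found (C.returned.view (hd ℓ)) ℓ ↔
    ∃ a, C.Prober hd ℓ a ∧ ¬ C.Occ ℓ (nbr (hd ℓ) (C.probePort a)) := by
  unfold Found
  rw [exists_view]
  constructor
  · rintro ⟨a, -, h2, h3⟩
    simp only [obs] at h2 h3
    rw [(hI.returned_fields a).1] at h2
    exact ⟨a, (hI.returned_fresh h2).1 h3⟩
  · rintro ⟨a, h1, h2⟩
    refine ⟨a, hI.returned_team h1.1, ?_, (hI.returned_fresh h1.1.1).2 ⟨h1, h2⟩⟩
    simp only [obs]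
    rw [(hI.returned_fields a).1]; exact h1.1.1

/-- If nothing was found, each inspected neighbour has a settled agent of the group, which helps
already or has just been recruited. Lower ports belong to the old helpers. -/
theorem Inv.exists_helping {ℓ i : ℕ} (hA : C.Active ℓ) (hF : ¬ Found (C.returned.view (hd ℓ)) ℓ)
    (h1 : i < C.helperCount ℓ + (C.team ℓ).card) (h2 : i < N.graph.degree (hd ℓ)) :
    ∃ a, C.Helping hd ℓ a ∧ C.loc a = nbr (hd ℓ) i := by
  by_cases h3 : i < C.helperCount ℓ
  · obtain ⟨-, a, g1, g2, g3, g4⟩ := (hI.search_helperCount hA).2.1 i h3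
    exact ⟨a, .inl ⟨g2, g3⟩, g4⟩
  · obtain ⟨y, hy, rfl⟩ := exists_prober (hd := hd) (not_lt.1 h3) h1 h2
    have h4 : C.Occ ℓ (nbr (hd ℓ) (C.probePort y)) := by
      by_contra h4; exact hF (hI.found_iff.2 ⟨y, hy, h4⟩)
    obtain ⟨b, g1, g2, g3⟩ := h4
    by_cases h5 : (C.mem b).help = none
    · exact ⟨b, .inr ⟨g1, g2, h5, y, hy, g3.symm⟩, g3⟩
    · exact ⟨b, .inl ⟨g2, h5⟩, g3⟩

/-- The helpers now at the head correspond to the ports below the minimum of the degree and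
`helperCount + team.card`. Counting them thus reveals whether all neighbours have been inspected. -/
theorem Inv.full_iff {ℓ : ℕ} (hA : C.Active ℓ) (hF : ¬ Found (C.returned.view (hd ℓ)) ℓ) :
    Full (C.returned.view (hd ℓ)) (N.graph.degree (hd ℓ)) ℓ ↔
      N.graph.degree (hd ℓ) ≤ C.helperCount ℓ + (C.team ℓ).card := by
  have h : ((C.returned.view (hd ℓ)).filter fun x => Helper ℓ x.mem).card =
      min (C.helperCount ℓ + (C.team ℓ).card) (N.graph.degree (hd ℓ)) := by
    rw [card_view]
    have hmem : ∀ a, (a ∈ Finset.univ.filter fun b => C.returned.loc b = hd ℓ ∧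
        Helper ℓ (C.returned.obs b).mem) ↔ C.Helping hd ℓ a := by
      intro a
      rw [Finset.mem_filter, ← hI.returned_help_ne]
      exact ⟨fun h => h.2.2, fun h => ⟨Finset.mem_univ _,
        (hI.helping_spec (hI.returned_help_ne.1 h)).2.2.2.2.1, h⟩⟩
    refine card_eq_of_bijOn (fun a => prt (hd ℓ) (C.loc a)) ?_ ?_ ?_
    · intro a ha b hb hab
      obtain ⟨a1, a2, a3, a4, -⟩ := hI.helping_spec ((hmem a).1 ha)
      obtain ⟨b1, b2, b3, b4, -⟩ := hI.helping_spec ((hmem b).1 hb)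
      refine hI.settled_inj a b a1 b1 ?_
      rw [← nbr_prt a3, ← nbr_prt b3, hab]
    · intro a ha
      obtain ⟨a1, a2, a3, a4, -⟩ := hI.helping_spec ((hmem a).1 ha)
      exact lt_min a4 (prt_lt a3)
    · intro i hi
      obtain ⟨h1, h2⟩ := lt_min_iff.1 hi
      obtain ⟨a, g1, g2⟩ := hI.exists_helping hA hF h1 h2
      exact ⟨a, (hmem a).2 g1, by rw [g2, prt_nbr h2]⟩
  unfold Full
  rw [h, le_min_iff]
  simp

/-- The three outcomes of a search cycle of the group `ℓ`: a new node is found, or all neighbours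
of the head belong to the group already, or the search goes on with more helpers. -/
theorem Inv.outcome {ℓ : ℕ} (hA : C.Active ℓ) :
    (∃ c, Found (C.returned.view (hd ℓ)) ℓ ∧
      target (C.returned.view (hd ℓ)) (N.graph.degree (hd ℓ)) ℓ = some c ∧
      c < N.graph.degree (hd ℓ) ∧ ¬ C.Occ ℓ (nbr (hd ℓ) c)) ∨
    (¬ Found (C.returned.view (hd ℓ)) ℓ ∧
      Full (C.returned.view (hd ℓ)) (N.graph.degree (hd ℓ)) ℓ ∧
      (∀ u, N.graph.Adj (hd ℓ) u → C.Occ ℓ u) ∧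
      ∃ s, (C.mem s).settled = true ∧ (C.mem s).label = ℓ ∧ C.loc s = hd ℓ ∧
        target (C.returned.view (hd ℓ)) (N.graph.degree (hd ℓ)) ℓ = (C.mem s).parent) ∨
    (¬ Found (C.returned.view (hd ℓ)) ℓ ∧
      ¬ Full (C.returned.view (hd ℓ)) (N.graph.degree (hd ℓ)) ℓ ∧
      target (C.returned.view (hd ℓ)) (N.graph.degree (hd ℓ)) ℓ = none ∧
      C.helperCount ℓ + (C.team ℓ).card < N.graph.degree (hd ℓ) ∧
      ∀ i < C.helperCount ℓ + (C.team ℓ).card, ∃ a, C.Helping hd ℓ a ∧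
        C.loc a = nbr (hd ℓ) i) := by
  by_cases hF : Found (C.returned.view (hd ℓ)) ℓ
  · left
    obtain ⟨x, f1, ⟨f2, f3⟩, f4⟩ := exists_pick (exists_view.1 hF)
    simp only [obs] at f2 f3
    rw [(hI.returned_fields x).1] at f2
    obtain ⟨g1, g2⟩ := (hI.returned_fresh f2).1 f3
    refine ⟨C.probePort x, hF, ?_, g1.2, g2⟩
    unfold target
    rw [if_pos hF, f4]
    exact (hI.returned_prober g1).2.2
  right
  have hfull := hI.full_iff hA hF
  by_cases h : Full (C.returned.view (hd ℓ)) (N.graph.degree (hd ℓ)) ℓ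
  · left
    refine ⟨hF, h, fun u hu => ?_, ?_⟩
    · obtain ⟨a, g1, g2⟩ := hI.exists_helping hA hF ((prt_lt hu).trans_le (hfull.1 h)) (prt_lt hu)
      obtain ⟨a1, a2, -⟩ := hI.helping_spec g1
      exact ⟨a, a1, a2, by rw [g2, nbr_prt hu]⟩
    · obtain ⟨s, h1, h2, h3⟩ := (hI.search ℓ hA).occ
      have hns : ∀ b, C.loc b = hd ℓ → ¬ C.Helping hd ℓ b := by
        intro b hb hH
        have := (hI.helping_spec hH).2.2.1
        rw [hb] at this; exact this.ne rfl
      have hex : ∃ b, C.returned.loc b = hd ℓ ∧ (C.returned.obs b).mem.settled = true ∧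
          (C.returned.obs b).mem.help = none ∧ (C.returned.obs b).mem.label = ℓ := by
        obtain ⟨g1, g2, g3⟩ := hI.returned_settled h1 (by rw [h2]; exact hns s h3)
        refine ⟨s, by rw [g1, h3], ?_, g2, ?_⟩
        · simp only [obs]; rw [(hI.returned_fields s).2.1, h1]
        · simp only [obs]; rw [(hI.returned_fields s).1, h2]
      obtain ⟨b, f1, ⟨f2, f3, f4⟩, f5⟩ := exists_pick (P := fun x => x.mem.settled = true ∧
        x.mem.help = none ∧ x.mem.label = ℓ) hex
      simp only [obs] at f2 f3 f4
      rw [(hI.returned_fields b).2.1] at f2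
      rw [(hI.returned_fields b).1] at f4
      have f6 : ¬ C.Helping hd ℓ b := fun hH => (hI.returned_help_ne.2 hH).2 f3
      refine ⟨b, f2, f4, ?_, ?_⟩
      · rw [← f1, (hI.returned_settled f2 (by rw [f4]; exact f6)).1]
      · unfold target
        rw [if_neg hF, if_pos h, f5]
        exact (hI.returned_fields b).2.2.1
  · right
    have h2 := not_le.1 (fun h2 => h (hfull.2 h2))
    refine ⟨hF, h, ?_, h2, fun i hi => hI.exists_helping hA hF hi (hi.trans h2)⟩
    unfold target
    rw [if_neg hF, if_neg h]

omit hI in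
/-- The configuration in which the helpers are home and the free agents at their targets. -/
def Conf.decided (C : Conf N) : Conf N := C.returned.next .decide

theorem Inv.decided_helping {ℓ : ℕ} {a : N.Agent} (h : C.Helping hd ℓ a) :
    (C.decided.mem a).label = (C.mem a).label ∧ (C.decided.mem a).settled = (C.mem a).settled ∧
    (C.decided.mem a).parent = (C.mem a).parent ∧ (C.decided.mem a).exit = (C.mem a).exit ∧
    ((C.decided.mem a).help = if Found (C.returned.view (hd ℓ)) ℓ ∨
        Full (C.returned.view (hd ℓ)) (N.graph.degree (hd ℓ)) ℓ then none
        else some (prt (C.loc a) (hd ℓ))) ∧ C.decided.loc a = C.loc a := by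
  obtain ⟨a1, a2, a3, a4, a5, a6, a7⟩ := hI.helping_spec h
  obtain ⟨e1, e2, -⟩ := next_of (I := .decide) (C := C.returned) (a := a) rfl a5 rfl rfl
  rw [← Conf.decided] at e1 e2
  simp only [Dispersion.act] at e1 e2
  rw [if_pos (by rw [a6]; simp)] at e1 e2
  rw [a7, goto_prt a3] at e2
  obtain ⟨r1, r2, r3, r4, -⟩ := hI.returned_fields a
  refine ⟨by rw [e1, r1], by rw [e1, r2], by rw [e1, r3], by rw [e1, r4], ?_, e2⟩
  rw [e1]
  simp only [a6, r1, a2]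

theorem Inv.decided_free {a : N.Agent} (h : (C.mem a).settled = false)
    (hl : (C.mem a).label ≠ 0) :
    C.decided.mem a = C.returned.mem a ∧ (C.decided.loc a, C.decided.pin a) =
      goto (hd (C.mem a).label) (target (C.returned.view (hd (C.mem a).label))
        (N.graph.degree (hd (C.mem a).label)) (C.mem a).label) := by
  have hh := hI.free_help a h
  have hr : ¬ C.Recruit hd (C.mem a).label a := fun hr => by have := hr.1; simp [h] at this
  have hT : Team (C.mem a).label (C.mem a) := ⟨rfl, hl, .inl h⟩
  obtain ⟨e1, e2, e3⟩ :=
    next_of (I := .decide) (C := C.returned) (a := a) rfl (hI.returned_team hT) rfl rfl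
  rw [← Conf.decided] at e1 e2 e3
  simp only [Dispersion.act] at e1 e2 e3
  obtain ⟨r1, r2, -⟩ := hI.returned_fields a
  rw [if_neg (by rw [hI.returned_help hr, hh]; simp), if_pos (by rw [r2, h]), r1,
    if_pos hl] at e1 e2 e3
  exact ⟨e1, Prod.ext e2 e3⟩

theorem Inv.decided_inert {a : N.Agent} (h : (C.mem a).settled = false)
    (hl : (C.mem a).label = 0) :
    C.decided.mem a = C.returned.mem a ∧ C.decided.loc a = C.loc a := by
  have hh := hI.free_help a h
  have hr : ¬ C.Recruit hd (C.mem a).label a := fun hr => by have := hr.1; simp [h] at this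
  have hT : ¬ Team (C.mem a).label (C.mem a) := fun hT => hT.2.1 hl
  obtain ⟨e1, e2, e3⟩ := next_of (I := .decide) (C := C.returned) (a := a) rfl rfl rfl rfl
  rw [← Conf.decided] at e1 e2 e3
  simp only [Dispersion.act] at e1 e2 e3
  obtain ⟨r1, r2, -⟩ := hI.returned_fields a
  rw [if_neg (by rw [hI.returned_help hr, hh]; simp), if_pos (by rw [r2, h]),
    if_neg (by rw [r1]; simpa using hl)] at e1 e2 e3
  refine ⟨e1, ?_⟩
  rw [e2, (hI.returned_other (fun hp => hT hp.1) hr).2.1, (hI.probed_other hT).1]; rfl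

theorem Inv.decided_settled {ℓ : ℕ} {a : N.Agent} (h : (C.mem a).settled = true)
    (hl : (C.mem a).label = ℓ) (hH : ¬ C.Helping hd ℓ a) :
    (C.decided.mem a).label = (C.mem a).label ∧ (C.decided.mem a).settled = (C.mem a).settled ∧
    (C.decided.mem a).parent = (C.mem a).parent ∧
    ((C.decided.mem a).exit = if C.Active ℓ ∧ C.loc a = hd ℓ ∧ target (C.returned.view (hd ℓ))
          (N.graph.degree (hd ℓ)) ℓ ≠ none then
        target (C.returned.view (hd ℓ)) (N.graph.degree (hd ℓ)) ℓ else (C.mem a).exit) ∧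
    (C.decided.mem a).help = none ∧ C.decided.loc a = C.loc a := by
  subst hl
  obtain ⟨g1, g2, g3⟩ := hI.returned_settled h hH
  obtain ⟨e1, e2, e3⟩ := next_of (I := .decide) (C := C.returned) (a := a) rfl g1 rfl rfl
  rw [← Conf.decided] at e1 e2 e3
  simp only [Dispersion.act] at e1 e2 e3
  obtain ⟨r1, r2, r3, r4, -⟩ := hI.returned_fields a
  have hex : (∃ x ∈ C.returned.view (C.loc a), x.mem.settled = false ∧
      x.mem.label = (C.returned.mem a).label) ↔
      C.Active (C.mem a).label ∧ C.loc a = hd (C.mem a).label := by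
    rw [exists_view, r1]
    have h0 := hI.settled_label a h
    constructor
    · rintro ⟨b, f1, f2, f3⟩
      simp only [obs] at f2 f3
      rw [(hI.returned_fields b).2.1] at f2
      rw [(hI.returned_fields b).1] at f3
      refine ⟨⟨h0, b, f2, f3⟩, ?_⟩
      rw [← f1]; exact hI.returned_team ⟨f3, h0, .inl f2⟩
    · rintro ⟨⟨-, b, f2, f3⟩, f4⟩
      refine ⟨b, by rw [f4]; exact hI.returned_team ⟨f3, h0, .inl f2⟩, ?_, ?_⟩
      · simp only [obs]; rw [(hI.returned_fields b).2.1, f2]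
      · simp only [obs]; rw [(hI.returned_fields b).1, f3]
  rw [if_neg (by rw [g2]; simp), if_neg (by rw [r2, h]; simp)] at e1 e2
  by_cases hc : C.Active (C.mem a).label ∧ C.loc a = hd (C.mem a).label
  · rw [if_pos (hex.2 hc)] at e1 e2
    refine ⟨by rw [e1, r1], by rw [e1, r2], by rw [e1, r3], ?_, by rw [e1, g2], e2⟩
    rw [e1]
    simp only [r1, r4]
    rw [hc.2]
    by_cases ht : target (C.returned.view (hd (C.mem a).label))
        (N.graph.degree (hd (C.mem a).label)) (C.mem a).label = none
    · rw [if_pos ht, if_neg (fun hh => hh.2.2 ht)]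
    · rw [if_neg ht, if_pos ⟨hc.1, rfl, ht⟩]
  · rw [if_neg (fun hh => hc (hex.1 hh))] at e1 e2
    refine ⟨by rw [e1, r1], by rw [e1, r2], by rw [e1, r3], ?_, by rw [e1, g2], e2⟩
    rw [e1, if_neg (fun hh => hc ⟨hh.1, hh.2.1⟩), r4]

theorem Inv.decided_fields (a : N.Agent) :
    (C.decided.mem a).label = (C.mem a).label ∧ (C.decided.mem a).settled = (C.mem a).settled ∧
    (C.decided.mem a).parent = (C.mem a).parent := by
  obtain ⟨r1, r2, r3, -⟩ := hI.returned_fields a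
  by_cases hs : (C.mem a).settled = true
  · by_cases hH : C.Helping hd (C.mem a).label a
    · obtain ⟨e1, e2, e3, -⟩ := hI.decided_helping hH
      exact ⟨e1, e2, e3⟩
    · obtain ⟨e1, e2, e3, -⟩ := hI.decided_settled hs rfl hH
      exact ⟨e1, e2, e3⟩
  · rw [Bool.not_eq_true] at hs
    by_cases hl : (C.mem a).label = 0
    · rw [(hI.decided_inert hs hl).1]; exact ⟨r1, r2, r3⟩
    · rw [(hI.decided_free hs hl).1]; exact ⟨r1, r2, r3⟩

theorem Inv.decided_loc {a : N.Agent} (hs : (C.mem a).settled = true) :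
    C.decided.loc a = C.loc a := by
  by_cases hH : C.Helping hd (C.mem a).label a
  · exact (hI.decided_helping hH).2.2.2.2.2
  · exact (hI.decided_settled hs rfl hH).2.2.2.2.2

theorem Inv.decided_exit {a : N.Agent} (hs : (C.mem a).settled = true) :
    (C.decided.mem a).exit = if C.Active (C.mem a).label ∧ C.loc a = hd (C.mem a).label ∧
      target (C.returned.view (hd (C.mem a).label)) (N.graph.degree (hd (C.mem a).label))
        (C.mem a).label ≠ none then
      target (C.returned.view (hd (C.mem a).label)) (N.graph.degree (hd (C.mem a).label))
        (C.mem a).label else (C.mem a).exit := by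
  by_cases hH : C.Helping hd (C.mem a).label a
  · have := (hI.helping_spec hH).2.2.1
    rw [if_neg (fun h => this.ne h.2.1.symm), (hI.decided_helping hH).2.2.2.1]
  · rw [(hI.decided_settled hs rfl hH).2.2.2.1]

end Deciding

end Dispersion

/-! ### Progress of the search in one cycle -/

namespace Dispersion

open scoped Classical
open Conf

variable {N : Network} {C : Conf N} {Λ : Finset ℕ} {hd : ℕ → N.Node} {W n : ℕ}

/-- A set of nodes that is closed under adjacency contains all nodes. -/
theorem forall_of_closed {P : N.Node → Prop} {x : N.Node} (hx : P x)
    (h : ∀ y, P y → ∀ z, N.graph.Adj y z → P z) (y : N.Node) : P y := by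
  obtain ⟨w⟩ := N.connected.preconnected x y
  induction w with
  | nil => exact hx
  | cons hadj _ ih => exact ih (h _ hx _ hadj)

/-- A path can be cut at its first visit to the target, so the steps leaving the target do not
matter. It is applied to `.decide`, which rewrites exit ports of a group only at its head. -/
theorem reflTransGen_of_ne {α : Type*} {r r' : α → α → Prop} {v : α}
    (h : ∀ x y, x ≠ v → r x y → r' x y) {x : α} (hx : Relation.ReflTransGen r x v) :
    Relation.ReflTransGen r' x v := by
  induction hx using Relation.ReflTransGen.head_induction_on with
  | refl => exact .refl
  | @head a b hab _ ih =>
    by_cases hav : a = v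
    · rw [hav]
    · exact .head (h _ _ hav hab) ih

section

variable (hI : Inv C Λ hd W n)
include hI

omit hI in
-- Settled agents on all nodes together with one free agent would exceed the number of nodes.
theorem Conf.Active.not_all_occ {ℓ : ℕ} (hA : C.Active ℓ) : ¬ ∀ x, C.Occ ℓ x := by
  intro h
  obtain ⟨-, b, hb, -⟩ := hA
  choose f h1 h2 h3 using h
  have hf : Function.Injective f := fun x y hxy => by rw [← h3 x, ← h3 y, hxy]
  have h4 : Fintype.card N.Node < Fintype.card N.Agent :=
    Fintype.card_lt_of_injective_of_notMem f hf (b := b) (by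
      rintro ⟨x, rfl⟩
      have := h1 x
      simp [hb] at this)
  exact absurd N.card_agent_le (not_le.2 h4)

omit hI in
theorem Conf.Active.groupSize_lt {ℓ : ℕ} (hA : C.Active ℓ) : C.groupSize ℓ < N.k := by
  obtain ⟨-, b, hb, -⟩ := hA
  refine Finset.card_lt_univ_of_notMem (x := b) ?_
  simp [hb]

/-- The team contains a free agent besides all helpers. This gives the doubling: `helperCount +
team.card + 1` is at least `2 * (helperCount + 1)`. -/
theorem Inv.helperCount_le {ℓ : ℕ} (hA : C.Active ℓ) :
    C.helperCount ℓ ≤ N.Δ ∧ C.helperCount ℓ + 1 ≤ N.k ∧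
      C.helperCount ℓ + 1 ≤ (C.team ℓ).card := by
  have h1 : C.helperCount ℓ + 1 ≤ (C.team ℓ).card := by
    obtain ⟨h0, b, hb, hbl⟩ := hA
    have hbH : b ∉ Finset.univ.filter fun b => Helper ℓ (C.mem b) := fun h =>
      (Finset.mem_filter.1 h).2.2 (hI.free_help b hb)
    unfold helperCount
    rw [← Finset.card_insert_of_notMem hbH]
    refine Finset.card_le_card fun a ha => ?_
    rw [mem_team]
    rcases Finset.mem_insert.1 ha with rfl | ha
    · exact ⟨hbl, h0, .inl hb⟩
    · have := (Finset.mem_filter.1 ha).2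
      exact ⟨this.1, h0, .inr this.2⟩
  refine ⟨?_, h1.trans (Finset.card_le_univ _), h1⟩
  refine le_trans ?_ (N.graph.degree_le_maxDegree (hd ℓ))
  by_contra h
  exact lt_irrefl _ ((hI.search_helperCount hA).2.1 _ (not_le.1 h)).1

/-- For `j > 0` the helper bounds `h ≤ Δ` and `h + 1 ≤ k` give `2 ^ (j - 1) ≤ τ`. The summand 2 in
`W` absorbs this shift and the cycle in progress. -/
theorem Inv.log_bound {ℓ j : ℕ} (hA : C.Active ℓ) (hj : 2 ^ j ≤ C.helperCount ℓ + 1)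
    (hW : Nat.log 2 N.τ + 2 ≤ W) : j + 1 ≤ W := by
  obtain ⟨h1, h2, -⟩ := hI.helperCount_le hA
  rcases Nat.eq_zero_or_pos j with rfl | hj0
  · omega
  obtain ⟨i, rfl⟩ := Nat.exists_eq_add_of_lt hj0
  have h3 : 2 ^ i ≤ N.τ := by
    have : 2 ^ (0 + i + 1) = 2 * 2 ^ i := by ring
    have := Nat.one_le_two_pow (n := i)
    refine le_min ?_ ?_ <;> omega
  have h4 : N.τ ≠ 0 := by
    have := Nat.one_le_two_pow (n := i)
    omega
  have := (Nat.le_log_iff_pow_le (by norm_num) h4).2 h3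
  omega

omit hI in
def Conf.goal (C : Conf N) (hd : ℕ → N.Node) (ℓ : ℕ) : Option ℕ :=
  target (C.returned.view (hd ℓ)) (N.graph.degree (hd ℓ)) ℓ

omit hI in
/-- The nodes of the groups after a search cycle. -/
def Conf.newHead (C : Conf N) (hd : ℕ → N.Node) (ℓ : ℕ) : N.Node :=
  if C.Active ℓ then (goto (hd ℓ) (C.goal hd ℓ)).1 else hd ℓ

theorem Inv.helping_cleared {ℓ : ℕ} (h : Found (C.returned.view (hd ℓ)) ℓ ∨
    Full (C.returned.view (hd ℓ)) (N.graph.degree (hd ℓ)) ℓ) {a : N.Agent}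
    (hs : (C.mem a).settled = true) (hl : (C.mem a).label = ℓ) :
    (C.decided.mem a).help = none := by
  by_cases hH : C.Helping hd ℓ a
  · rw [(hI.decided_helping hH).2.2.2.2.1, if_pos h]
  · exact (hI.decided_settled hs hl hH).2.2.2.2.1

theorem Inv.decided_occ {ℓ : ℕ} {x : N.Node} : C.decided.Occ ℓ x ↔ C.Occ ℓ x := by
  unfold Occ
  refine exists_congr fun a => ?_
  obtain ⟨h1, h2, -⟩ := hI.decided_fields a
  rw [h1, h2]
  exact and_congr_right fun h => by rw [hI.decided_loc h]

theorem Inv.decided_active {ℓ : ℕ} : C.decided.Active ℓ ↔ C.Active ℓ := by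
  unfold Active
  refine and_congr_right fun _ => exists_congr fun a => ?_
  obtain ⟨h1, h2, -⟩ := hI.decided_fields a
  rw [h1, h2]

theorem Inv.decided_groupSize (ℓ : ℕ) : C.decided.groupSize ℓ = C.groupSize ℓ := by
  unfold groupSize
  congr 1
  ext a
  obtain ⟨h1, h2, -⟩ := hI.decided_fields a
  simp only [Finset.mem_filter, h1, h2]

theorem Inv.decided_stack {ℓ : ℕ} {l : List N.Node} (h : C.Stack ℓ l) : C.decided.Stack ℓ l := by
  refine h.mono fun a h1 h2 => ?_
  obtain ⟨g1, g2, g3⟩ := hI.decided_fields a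
  exact ⟨g2.trans h1, g1.trans h2, hI.decided_loc h1, g3⟩

theorem Inv.decided_explored {ℓ : ℕ} {l : List N.Node} (h : C.Explored ℓ l) :
    C.decided.Explored ℓ l := fun x hx hxl y hy =>
  hI.decided_occ.2 (h x (hI.decided_occ.1 hx) hxl y hy)

/-- The search of an active group advances in a search cycle. -/
theorem Inv.decided_search (hW : Nat.log 2 N.τ + 2 ≤ W) {ℓ : ℕ} (hA : C.Active ℓ) :
    (∀ c, C.goal hd ℓ = some c → c < N.graph.degree (hd ℓ)) ∧
    (C.decided.Search W (n + 1) ℓ (C.newHead hd ℓ) ∨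
      C.decided.Arrival W (n + 1) ℓ (C.newHead hd ℓ)) := by
  obtain ⟨k1, k2, l, j, k3, k4, k5, k6⟩ := hI.search_helperCount hA
  have hj := hI.log_bound hA k5 hW
  unfold Conf.newHead
  rw [if_pos hA]
  rcases hI.outcome hA with ⟨c, h1, h2, h3, h4⟩ | ⟨h1, h2, h3, s, h4, h5, h6, h7⟩ |
    ⟨h1, h2, h3, h4, h5⟩
  · change C.goal hd ℓ = _ at h2
    rw [h2, goto_some h3]
    refine ⟨fun c' hc' => by simp only [Option.some.injEq] at hc'; omega, .inr ⟨?_, ?_, ?_⟩⟩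
    · rw [hI.decided_occ]; exact h4
    · intro a ha hal
      obtain ⟨g1, g2, -⟩ := hI.decided_fields a
      exact hI.helping_cleared (.inl h1) (g2.symm.trans ha) (g1.symm.trans hal)
    -- The old head stays on the stack; `j + 1 ≤ W` lets the reserve of the finished search pay for
    -- this cycle.
    · refine ⟨hd ℓ :: l, hI.decided_stack k3, hI.decided_explored k4, ?_, by simp, ?_⟩
      · rw [hI.decided_groupSize, List.length_cons]; omega
      · intro y hy
        obtain rfl : hd ℓ = y := by simpa using hy
        refine ⟨(adj_nbr h3).symm, fun a ha hal => ?_⟩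
        obtain ⟨g1, g2, -⟩ := hI.decided_fields a
        rw [g2] at ha; rw [g1] at hal
        have := (hI.decided_free ha (by rw [hal]; exact hA.1)).2
        rw [hal] at this
        change _ = goto _ (C.goal hd ℓ) at this
        rw [h2, goto_some h3] at this
        exact (Prod.ext_iff.1 this).2
  · change C.goal hd ℓ = _ at h7
    -- Backtracking. At the root, the nodes of the group would be closed under adjacency, hence all
    -- nodes by connectedness, although a free agent remains.
    cases l with
    | nil =>
      exfalso
      refine hA.not_all_occ (forall_of_closed (hI.search ℓ hA).occ fun y hy z hz => ?_)
      by_cases hyh : y = hd ℓ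
      · subst hyh; exact h3 z hz
      · exact k4 y hy (by simpa using hyh) z hz
    | cons y l =>
      obtain ⟨⟨a, g1, g2, g3, g4⟩, k3'⟩ := k3
      obtain ⟨g5, g6⟩ := g4 y (by simp)
      obtain rfl := hI.settled_inj s a h4 g1 (h6.trans g3.symm)
      rw [g6] at h7
      rw [h7, goto_prt g5]
      refine ⟨fun c' hc' => ?_, .inl ⟨0, l, 0, ?_, by simp, hI.decided_stack k3',
        hI.decided_explored ?_, by simp, ?_⟩⟩
      · simp only [Option.some.injEq] at hc'
        rw [← hc']; exact prt_lt g5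
      · intro a p ha hal hp
        obtain ⟨f1, f2, -⟩ := hI.decided_fields a
        rw [hI.helping_cleared (.inr h2) (f2.symm.trans ha) (f1.symm.trans hal)] at hp
        simp at hp
      · intro x hx hxl z hz
        by_cases hxh : x = hd ℓ
        · subst hxh; exact h3 z hz
        · refine k4 x hx (fun hxl' => ?_) z hz
          rcases List.mem_cons.1 hxl' with h | h
          · exact hxh h
          · exact hxl h
      · rw [hI.decided_groupSize]
        rw [List.length_cons, Nat.mul_add W (l.length + 1) 1, mul_one] at k6
        omega
  · change C.goal hd ℓ = _ at h3
    rw [h3]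
    -- No move: the inspected ports become helper ports, and the increment of `j` pays for the
    -- cycle.
    refine ⟨by simp, .inl ⟨C.helperCount ℓ + (C.team ℓ).card, l, j + 1, ?_, ?_,
      hI.decided_stack k3, hI.decided_explored k4, ?_, ?_⟩⟩
    · intro a p ha hal hp
      obtain ⟨f1, f2, -⟩ := hI.decided_fields a
      rw [f2] at ha; rw [f1] at hal
      by_cases hH : C.Helping hd ℓ a
      · obtain ⟨-, -, a3, a4, -⟩ := hI.helping_spec hH
        rw [(hI.decided_helping hH).2.2.2.2.1, if_neg (by tauto)] at hp
        rw [hI.decided_loc ha]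
        exact ⟨a3, a4, by simpa using hp.symm⟩
      · rw [(hI.decided_settled ha hal hH).2.2.2.2.1] at hp
        simp at hp
    · intro i hi
      obtain ⟨a, hH, ha⟩ := h5 i hi
      obtain ⟨a1, a2, -⟩ := hI.helping_spec hH
      obtain ⟨f1, f2, -⟩ := hI.decided_fields a
      refine ⟨hi.trans h4, a, f2.trans a1, f1.trans a2, ?_, (hI.decided_loc a1).trans ha⟩
      rw [(hI.decided_helping hH).2.2.2.2.1, if_neg (by tauto)]
      simp
    · have := (hI.helperCount_le hA).2.2
      rw [pow_succ]; omega
    · rw [hI.decided_groupSize]; omega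

/-- Cut at the old head, the old exit path is unchanged; if the group moves, the new exit port of
the old head adds the step to the new one. Inactive groups keep all exit ports. -/
theorem Inv.decided_reach (hW : Nat.log 2 N.τ + 2 ≤ W) {a : N.Agent}
    (ha : (C.mem a).settled = true) :
    C.decided.Reach (C.mem a).label (C.loc a) (C.newHead hd (C.mem a).label) := by
  set ℓ := (C.mem a).label with hℓ
  have hstep : ∀ x y, (C.Active ℓ → x ≠ hd ℓ) → C.ExitStep ℓ x y → C.decided.ExitStep ℓ x y := by
    rintro x y hx ⟨b, p, h1, h2, h3, h4, h5⟩
    obtain ⟨f1, f2, -⟩ := hI.decided_fields b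
    refine ⟨b, p, f2.trans h1, f1.trans h2, (hI.decided_loc h1).trans h3, ?_, h5⟩
    rw [hI.decided_exit h1, if_neg, h4]
    rintro ⟨g1, g2, -⟩
    rw [h2] at g1 g2
    exact hx g1 (h3.symm.trans g2)
  unfold Conf.newHead
  by_cases hA : C.Active ℓ
  · rw [if_pos hA]
    have h1 : C.decided.Reach ℓ (C.loc a) (hd ℓ) :=
      reflTransGen_of_ne (fun x y hx h => hstep x y (fun _ => hx) h) (hI.reach a ha)
    rcases hg : C.goal hd ℓ with _ | c
    · exact h1
    · have hc := (hI.decided_search hW hA).1 c hg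
      rw [goto_some hc]
      refine h1.tail ?_
      obtain ⟨s, g1, g2, g3⟩ := (hI.search ℓ hA).occ
      obtain ⟨f1, f2, -⟩ := hI.decided_fields s
      refine ⟨s, c, f2.trans g1, f1.trans g2, (hI.decided_loc g1).trans g3, ?_, hc, rfl⟩
      change target _ _ _ = _ at hg
      rw [hI.decided_exit g1, g2, if_pos ⟨hA, g3, by rw [hg]; simp⟩, hg]
  · rw [if_neg hA]
    exact Relation.ReflTransGen.mono (fun x y h => hstep x y (fun h' => absurd h' hA) h) _ _
      (hI.reach a ha)

theorem Inv.decided_free_help {a : N.Agent} (ha : (C.mem a).settled = false) :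
    (C.decided.mem a).help = none := by
  have hr : ¬ C.Recruit hd (C.mem a).label a := fun hr => by have := hr.1; simp [ha] at this
  have h1 := (hI.returned_help hr).trans (hI.free_help a ha)
  by_cases hl : (C.mem a).label = 0
  · rw [(hI.decided_inert ha hl).1, h1]
  · rw [(hI.decided_free ha hl).1, h1]

theorem Inv.decided (hW : Nat.log 2 N.τ + 2 ≤ W) :
    Pre C.decided Λ (C.newHead hd) W (n + 1) := by
  have hf1 := fun a => (hI.decided_fields a).1
  have hf2 := fun a => (hI.decided_fields a).2.1
  refine ⟨⟨?_, ?_, ?_, ?_, ?_, ?_, ?_, ?_⟩, ?_, ?_, ?_⟩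
  · intro a b ha hb hab
    rw [hf2] at ha hb
    rw [hI.decided_loc ha, hI.decided_loc hb] at hab
    exact hI.settled_inj a b ha hb hab
  · intro a ha
    rw [hf2] at ha; rw [hf1]; exact hI.settled_label a ha
  · intro a ha
    rw [hf1] at ha ⊢; exact hI.label_mem a ha
  · intro a ha
    rw [hf2] at ha; exact hI.decided_free_help ha
  · intro a ha hl
    rw [hf2] at ha; rw [hf1] at hl ⊢
    unfold Conf.newHead
    rw [if_pos ⟨hl, a, ha, rfl⟩]
    exact (Prod.ext_iff.1 (hI.decided_free ha hl).2).1
  · intro a ha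
    rw [hf2] at ha
    rw [hf1, hI.decided_loc ha]
    exact hI.decided_reach hW ha
  · intro a s ha hl hs hsa
    rw [hf2] at ha hs; rw [hf1] at hl
    have hla := (hI.decided_inert ha hl).2
    rw [hI.decided_loc hs, hla] at hsa
    -- The group of `y` is inactive, so its exit ports are frozen and the path persists.
    obtain ⟨y, h1, h2, h3, h4⟩ := hI.inert a s ha hl hs hsa
    refine ⟨y, (hf2 y).trans h1, by rw [hf1, hf1]; exact h2, ?_, ?_⟩
    · rw [hf1, hI.decided_active]; exact h3
    · rw [hf1, hI.decided_loc h1, hla]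
      refine Relation.ReflTransGen.mono ?_ _ _ h4
      rintro x z ⟨b, p, g1, g2, g3, g4, g5⟩
      refine ⟨b, p, (hf2 b).trans g1, (hf1 b).trans g2, (hI.decided_loc g1).trans g3, ?_, g5⟩
      rw [hI.decided_exit g1, if_neg, g4]
      rintro ⟨f1, -⟩
      rw [g2] at f1; exact h3 f1
  · intro a ha hact
    rw [hf2] at ha; rw [hf1, hI.decided_active] at hact
    have hH : ¬ C.Helping hd (C.mem a).label a := by
      rintro (h | ⟨-, -, -, y, hy, -⟩)
      · exact hact (hI.active_of_help h.2)
      · exact hact (hI.active_of_team hy.1)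
    exact (hI.decided_settled ha rfl hH).2.2.2.2.1
  · intro ℓ hA
    rw [hI.decided_active] at hA
    exact (hI.decided_search hW hA).2
  · intro a ha hl
    rw [hf2] at ha; rw [hf1] at hl
    have hla := (hI.decided_inert ha hl).2
    rw [hla]
    rcases hI.alone a ha hl with ⟨s, hs, hsa⟩ | h
    · exact .inl ⟨s, (hf2 s).trans hs, (hI.decided_loc hs).trans hsa⟩
    · right
      intro b hb hbl
      rw [hf1] at hbl
      have hbs : (C.mem b).settled = false := by
        by_contra hbs; exact hI.settled_label b (by simpa using hbs) hbl
      rw [(hI.decided_inert hbs hbl).2] at hb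
      exact h b hb
  · intro a p ha hp
    rw [hf2] at ha
    rw [hI.decided_exit ha] at hp
    rw [hI.decided_loc ha]
    split_ifs at hp with hc
    · obtain ⟨hA, hloc, -⟩ := hc
      change C.goal hd _ = _ at hp
      have := (hI.decided_search hW hA).1 p hp
      rw [hloc]
      refine ⟨this, .inr ⟨_, hI.decided_active.2 hA, ?_⟩⟩
      unfold Conf.newHead
      rw [if_pos hA, hp, goto_some this]
    · obtain ⟨h1, s, hs, hsl⟩ := hI.exit_settled a p ha hp
      exact ⟨h1, .inl ⟨s, (hf2 s).trans hs, (hI.decided_loc hs).trans hsl⟩⟩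

/-- The invariant is preserved by a search cycle. -/
theorem Inv.cycle (hW : Nat.log 2 N.τ + 2 ≤ W) :
    Inv (C.run Dispersion.cycle) Λ (C.newHead hd) W (n + 1) :=
  (hI.decided hW).resolve

end

theorem Inv.cycles (hW : Nat.log 2 N.τ + 2 ≤ W) (hI : Inv C Λ hd W 0) (R : ℕ) :
    ∃ hd', Inv (C.run (List.replicate R Dispersion.cycle).flatten) Λ hd' W R := by
  induction R with
  | zero => exact ⟨hd, hI⟩
  | succ R ih =>
    obtain ⟨hd', h⟩ := ih
    rw [List.replicate_succ', List.flatten_append, Conf.run_append]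
    simp only [List.flatten_cons, List.flatten_nil, List.append_nil]
    exact ⟨_, h.cycle hW⟩

/-- After enough search cycles no group is active. -/
theorem Inv.not_active (hW : Nat.log 2 N.τ + 2 ≤ W) (hI : Inv C Λ hd W n)
    (hn : 2 * W * N.k < n) (ℓ : ℕ) : ¬ C.Active ℓ := by
  intro hA
  obtain ⟨-, -, l, j, -, -, h1, h2⟩ := hI.search_helperCount hA
  have h3 := hI.log_bound hA h1 hW
  have h4 := Nat.mul_le_mul_left (2 * W) hA.groupSize_lt.le
  omega

end Dispersion

/-! ### Following the exit ports to a common node -/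

namespace Dispersion

open scoped Classical
open Conf

variable {N : Network}

section Orbit

variable {V : Type*} (f : V → V)

/-- `z` is visited infinitely often from `x`. -/
def Recurrent (x z : V) : Prop := ∀ n, ∃ m ≥ n, f^[m] x = z

variable {f}

theorem recurrent_iterate (j : ℕ) (x z : V) : Recurrent f (f^[j] x) z ↔ Recurrent f x z := by
  constructor
  · intro h n
    obtain ⟨m, hm, h1⟩ := h n
    exact ⟨m + j, by omega, by rw [Function.iterate_add_apply, h1]⟩
  · intro h n
    obtain ⟨m, hm, h1⟩ := h (n + j)
    refine ⟨m - j, by omega, ?_⟩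
    rw [← Function.iterate_add_apply, Nat.sub_add_cancel (by omega), h1]

/-- An orbit within a set of at most `R` elements is periodic after `R` steps. -/
theorem exists_period {T : Finset V} (hT : ∀ y ∈ T, f y ∈ T) {x : V} (hx : x ∈ T) {R : ℕ}
    (hR : T.card ≤ R) : ∃ p, 0 < p ∧ p ≤ R ∧ ∀ m ≥ R, f^[m + p] x = f^[m] x := by
  have hmem : ∀ m, f^[m] x ∈ T := by
    intro m
    induction m with
    | zero => exact hx
    | succ m ih => rw [Function.iterate_succ_apply']; exact hT _ ih
  obtain ⟨i, hi, j, hj, hij, h⟩ := Finset.exists_ne_map_eq_of_card_lt_of_maps_to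
    (s := Finset.range (R + 1)) (t := T) (by rw [Finset.card_range]; omega)
    (f := fun m => f^[m] x) (fun m _ => hmem m)
  wlog hlt : i < j generalizing i j
  · exact this j hj i hi hij.symm h.symm (by omega)
  rw [Finset.mem_range] at hi hj
  refine ⟨j - i, by omega, by omega, fun m hm => ?_⟩
  have h1 : m + (j - i) = (m - i) + j := by omega
  have h2 : m = (m - i) + i := by omega
  rw [h1, Function.iterate_add_apply, ← show f^[i] x = f^[j] x from h,
    ← Function.iterate_add_apply, ← h2]

/-- After `R` steps the orbit is periodic with period at most `R`, so any later window of `R` steps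
shows exactly the recurrent points. This makes recurrence observable for a walking agent. -/
theorem recurrent_iff {T : Finset V} (hT : ∀ y ∈ T, f y ∈ T) {x : V} (hx : x ∈ T) {R n : ℕ}
    (hR : T.card ≤ R) (hn : R ≤ n) (z : V) :
    Recurrent f x z ↔ ∃ i < R, f^[n + i] x = z := by
  obtain ⟨p, hp0, hpR, hp⟩ := exists_period hT hx hR
  have hmul : ∀ m ≥ R, ∀ q, f^[m + p * q] x = f^[m] x := by
    intro m hm q
    induction q with
    | zero => rfl
    | succ q ih => rw [mul_add, mul_one, ← add_assoc, hp _ (by omega), ih]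
  constructor
  · intro h
    obtain ⟨m, hm, rfl⟩ := h n
    refine ⟨(m - n) % p, (Nat.mod_lt _ hp0).trans_le hpR, ?_⟩
    rw [← hmul (n + (m - n) % p) (by omega) ((m - n) / p), add_assoc, Nat.mod_add_div]
    congr 2; omega
  · rintro ⟨i, -, rfl⟩ n'
    refine ⟨n + i + p * n', ?_, hmul _ (by omega) _⟩
    have := Nat.le_mul_of_pos_left n' hp0
    omega

theorem Recurrent.mem {T : Finset V} (hT : ∀ y ∈ T, f y ∈ T) {x : V} (hx : x ∈ T) {z : V}
    (h : Recurrent f x z) : z ∈ T := by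
  obtain ⟨m, -, rfl⟩ := h 0
  clear h
  induction m with
  | zero => exact hx
  | succ m ih => rw [Function.iterate_succ_apply']; exact hT _ ih

end Orbit

namespace Conf

variable (C : Conf N)

/-- The nodes that are occupied by settled agents. -/
def settledNodes : Finset N.Node :=
  (Finset.univ.filter fun a => (C.mem a).settled = true).image C.loc

variable {C}

theorem mem_settledNodes {x : N.Node} :
    x ∈ C.settledNodes ↔ ∃ s, (C.mem s).settled = true ∧ C.loc s = x := by
  simp [settledNodes]

variable (C)

theorem card_settledNodes_le : C.settledNodes.card ≤ N.k :=
  Finset.card_image_le.trans (Finset.card_le_univ _)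

/-- The identifier of the settled agent at a node. -/
def idAt (x : N.Node) : ℕ :=
  if h : ∃ s, (C.mem s).settled = true ∧ C.loc s = x then N.ident h.choose else 0

/-- The node to which the exit port at `x` leads. -/
def follow (x : N.Node) : N.Node :=
  if h : ∃ s, (C.mem s).settled = true ∧ C.loc s = x then
    (goto x (C.mem h.choose).exit).1 else x

/-- The settled agents of `E` are those of `C`. -/
structure SameSettled (C E : Conf N) : Prop where
  settled : ∀ a, (E.mem a).settled = (C.mem a).settled
  exit : ∀ a, (E.mem a).exit = (C.mem a).exit
  loc : ∀ a, (C.mem a).settled = true → E.loc a = C.loc a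

end Conf

section Flow

variable {C E : Conf N} (hinj : ∀ a b, (C.mem a).settled = true → (C.mem b).settled = true →
  C.loc a = C.loc b → a = b)
include hinj

theorem Conf.idAt_loc {s : N.Agent} (hs : (C.mem s).settled = true) :
    C.idAt (C.loc s) = N.ident s := by
  have h : ∃ s', (C.mem s').settled = true ∧ C.loc s' = C.loc s := ⟨s, hs, rfl⟩
  unfold idAt
  rw [dif_pos h, hinj _ _ h.choose_spec.1 hs h.choose_spec.2]

theorem Conf.follow_loc {s : N.Agent} (hs : (C.mem s).settled = true) :
    C.follow (C.loc s) = (goto (C.loc s) (C.mem s).exit).1 := by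
  have h : ∃ s', (C.mem s').settled = true ∧ C.loc s' = C.loc s := ⟨s, hs, rfl⟩
  unfold follow
  rw [dif_pos h, hinj _ _ h.choose_spec.1 hs h.choose_spec.2]

omit hinj in
theorem Conf.follow_of_not_mem {x : N.Node} (h : x ∉ C.settledNodes) : C.follow x = x := by
  rw [mem_settledNodes] at h
  unfold follow; rw [dif_neg h]

omit hinj in
theorem Conf.SameSettled.exists_iff (h : C.SameSettled E) (v : N.Node) :
    (∃ x ∈ E.view v, x.mem.settled = true) ↔ v ∈ C.settledNodes := by
  rw [exists_view, mem_settledNodes]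
  constructor
  · rintro ⟨b, h1, h2⟩
    have h3 := (h.settled b).symm.trans h2
    exact ⟨b, h3, by rw [← h.loc b h3, h1]⟩
  · rintro ⟨b, h1, h2⟩
    exact ⟨b, by rw [h.loc b h1, h2], (h.settled b).trans h1⟩

theorem Conf.SameSettled.pick (h : C.SameSettled E) {v : N.Node} (hv : v ∈ C.settledNodes) :
    (Dispersion.pick (E.view v) fun x => x.mem.settled = true).id = C.idAt v ∧
    (goto v (Dispersion.pick (E.view v) fun x => x.mem.settled = true).mem.exit).1 =
      C.follow v := by
  obtain ⟨b, h1, h2, h3⟩ := exists_pick (exists_view.1 ((h.exists_iff v).2 hv))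
  have h4 := (h.settled b).symm.trans h2
  have h5 := (h.loc b h4).symm.trans h1
  subst h5
  rw [h3, idAt_loc hinj h4, follow_loc hinj h4]
  simp only [obs, h.exit, and_self]

omit hinj in
theorem Conf.SameSettled.settled_act (h : C.SameSettled E) {a : N.Agent}
    (ha : (C.mem a).settled = true) {I : Instr} (hI : I = .walk ∨ I = .record ∨ I = .seek) :
    (E.next I).loc a = E.loc a := by
  have h1 : (E.mem a).settled = true := (h.settled a).trans ha
  have h2 : (E.act I a).2 = none := by
    rcases hI with rfl | rfl | rfl <;> simp [Conf.act, Dispersion.act, h1]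
  simp [next, h2]

omit hinj in
theorem Conf.SameSettled.next (h : C.SameSettled E) {I : Instr}
    (hI : I = .walk ∨ I = .record ∨ I = .seek) : C.SameSettled (E.next I) := by
  have h1 : ∀ a, ((E.next I).mem a).settled = (E.mem a).settled ∧
      ((E.next I).mem a).exit = (E.mem a).exit := by
    intro a
    rcases hI with rfl | rfl | rfl
    · exact ⟨rfl, rfl⟩
    · simp only [Conf.next, Conf.act, Dispersion.act]
      split_ifs <;> exact ⟨rfl, rfl⟩
    · exact ⟨rfl, rfl⟩
  exact ⟨fun a => (h1 a).1.trans (h.settled a), fun a => (h1 a).2.trans (h.exit a),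
    fun a ha => (h.settled_act ha hI).trans (h.loc a ha)⟩

theorem Conf.SameSettled.walk (h : C.SameSettled E) {a : N.Agent}
    (ha : (C.mem a).settled = false) :
    (E.next .walk).loc a = C.follow (E.loc a) ∧ ((E.next .walk).mem a).best = 0 := by
  have h1 := (h.settled a).trans ha
  refine ⟨?_, rfl⟩
  simp only [Conf.next, Conf.act, Dispersion.act]
  by_cases hv : E.loc a ∈ C.settledNodes
  · rw [if_pos ⟨h1, (h.exists_iff _).2 hv⟩, (h.pick hinj hv).2]
  · rw [if_neg (fun h' => hv ((h.exists_iff _).1 h'.2)), follow_of_not_mem hv]; rfl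

theorem Conf.SameSettled.record (h : C.SameSettled E) {a : N.Agent}
    (ha : (C.mem a).settled = false) :
    (E.next .record).loc a = C.follow (E.loc a) ∧
      ((E.next .record).mem a).best = max (E.mem a).best (C.idAt (E.loc a)) := by
  have h1 := (h.settled a).trans ha
  simp only [Conf.next, Conf.act, Dispersion.act]
  by_cases hv : E.loc a ∈ C.settledNodes
  · rw [if_pos ⟨h1, (h.exists_iff _).2 hv⟩, (h.pick hinj hv).2, (h.pick hinj hv).1]
    exact ⟨rfl, rfl⟩
  · rw [if_neg (fun h' => hv ((h.exists_iff _).1 h'.2)), follow_of_not_mem hv]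
    refine ⟨rfl, ?_⟩
    rw [mem_settledNodes] at hv
    unfold idAt; rw [dif_neg hv]; simp

theorem Conf.SameSettled.seek (h : C.SameSettled E) {a : N.Agent}
    (ha : (C.mem a).settled = false) :
    (E.next .seek).loc a = (if C.idAt (E.loc a) = (E.mem a).best then E.loc a
      else C.follow (E.loc a)) ∧ ((E.next .seek).mem a).best = (E.mem a).best := by
  have h1 := (h.settled a).trans ha
  refine ⟨?_, rfl⟩
  simp only [Conf.next, Conf.act, Dispersion.act]
  by_cases hv : E.loc a ∈ C.settledNodes
  · rw [(h.pick hinj hv).1]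
    by_cases hb : C.idAt (E.loc a) = (E.mem a).best
    · rw [if_neg (fun h' => h'.2.2 hb), if_pos hb]; rfl
    · rw [if_pos ⟨h1, (h.exists_iff _).2 hv, hb⟩, if_neg hb, (h.pick hinj hv).2]
  · rw [if_neg (fun h' => hv ((h.exists_iff _).1 h'.2.1)), follow_of_not_mem hv]; simp

omit hinj in
theorem Conf.SameSettled.run (h : C.SameSettled E) {I : Instr}
    (hI : I = .walk ∨ I = .record ∨ I = .seek) (R : ℕ) :
    C.SameSettled (E.run (List.replicate R I)) := by
  induction R with
  | zero => exact h
  | succ R ih => rw [List.replicate_succ', Conf.run_append]; exact ih.next hI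

theorem Conf.SameSettled.run_walk (h : C.SameSettled E) {a : N.Agent}
    (ha : (C.mem a).settled = false) (R : ℕ) :
    (E.run (List.replicate R .walk)).loc a = C.follow^[R] (E.loc a) ∧
      (0 < R → ((E.run (List.replicate R .walk)).mem a).best = 0) := by
  induction R with
  | zero => exact ⟨rfl, fun h => absurd h (lt_irrefl _)⟩
  | succ R ih =>
    obtain ⟨g1, g2⟩ := (h.run (.inl rfl) R).walk hinj ha
    rw [List.replicate_succ', Conf.run_append]
    exact ⟨by rw [Function.iterate_succ_apply', ← ih.1]; exact g1, fun _ => g2⟩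

theorem Conf.SameSettled.run_record (h : C.SameSettled E) {a : N.Agent}
    (ha : (C.mem a).settled = false) (hb : (E.mem a).best = 0) (R : ℕ) :
    (E.run (List.replicate R .record)).loc a = C.follow^[R] (E.loc a) ∧
      ((E.run (List.replicate R .record)).mem a).best =
        (Finset.range R).sup fun i => C.idAt (C.follow^[i] (E.loc a)) := by
  induction R with
  | zero => exact ⟨rfl, hb⟩
  | succ R ih =>
    obtain ⟨g1, g2⟩ := (h.run (.inr (.inl rfl)) R).record hinj ha
    rw [List.replicate_succ', Conf.run_append]
    refine ⟨by rw [Function.iterate_succ_apply', ← ih.1]; exact g1, ?_⟩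
    rw [Finset.range_add_one, Finset.sup_insert, sup_comm, ← ih.2, ← ih.1]
    exact g2

/-- The agent stops for good at the first node whose identifier is the recorded maximum; `i` only
witnesses that there is one in time. -/
theorem Conf.SameSettled.run_seek (h : C.SameSettled E) {a : N.Agent}
    (ha : (C.mem a).settled = false) {i : ℕ}
    (hi : C.idAt (C.follow^[i] (E.loc a)) = (E.mem a).best) {R : ℕ} (hR : i ≤ R) :
    ∃ j, (E.run (List.replicate R .seek)).loc a = C.follow^[j] (E.loc a) ∧
      C.idAt (C.follow^[j] (E.loc a)) = (E.mem a).best := by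
  induction R generalizing E i with
  | zero =>
    obtain rfl : i = 0 := by omega
    exact ⟨0, rfl, hi⟩
  | succ R ih =>
    obtain ⟨g1, g2⟩ := h.seek hinj ha
    rw [List.replicate_succ, Conf.run_cons]
    have h' := h.next (I := .seek) (.inr (.inr rfl))
    by_cases h0 : C.idAt (E.loc a) = (E.mem a).best
    · rw [if_pos h0] at g1
      obtain ⟨j, h1, h2⟩ := ih h' (i := 0) (by rw [g1, g2]; exact h0) (by omega)
      rw [g1, g2] at h2; rw [g1] at h1
      exact ⟨j, h1, h2⟩
    · rw [if_neg h0] at g1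
      cases i with
      | zero => exact absurd hi h0
      | succ i =>
        obtain ⟨j, h1, h2⟩ := ih h' (i := i)
          (by rw [g1, g2, ← Function.iterate_succ_apply]; exact hi) (by omega)
        rw [g1, g2, ← Function.iterate_succ_apply] at h2
        rw [g1, ← Function.iterate_succ_apply] at h1
        exact ⟨j + 1, h1, h2⟩

end Flow

/-- The last part of a round. -/
def flow (R : ℕ) : List Instr :=
  List.replicate R .walk ++ (List.replicate R .record ++ List.replicate R .seek)

variable {C : Conf N}

theorem Conf.flow_settled (R : ℕ) : C.SameSettled (C.run (flow R)) := by
  have h0 : C.SameSettled C := ⟨fun _ => rfl, fun _ => rfl, fun _ _ => rfl⟩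
  rw [flow, Conf.run_append, Conf.run_append]
  exact ((h0.run (.inl rfl) R).run (.inr (.inl rfl)) R).run (.inr (.inr rfl)) R

/-- At the end of a round, the free agents are at the recurrent node with the largest
identifier. -/
theorem Conf.flow_free (hinj : ∀ a b, (C.mem a).settled = true → (C.mem b).settled = true →
    C.loc a = C.loc b → a = b) (hclosed : ∀ x ∈ C.settledNodes, C.follow x ∈ C.settledNodes)
    {R : ℕ} (hR : N.k ≤ R) {a : N.Agent} (ha : (C.mem a).settled = false)
    (hloc : C.loc a ∈ C.settledNodes) :
    Recurrent C.follow (C.loc a) ((C.run (flow R)).loc a) ∧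
    ∀ z, Recurrent C.follow (C.loc a) z → C.idAt z ≤ C.idAt ((C.run (flow R)).loc a) := by
  have hR' := C.card_settledNodes_le.trans hR
  have hk : 0 < N.k := Fintype.card_pos
  have h0 : C.SameSettled C := ⟨fun _ => rfl, fun _ => rfl, fun _ _ => rfl⟩
  rw [flow, Conf.run_append, Conf.run_append]
  set E1 := C.run (List.replicate R .walk) with hE1
  set E2 := E1.run (List.replicate R .record) with hE2
  have h1 : C.SameSettled E1 := h0.run (.inl rfl) R
  have h2 : C.SameSettled E2 := h1.run (.inr (.inl rfl)) R
  obtain ⟨w1, w2⟩ := h0.run_walk hinj ha R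
  obtain ⟨r1, r2⟩ := h1.run_record hinj ha (w2 (by omega)) R
  rw [← hE1] at w1 w2
  rw [← hE2] at r1 r2
  rw [w1] at r1 r2
  rw [← Function.iterate_add_apply] at r1
  have hrec := fun n hn z => recurrent_iff hclosed hloc (R := R) (n := n) hR' hn z
  -- The recorded maximum is attained at a recurrent node, which the orbit meets again in the next
  -- window.
  have hbest : ∃ i < R, C.idAt (C.follow^[i] (E2.loc a)) = (E2.mem a).best := by
    obtain ⟨i, hi, hs⟩ := Finset.exists_mem_eq_sup (Finset.range R) ⟨0, by simp; omega⟩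
      fun i => C.idAt (C.follow^[i] (C.follow^[R] (C.loc a)))
    rw [Finset.mem_range] at hi
    have hz := (hrec R le_rfl _).2 ⟨i, hi, rfl⟩
    obtain ⟨i', hi', hz'⟩ := (hrec (R + R) (by omega) _).1 hz
    refine ⟨i', hi', ?_⟩
    rw [r2, hs, r1, ← Function.iterate_add_apply, ← Function.iterate_add_apply, add_comm i', hz',
      add_comm]
  obtain ⟨i, hi, hib⟩ := hbest
  obtain ⟨j, s1, s2⟩ := h2.run_seek hinj ha hib hi.le
  have hj : Recurrent C.follow (C.loc a) ((E2.run (List.replicate R .seek)).loc a) := by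
    rw [s1, r1, ← Function.iterate_add_apply]
    rw [hrec (j + (R + R)) (by omega)]
    exact ⟨0, by omega, rfl⟩
  refine ⟨hj, fun z hz => ?_⟩
  rw [← s1] at s2
  rw [s2, r2]
  obtain ⟨i', hi', rfl⟩ := (hrec R le_rfl z).1 hz
  rw [add_comm, Function.iterate_add_apply]
  exact Finset.le_sup (f := fun i => C.idAt (C.follow^[i] (C.follow^[R] (C.loc a))))
    (Finset.mem_range.2 hi')

end Dispersion

/-! ### A round halves the number of crowded nodes -/

namespace Dispersion

open scoped Classical
open Conf

variable {N : Network}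

namespace Conf

variable (C : Conf N)

/-- The nodes with more than one agent. -/
def crowded : Finset N.Node :=
  Finset.univ.filter fun v => ∃ a b, a ≠ b ∧ C.loc a = v ∧ C.loc b = v

/-- The label of the group that forms at `v` in the beginning of a round. -/
def leaderId (v : N.Node) : ℕ := (pick (C.view v) fun _ => True).id

def labels : Finset ℕ := C.crowded.image C.leaderId

/-- The node of the agent with identifier `ℓ`. -/
def home (ℓ : ℕ) : N.Node :=
  if h : ∃ b, N.ident b = ℓ then C.loc h.choose else N.connected.nonempty.some

variable {C}

theorem mem_crowded {v : N.Node} :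
    v ∈ C.crowded ↔ ∃ a b, a ≠ b ∧ C.loc a = v ∧ C.loc b = v := by
  simp [crowded]

theorem injective_of_crowded (h : C.crowded = ∅) : Function.Injective C.loc := by
  intro a b hab
  by_contra hne
  have : C.loc a ∈ C.crowded := mem_crowded.2 ⟨a, b, hne, rfl, hab.symm⟩
  rw [h] at this; simp at this

theorem two_mul_crowded_le : 2 * C.crowded.card ≤ N.k := by
  have h : ∀ v ∈ C.crowded, 2 ≤ (Finset.univ.filter fun a => C.loc a = v).card := by
    intro v hv
    obtain ⟨a, b, hab, ha, hb⟩ := mem_crowded.1 hv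
    exact Finset.one_lt_card.2 ⟨a, by simp [ha], b, by simp [hb], hab⟩
  calc 2 * C.crowded.card = ∑ v ∈ C.crowded, 2 := by simp [mul_comm]
    _ ≤ ∑ v ∈ C.crowded, (Finset.univ.filter fun a => C.loc a = v).card := Finset.sum_le_sum h
    _ ≤ ∑ v, (Finset.univ.filter fun a => C.loc a = v).card :=
        Finset.sum_le_sum_of_subset (Finset.subset_univ _)
    _ = N.k := by
        exact (Finset.card_eq_sum_card_fiberwise (f := C.loc) (s := Finset.univ)
          (fun _ _ => Finset.mem_univ _)).symm

theorem leaderId_eq (a : N.Agent) :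
    ∃ w, C.loc w = C.loc a ∧ C.leaderId (C.loc a) = N.ident w := by
  obtain ⟨w, h1, -, h2⟩ := exists_pick (C := C) (v := C.loc a) (P := fun _ => True)
    ⟨a, rfl, trivial⟩
  exact ⟨w, h1, by rw [leaderId, h2]; rfl⟩

theorem home_leaderId (a : N.Agent) : C.home (C.leaderId (C.loc a)) = C.loc a := by
  obtain ⟨w, h1, h2⟩ := leaderId_eq (C := C) a
  have h : ∃ b, N.ident b = C.leaderId (C.loc a) := ⟨w, h2.symm⟩
  unfold home
  rw [dif_pos h, N.ident_injective (h.choose_spec.trans h2), h1]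

@[simp] theorem reset_loc : (C.next .reset).loc = C.loc := by
  funext a
  simp only [next, act, Dispersion.act]
  split_ifs <;> rfl

theorem reset_mem (a : N.Agent) : (C.next .reset).mem a =
    if ∀ b, C.loc b = C.loc a → b = a then {} else { label := C.leaderId (C.loc a) } := by
  have h : (∀ x ∈ C.view (C.loc a), x.id = N.ident a) ↔ ∀ b, C.loc b = C.loc a → b = a := by
    rw [forall_view]
    exact forall_congr' fun b => imp_congr_right fun _ => N.ident_injective.eq_iff
  simp only [next, act, Dispersion.act]
  by_cases h' : ∀ b, C.loc b = C.loc a → b = a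
  · rw [if_pos (h.2 h'), if_pos h']
  · rw [if_neg (fun h'' => h' (h.1 h'')), if_neg h']; rfl

theorem reset_settled (a : N.Agent) : ((C.next .reset).mem a).settled = false := by
  rw [reset_mem]; split_ifs <;> rfl

/-- Nobody is settled yet, so most clauses are vacuous; every group is in `Arrival` with an empty
stack. -/
theorem reset_pre (W : ℕ) : Pre (C.next .reset) C.labels C.home W 0 := by
  have hs := reset_settled (C := C)
  have hpos : ∀ a, C.leaderId (C.loc a) ≠ 0 := by
    intro a
    obtain ⟨w, -, h⟩ := leaderId_eq (C := C) a
    rw [h]; exact (N.ident_pos w).ne'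
  have hlab : ∀ a, ((C.next .reset).mem a).label ≠ 0 →
      (∃ b, b ≠ a ∧ C.loc b = C.loc a) ∧
        ((C.next .reset).mem a).label = C.leaderId (C.loc a) := by
    intro a ha
    rw [reset_mem] at ha ⊢
    split_ifs at ha ⊢ with h
    · exact absurd rfl ha
    · push Not at h
      obtain ⟨b, h1, h2⟩ := h
      exact ⟨⟨b, h2, h1⟩, rfl⟩
  have habs : ∀ {p : Prop} (a : N.Agent), ((C.next .reset).mem a).settled = true → p := by
    intro p a ha; rw [hs] at ha; simp at ha
  have hocc : ∀ ℓ x, ¬ (C.next .reset).Occ ℓ x := fun ℓ x ⟨a, ha, _⟩ => habs a ha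
  refine ⟨⟨fun a _ ha => habs a ha, fun a ha => habs a ha, ?_, ?_, ?_, fun a ha => habs a ha,
    fun _ s _ _ hs => habs s hs, fun a ha => habs a ha⟩, ?_, ?_, fun a _ ha => habs a ha⟩
  · intro a ha
    obtain ⟨⟨b, h1, h2⟩, h3⟩ := hlab a ha
    rw [h3]
    exact Finset.mem_image_of_mem _ (mem_crowded.2 ⟨b, a, h1, h2, rfl⟩)
  · intro a _
    rw [reset_mem]; split_ifs <;> rfl
  · intro a _ ha
    rw [(hlab a ha).2, home_leaderId, reset_loc]
  · intro ℓ _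
    exact .inr ⟨hocc _ _, fun a ha => habs a ha, [], trivial,
      fun x hx => absurd hx (hocc _ _), by simp, fun _ s _ => hs s, by simp⟩
  · intro a _ ha
    right
    rw [reset_mem] at ha
    split_ifs at ha with h
    · intro b hb _
      rw [reset_loc] at hb; exact h b hb
    · exact absurd ha (hpos a)

end Conf

variable {C : Conf N}

theorem Conf.ExitStep.follow {ℓ : ℕ} (hinj : ∀ a b, (C.mem a).settled = true →
    (C.mem b).settled = true → C.loc a = C.loc b → a = b) {x y : N.Node}
    (h : C.ExitStep ℓ x y) : C.follow x = y := by
  obtain ⟨a, p, h1, h2, h3, h4, h5, h6⟩ := h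
  subst h3
  rw [follow_loc hinj h1, h4, goto_some h5]; exact h6

/-- Exit steps are steps of `follow`, so both orbits share a tail. -/
theorem Conf.Reach.recurrent {ℓ : ℕ} (hinj : ∀ a b, (C.mem a).settled = true →
    (C.mem b).settled = true → C.loc a = C.loc b → a = b) {x y : N.Node} (h : C.Reach ℓ x y)
    (z : N.Node) : Recurrent C.follow x z ↔ Recurrent C.follow y z := by
  induction h with
  | refl => rfl
  | @tail b c _ hbc ih =>
    rw [ih, ← hbc.follow hinj]
    exact (recurrent_iterate 1 b z).symm

/-- If no group is active any more, every crowded node that remains is shared by two groups. -/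
theorem Inv.crowded_flow {Λ : Finset ℕ} {hd : ℕ → N.Node} {W n R : ℕ} (hI : Inv C Λ hd W n)
    (hA : ∀ ℓ, ¬ C.Active ℓ) (hR : N.k ≤ R) : 2 * (C.run (flow R)).crowded.card ≤ Λ.card := by
  set E := C.run (flow R) with hE
  have hinj := hI.settled_inj
  have hS : C.SameSettled E := C.flow_settled R
  have hclosed : ∀ x ∈ C.settledNodes, C.follow x ∈ C.settledNodes := by
    intro x hx
    obtain ⟨s, hs, rfl⟩ := mem_settledNodes.1 hx
    rw [follow_loc hinj hs]
    rcases he : (C.mem s).exit with _ | p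
    · exact hx
    · obtain ⟨h1, h2⟩ := hI.exit_settled s p hs he
      rw [goto_some h1]; exact mem_settledNodes.2 h2
  have hlab : ∀ a, (C.mem a).settled = false → (C.mem a).label = 0 := by
    intro a ha
    by_contra h; exact hA _ ⟨h, a, ha, rfl⟩
  have hstay : ∀ a, (C.mem a).settled = false → C.loc a ∉ C.settledNodes → E.loc a = C.loc a := by
    intro a ha hloc
    have h0 : C.SameSettled C := ⟨fun _ => rfl, fun _ => rfl, fun _ _ => rfl⟩
    have hit : ∀ m, C.follow^[m] (C.loc a) = C.loc a := fun m =>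
      Function.iterate_fixed (follow_of_not_mem hloc) m
    have h1 := h0.run (I := .walk) (.inl rfl) R
    have h2 := h1.run (I := .record) (.inr (.inl rfl)) R
    obtain ⟨w1, w2⟩ := h0.run_walk hinj ha R
    have hk : 0 < N.k := Fintype.card_pos
    have r1 := (h1.run_record hinj ha (w2 (by omega)) R).1
    rw [w1, hit, hit] at r1
    have hs : ∀ (R : ℕ) (F : Conf N), C.SameSettled F → F.loc a = C.loc a →
        (F.run (List.replicate R .seek)).loc a = C.loc a := by
      intro R
      induction R with
      | zero => intro F _ hF; exact hF
      | succ R ih =>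
        intro F hF hl
        rw [List.replicate_succ, Conf.run_cons]
        refine ih _ (hF.next (.inr (.inr rfl))) ?_
        rw [(hF.seek hinj ha).1, hl, follow_of_not_mem hloc, ite_self]
    rw [hE, flow, Conf.run_append, Conf.run_append]
    exact hs R _ h2 r1
  -- The groups attracted by `v`: their exit paths run into a cycle on which `v` has the largest
  -- identifier.
  let F : N.Node → Finset ℕ := fun v => Λ.filter fun ℓ => ∃ y, (C.mem y).settled = true ∧
    (C.mem y).label = ℓ ∧ Recurrent C.follow (C.loc y) v ∧
    ∀ z, Recurrent C.follow (C.loc y) z → C.idAt z ≤ C.idAt v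
  have hF2 : ∀ v ∈ E.crowded, 2 ≤ (F v).card := by
    intro v hv
    obtain ⟨a, b, hab, rfl, hb⟩ := mem_crowded.1 hv
    have key : ∀ c, (C.mem c).settled = false → C.loc c ∈ C.settledNodes →
        2 ≤ (F (E.loc c)).card := by
      intro c hc hcl
      obtain ⟨f1, f2⟩ := C.flow_free hinj hclosed hR hc hcl
      rw [← hE] at f1 f2
      obtain ⟨s, hs, hsl⟩ := mem_settledNodes.1 hcl
      -- The free agent `c` came from a node shared by the group of `s` and the group of `y`; both
      -- are attracted by the node where `c` ends.
      obtain ⟨y, y1, y2, -, y3⟩ := hI.inert c s hc (hlab c hc) hs hsl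
      refine Finset.one_lt_card.2 ⟨(C.mem y).label, Finset.mem_filter.2 ⟨?_, y, y1, rfl, ?_⟩,
        (C.mem s).label, Finset.mem_filter.2 ⟨?_, s, hs, rfl, ?_⟩, y2⟩
      · exact hI.label_mem y (hI.settled_label y y1)
      · simp only [y3.recurrent hinj]; exact ⟨f1, f2⟩
      · exact hI.label_mem s (hI.settled_label s hs)
      · rw [hsl]; exact ⟨f1, f2⟩
    have hend : ∀ c, (C.mem c).settled = true ∨ C.loc c ∈ C.settledNodes →
        E.loc c ∈ C.settledNodes := by
      intro c hc
      by_cases hcs : (C.mem c).settled = true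
      · rw [hS.loc c hcs]; exact mem_settledNodes.2 ⟨c, hcs, rfl⟩
      · exact (C.flow_free hinj hclosed hR (by simpa using hcs)
          (hc.resolve_left hcs)).1.mem hclosed (hc.resolve_left hcs)
    -- Off the settled nodes an agent is alone and stays, and agents on settled nodes never leave
    -- this set, so only agents from settled nodes can end up crowded.
    have hout : ∀ c d, c ≠ d → E.loc c = E.loc d → (C.mem c).settled = false →
        C.loc c ∈ C.settledNodes := by
      intro c d hcd hl hc
      by_contra hn
      have h1 := hstay c hc hn
      rcases hI.alone c hc (hlab c hc) with h2 | h2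
      · exact hn (mem_settledNodes.2 h2)
      · by_cases hd' : (C.mem d).settled = true ∨ C.loc d ∈ C.settledNodes
        · have := hend d hd'
          rw [← hl, h1] at this; exact hn this
        · push Not at hd'
          have h3 := hstay d (by simpa using hd'.1) hd'.2
          exact hcd (h2 d (by rw [← h3, ← hl, h1])).symm
    by_cases ha : (C.mem a).settled = true
    · by_cases hb' : (C.mem b).settled = true
      · refine absurd (hinj a b ha hb' ?_) hab
        rw [← hS.loc a ha, ← hS.loc b hb', hb]
      · rw [Bool.not_eq_true] at hb'
        rw [← hb]
        exact key b hb' (hout b a hab.symm hb hb')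
    · rw [Bool.not_eq_true] at ha
      exact key a ha (hout a b hab hb.symm ha)
  -- All nodes of a group flow to its last head, hence into one cycle, whose node of largest
  -- identifier is unique.
  have hdisj : ∀ v v' : N.Node, v ≠ v' → Disjoint (F v) (F v') := by
    intro v v' hne
    rw [Finset.disjoint_left]
    rintro ℓ h h'
    obtain ⟨-, y, y1, y2, y3, y4⟩ := Finset.mem_filter.1 h
    obtain ⟨-, y', z1, z2, z3, z4⟩ := Finset.mem_filter.1 h'
    have hyy : ∀ z, Recurrent C.follow (C.loc y) z ↔ Recurrent C.follow (C.loc y') z := by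
      intro z
      rw [(hI.reach y y1).recurrent hinj, (hI.reach y' z1).recurrent hinj, y2, z2]
    have e1 : C.idAt v = C.idAt v' :=
      le_antisymm (z4 v ((hyy v).1 y3)) (y4 v' ((hyy v').2 z3))
    obtain ⟨s, s1, rfl⟩ := mem_settledNodes.1
      (y3.mem hclosed (mem_settledNodes.2 ⟨y, y1, rfl⟩))
    obtain ⟨s', s2, rfl⟩ := mem_settledNodes.1
      (z3.mem hclosed (mem_settledNodes.2 ⟨y', z1, rfl⟩))
    rw [idAt_loc hinj s1, idAt_loc hinj s2] at e1
    exact hne (by rw [N.ident_injective e1])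
  calc 2 * E.crowded.card = ∑ v ∈ E.crowded, 2 := by simp [mul_comm]
    _ ≤ ∑ v ∈ E.crowded, (F v).card := Finset.sum_le_sum hF2
    _ = (E.crowded.biUnion F).card :=
        (Finset.card_biUnion fun v _ v' _ hne => hdisj v v' hne).symm
    _ ≤ Λ.card := Finset.card_le_card (Finset.biUnion_subset.2 fun v _ => Finset.filter_subset _ _)

/-- A round that is long enough halves the number of crowded nodes. -/
theorem crowded_round (C : Conf N) {R : ℕ} (hR : 2 * (Nat.log 2 N.τ + 2) * N.k < R) :
    2 * (C.run (round R)).crowded.card ≤ C.crowded.card := by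
  have h0 : Inv (C.run [.reset, .resolve]) C.labels C.home (Nat.log 2 N.τ + 2) 0 :=
    (reset_pre _).resolve
  obtain ⟨hd, h1⟩ := h0.cycles le_rfl R
  have hk : N.k ≤ R := by nlinarith
  have h2 := h1.crowded_flow (fun ℓ => h1.not_active le_rfl hR ℓ) hk
  rw [show round R = ([.reset, .resolve] ++ (List.replicate R Dispersion.cycle).flatten) ++ flow R
    from rfl, Conf.run_append, Conf.run_append]
  exact h2.trans Finset.card_image_le

theorem crowded_rounds (C : Conf N) {R : ℕ} (hR : 2 * (Nat.log 2 N.τ + 2) * N.k < R) (m : ℕ) :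
    2 ^ m * (C.run (List.replicate m (round R)).flatten).crowded.card ≤ C.crowded.card := by
  induction m with
  | zero => simp
  | succ m ih =>
    rw [List.replicate_succ', List.flatten_append, Conf.run_append]
    simp only [List.flatten_cons, List.flatten_nil, List.append_nil]
    refine le_trans ?_ ih
    rw [pow_succ, mul_assoc]
    exact Nat.mul_le_mul_left _ (crowded_round _ hR)

end Dispersion

/-! ### The time bound -/

namespace Dispersion

open scoped Classical
open Conf

variable {N : Network}

theorem k_le_idMax (N : Network) : N.k ≤ N.idMax := by
  have h : (Finset.univ.image N.ident).card = N.k :=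
    Finset.card_image_of_injective _ N.ident_injective
  rw [← h]
  have h2 : Finset.univ.image N.ident ⊆ Finset.Icc 1 N.idMax := by
    intro i hi
    obtain ⟨a, -, rfl⟩ := Finset.mem_image.1 hi
    exact Finset.mem_Icc.2 ⟨N.ident_pos a, N.ident_le a⟩
  simpa using Finset.card_le_card h2

theorem k_pos (N : Network) : 0 < N.k := Fintype.card_pos

theorem length_round (R : ℕ) : (round R).length = 8 * R + 2 := by
  simp [round, cycle]; ring

theorem length_phase (m i : ℕ) : (phase m i).length = m.size * (8 * 2 ^ i + 2) := by
  simp [phase, length_round]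

/-- A geometric sum, with `8 * 2 ^ i + 2 ≤ 10 * 2 ^ i` for each round. -/
theorem length_phases_le (m i : ℕ) :
    ((List.range i).flatMap (phase m)).length ≤ 10 * m.size * 2 ^ i := by
  induction i with
  | zero => simp
  | succ i ih =>
    rw [List.range_succ, List.flatMap_append, List.length_append]
    simp only [List.flatMap_cons, List.flatMap_nil, List.append_nil, length_phase]
    have := Nat.one_le_two_pow (n := i)
    rw [pow_succ]
    nlinarith [Nat.zero_le m.size]

theorem round_eq_cons (R : ℕ) : ∃ l, round R = .reset :: l := ⟨_, rfl⟩

theorem phase_eq_cons {m : ℕ} (hm : 0 < m) (i : ℕ) : ∃ l, phase m i = .reset :: l := by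
  obtain ⟨s, hs⟩ := Nat.exists_eq_succ_of_ne_zero (Nat.size_pos.2 hm).ne'
  obtain ⟨l, hl⟩ := round_eq_cons (2 ^ i)
  refine ⟨l ++ (List.replicate s (round (2 ^ i))).flatten, ?_⟩
  rw [phase, hs, List.replicate_succ, List.flatten_cons, hl]; rfl

/-- The program consists of the first phases and of further rounds. -/
theorem program_eq {m : ℕ} (hm : 0 < m) {i : ℕ} (hi : i < 2 * m.size + 4) :
    ∃ l, program m = (List.range i).flatMap (phase m) ++ .reset :: l := by
  obtain ⟨j, hj⟩ := Nat.exists_eq_add_of_lt hi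
  obtain ⟨l, hl⟩ := phase_eq_cons hm i
  refine ⟨l ++ (List.map (fun x => i + 1 + x) (List.range j)).flatMap (phase m), ?_⟩
  unfold program
  rw [hj, add_right_comm, List.range_add, List.flatMap_append, List.range_succ,
    List.flatMap_append]
  simp [hl]

/-- The number of search cycles that suffice to halve the number of crowded nodes. -/
def cyclesNeeded (N : Network) : ℕ := 2 * (Nat.log 2 N.τ + 2) * N.k

/-- Since `log τ ≤ k ≤ idMax`, the number of cycles is at most `2 * (k + 2) * k`, which is less than
`2 * (idMax + 1) ^ 2`. The additional 1 is for the phase that follows. -/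
theorem size_cyclesNeeded_le (N : Network) :
    (cyclesNeeded N).size + 1 < 2 * N.idMax.size + 4 := by
  have h1 : (cyclesNeeded N).size ≤ 2 * N.idMax.size + 1 := by
    rw [Nat.size_le]
    have h2 := Nat.lt_size_self N.idMax
    have h3 := k_le_idMax N
    have h4 : Nat.log 2 N.τ ≤ N.k := (Nat.log_le_self _ _).trans (min_le_left _ _)
    set P := 2 ^ N.idMax.size with hP
    have h5 : 2 ^ (2 * N.idMax.size + 1) = 2 * (P * P) := by
      rw [hP, ← pow_add, ← two_mul, pow_succ]; ring
    rw [h5]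
    unfold cyclesNeeded
    have h6 : (Nat.log 2 N.τ + 2) * N.k ≤ (N.k + 2) * N.k := Nat.mul_le_mul_right _ (by omega)
    nlinarith
  omega

/-- The exponent `(cyclesNeeded N).size` is the first whose phase has long enough rounds, and that
phase removes all crowded nodes. The constant is `10 * 4 * 2`: the geometric sum, rounding up to a
power of two together with the final phase, and the factor in `cyclesNeeded`. -/
theorem disperses_nat (hk : 2 ≤ N.k) (place : N.Agent → N.Node) :
    ∃ T, T ≤ 80 * N.idMax.size * ((Nat.log 2 N.τ + 2) * N.k) ∧
      algorithm.Legitimate (algorithm.exec (algorithm.initial place) T) := by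
  have hm : 0 < N.idMax := (k_pos N).trans_le (k_le_idMax N)
  obtain ⟨l', hl⟩ := program_eq hm (size_cyclesNeeded_le N)
  refine ⟨_, ?_, legitimate_of_injective place hl ?_⟩
  · refine (length_phases_le _ _).trans ?_
    have h0 : 0 < cyclesNeeded N := by unfold cyclesNeeded; positivity
    obtain ⟨j, hj⟩ := Nat.exists_eq_succ_of_ne_zero (Nat.size_pos.2 h0).ne'
    have h1 : 2 ^ j ≤ cyclesNeeded N := Nat.lt_size.1 (by omega)
    have h2 : 2 ^ ((cyclesNeeded N).size + 1) = 4 * 2 ^ j := by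
      rw [hj, Nat.succ_eq_add_one, pow_succ, pow_succ]; ring
    rw [h2]
    unfold cyclesNeeded at h1
    calc 10 * N.idMax.size * (4 * 2 ^ j)
        ≤ 10 * N.idMax.size * (4 * (2 * (Nat.log 2 N.τ + 2) * N.k)) := by gcongr
      _ = _ := by ring
  · rw [List.range_succ, List.flatMap_append, Conf.run_append]
    simp only [List.flatMap_cons, List.flatMap_nil, List.append_nil]
    refine injective_of_crowded ?_
    set C := (start place).run ((List.range (cyclesNeeded N).size).flatMap (phase N.idMax))
    have h1 := crowded_rounds C (R := 2 ^ (cyclesNeeded N).size)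
      (Nat.lt_size_self (cyclesNeeded N)) N.idMax.size
    have h2 := two_mul_crowded_le (C := C)
    have h3 := Nat.lt_size_self N.idMax
    have h4 := k_le_idMax N
    rw [← Finset.card_eq_zero]
    by_contra h5
    have h6 := Nat.le_mul_of_pos_right (2 ^ N.idMax.size) (Nat.pos_of_ne_zero h5)
    unfold phase at h5 h6
    omega

/-- For `k = 1` the time bound is zero because `log k = 0`, so the initial configuration itself has
to be legitimate. -/
theorem legitimate_of_k_eq_one (hk : N.k = 1) (place : N.Agent → N.Node) :
    algorithm.Legitimate (algorithm.exec (algorithm.initial place) 0) := by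
  have hm : 0 < N.idMax := (k_pos N).trans_le (k_le_idMax N)
  obtain ⟨l', hl⟩ := program_eq hm (i := 0) (by omega)
  refine legitimate_of_injective place hl ?_
  have : Subsingleton N.Agent := Fintype.card_le_one_iff_subsingleton.1 hk.le
  exact Function.injective_of_subsingleton _

theorem logb_idMax_le {c : ℕ} (hc : N.idMax ≤ c * N.k ^ c) :
    Real.logb 2 N.idMax ≤ c + c * Real.logb 2 N.k := by
  have hm : 0 < N.idMax := (k_pos N).trans_le (k_le_idMax N)
  have hc0 : 0 < c := by
    rcases Nat.eq_zero_or_pos c with rfl | h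
    · simp at hc; omega
    · exact h
  have hk := k_pos N
  have h1 : (N.idMax : ℝ) ≤ c * (N.k : ℝ) ^ c := by exact_mod_cast hc
  have hk' : (0 : ℝ) < N.k := by exact_mod_cast hk
  have hc' : (0 : ℝ) < c := by exact_mod_cast hc0
  calc Real.logb 2 N.idMax ≤ Real.logb 2 (c * (N.k : ℝ) ^ c) :=
        Real.logb_le_logb_of_le (by norm_num) (by exact_mod_cast hm) h1
    _ = Real.logb 2 c + c * Real.logb 2 N.k := by
        rw [Real.logb_mul hc'.ne' (by positivity), Real.logb_pow]
    _ ≤ c + c * Real.logb 2 N.k := by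
        have : Real.logb 2 c ≤ c := by
          rw [Real.logb_le_iff_le_rpow (by norm_num) hc', Real.rpow_natCast]
          exact_mod_cast (Nat.lt_two_pow_self).le
        linarith

/-- The factor 240 is `80 * 3`, from `log τ + 2 ≤ 3 * log (max 2 τ)`; the factor `2 * c + 1` bounds
`idMax.size` in units of `log k ≥ 1`. -/
theorem disperses {c : ℕ} {K : ℝ} (hc : N.idMax ≤ c * N.k ^ c) (hK : 240 * (2 * c + 1) ≤ K) :
    algorithm.DispersesWithin N
      (K * ((N.k : ℝ) * Real.logb 2 (max 2 (N.τ : ℝ)) * Real.logb 2 (N.k : ℝ))) := by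
  intro place
  have hk0 := k_pos N
  rcases Nat.lt_or_ge 1 N.k with hk | hk
  · obtain ⟨T, hT, hL⟩ := disperses_nat hk place
    refine ⟨T, ?_, hL⟩
    have hm : 0 < N.idMax := (k_pos N).trans_le (k_le_idMax N)
    have hlk : 1 ≤ Real.logb 2 (N.k : ℝ) := by
      rw [Real.le_logb_iff_rpow_le (by norm_num) (by exact_mod_cast hk0)]
      simpa using (by exact_mod_cast hk : (2 : ℝ) ≤ N.k)
    have hlt : 1 ≤ Real.logb 2 (max 2 (N.τ : ℝ)) := by
      rw [Real.le_logb_iff_rpow_le (by norm_num) (by positivity)]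
      simp
    have h1 : (Nat.log 2 N.τ : ℝ) ≤ Real.logb 2 (max 2 (N.τ : ℝ)) := by
      rcases Nat.eq_zero_or_pos N.τ with h | h
      · rw [h]; simp
      · refine (Real.natLog_le_logb _ _).trans ?_
        exact Real.logb_le_logb_of_le (by norm_num) (by exact_mod_cast h) (le_max_right _ _)
    have h2 : (N.idMax.size : ℝ) ≤ (2 * c + 1) * Real.logb 2 (N.k : ℝ) := by
      have h3 : N.idMax.size ≤ Nat.log 2 N.idMax + 1 :=
        Nat.size_le.2 (Nat.lt_pow_succ_log_self (by norm_num) _)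
      have h4 : (N.idMax.size : ℝ) ≤ Nat.log 2 N.idMax + 1 := by exact_mod_cast h3
      have h5 : (Nat.log 2 N.idMax : ℝ) ≤ Real.logb 2 N.idMax := by
        simpa using Real.natLog_le_logb N.idMax 2
      have h6 := logb_idMax_le hc
      have h7 : (c : ℝ) ≤ c * Real.logb 2 (N.k : ℝ) := le_mul_of_one_le_right (by positivity) hlk
      linarith
    have hT' : (T : ℝ) ≤ 80 * N.idMax.size * ((Nat.log 2 N.τ + 2) * N.k) := by exact_mod_cast hT
    calc (T : ℝ) ≤ 80 * N.idMax.size * ((Nat.log 2 N.τ + 2) * N.k) := hT'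
      _ ≤ 80 * ((2 * c + 1) * Real.logb 2 (N.k : ℝ)) *
          ((3 * Real.logb 2 (max 2 (N.τ : ℝ))) * N.k) := by
          gcongr
          linarith
      _ = 240 * (2 * c + 1) *
          ((N.k : ℝ) * Real.logb 2 (max 2 (N.τ : ℝ)) * Real.logb 2 (N.k : ℝ)) := by ring
      _ ≤ _ := by gcongr
  · have h1 : N.k = 1 := by omega
    exact ⟨0, by simp [h1], legitimate_of_k_eq_one h1 place⟩

end Dispersion

/-! ### The space bound -/

namespace Dispersion

open scoped Classical
open Conf

variable {N : Network}

def PortBound (D : ℕ) (o : Option ℕ) : Prop := ∀ p, o = some p → p < D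

/-- Labels and identifiers are at most `M`, ports are smaller than `D`. -/
structure Mem.Bounded (M D : ℕ) (m : Mem) : Prop where
  label : m.label ≤ M
  parent : PortBound D m.parent
  exit : PortBound D m.exit
  help : PortBound D m.help
  home : PortBound D m.home
  best : m.best ≤ M

structure Obs.Bounded (M D : ℕ) (x : Obs) : Prop where
  id : x.id ≤ M
  mem : x.mem.Bounded M D
  pin : PortBound D x.pin

theorem portBound_none (D : ℕ) : PortBound D none := fun p hp => by simp at hp

theorem bounded_default (M D : ℕ) : (default : Mem).Bounded M D :=
  ⟨Nat.zero_le _, portBound_none D, portBound_none D, portBound_none D, portBound_none D,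
    Nat.zero_le _⟩

theorem bounded_pick {M D : ℕ} {V : Finset Obs} (hV : ∀ x ∈ V, x.Bounded M D) (P : Obs → Prop) :
    (pick V P).Bounded M D := by
  unfold pick
  split_ifs with h
  · exact hV _ h.choose_spec.1
  · exact ⟨Nat.zero_le _, bounded_default M D, portBound_none D⟩

theorem portBound_target {M D : ℕ} {V : Finset Obs} (hV : ∀ x ∈ V, x.Bounded M D) (deg ℓ : ℕ) :
    PortBound D (target V deg ℓ) := by
  unfold target
  split_ifs
  · exact (bounded_pick hV _).pin
  · exact (bounded_pick hV _).mem.parent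
  · exact portBound_none D

/-- Stored values are only copied from identifiers, incoming ports and other memories, or reset; the
computed port of `.probe` is used but never stored. -/
theorem bounded_act {M D : ℕ} {V : Finset Obs} (hV : ∀ x ∈ V, x.Bounded M D) {m : Mem}
    (hm : m.Bounded M D) {pin : Option ℕ} (hp : PortBound D pin) (deg self : ℕ) (I : Instr) :
    (act deg self V m pin I).1.Bounded M D := by
  have hn := portBound_none D
  obtain ⟨h1, h2, h3, h4, h5, h6⟩ := hm
  have hpk := bounded_pick hV
  have ht := portBound_target hV
  cases I <;> simp only [act]
  case reset =>
    split_ifs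
    · exact bounded_default M D
    · exact ⟨(hpk _).id, hn, hn, hn, hn, Nat.zero_le _⟩
  case resolve =>
    split_ifs
    · exact ⟨h1, h2, h3, h4, h5, h6⟩
    · exact ⟨h1, h2, h3, h4, h5, h6⟩
    · exact ⟨Nat.zero_le _, h2, h3, h4, h5, h6⟩
    · exact ⟨h1, hp, hn, hn, hn, Nat.zero_le _⟩
    · exact ⟨(hpk _).mem.label, h2, h3, h4, h5, h6⟩
    · exact ⟨h1, h2, h3, h4, h5, h6⟩
  case gather => exact ⟨h1, h2, h3, h4, h5, h6⟩
  case probe =>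
    refine ⟨h1, h2, h3, h4, ?_, h6⟩
    dsimp only
    split_ifs
    · exact hn
    · exact hp
  case back =>
    split_ifs
    · exact ⟨h1, h2, h3, h4, h5, h6⟩
    · exact ⟨h1, h2, h3, (hpk _).pin, h5, h6⟩
    · exact ⟨h1, h2, h3, h4, h5, h6⟩
  case decide =>
    split_ifs
    · exact ⟨h1, h2, h3, hn, h5, h6⟩
    · exact ⟨h1, h2, h3, hn, h5, h6⟩
    · exact ⟨h1, h2, h3, h4, h5, h6⟩
    · exact ⟨h1, h2, h3, h4, h5, h6⟩
    · exact ⟨h1, h2, h3, h4, h5, h6⟩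
    · exact ⟨h1, h2, h3, h4, h5, h6⟩
    · exact ⟨h1, h2, h3, h4, h5, h6⟩
    · exact ⟨h1, h2, ht _ _, h4, h5, h6⟩
    · exact ⟨h1, h2, h3, h4, h5, h6⟩
  case walk => exact ⟨h1, h2, h3, h4, h5, Nat.zero_le _⟩
  case record =>
    split_ifs
    · exact ⟨h1, h2, h3, h4, h5, max_le h6 (hpk _).id⟩
    · exact ⟨h1, h2, h3, h4, h5, h6⟩
  case seek => exact ⟨h1, h2, h3, h4, h5, h6⟩
  case nop => exact ⟨h1, h2, h3, h4, h5, h6⟩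

theorem portBound_goto (v : N.Node) (o : Option ℕ) : PortBound N.Δ (goto v o).2 := by
  rcases o with _ | p
  · exact portBound_none _
  by_cases h : p < N.graph.degree v
  · rw [goto_some h]
    intro q hq
    simp only [Option.some.injEq] at hq
    subst hq
    exact (prt_lt (adj_nbr h).symm).trans_le (N.graph.degree_le_maxDegree _)
  · rw [goto_ge h]; exact portBound_none _

theorem bounded_conf (place : N.Agent → N.Node) (t : ℕ) (a : N.Agent) :
    ((conf place t).mem a).Bounded N.idMax N.Δ ∧ PortBound N.Δ ((conf place t).pin a) := by
  induction t generalizing a with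
  | zero => exact ⟨bounded_default _ _, portBound_none _⟩
  | succ t ih =>
    refine ⟨bounded_act ?_ (ih a).1 (ih a).2 _ _ _, portBound_goto _ _⟩
    exact Conf.forall_view.2 fun b _ => ⟨N.ident_le b, (ih b).1, (ih b).2⟩

abbrev Code : Type :=
  ℕ × ℕ × Bool × Option ℕ × Option ℕ × Option ℕ × Option ℕ × Bool × ℕ

def St.code (s : St) : Code :=
  (s.clock, s.mem.label, s.mem.settled, s.mem.parent, s.mem.exit, s.mem.help, s.mem.home,
    s.mem.fresh, s.mem.best)

theorem St.code_injective : Function.Injective St.code := by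
  rintro ⟨t, ⟨a1, a2, a3, a4, a5, a6, a7, a8⟩⟩ ⟨t', ⟨b1, b2, b3, b4, b5, b6, b7, b8⟩⟩ h
  simp only [St.code, Prod.mk.injEq] at h
  obtain ⟨rfl, rfl, rfl, rfl, rfl, rfl, rfl, rfl, rfl⟩ := h
  rfl

/-- The codes of the states that can occur. -/
def codes (M D L : ℕ) : Finset Code :=
  Finset.range (L + 1) ×ˢ Finset.range (M + 1) ×ˢ Finset.univ ×ˢ
    (Finset.range D).insertNone ×ˢ (Finset.range D).insertNone ×ˢ
    (Finset.range D).insertNone ×ˢ (Finset.range D).insertNone ×ˢ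
    Finset.univ ×ˢ Finset.range (M + 1)

theorem card_codes (M D L : ℕ) :
    (codes M D L).card = 4 * (L + 1) * (M + 1) ^ 2 * (D + 1) ^ 4 := by
  simp [codes, Finset.card_product]; ring

theorem PortBound.mem {D : ℕ} {o : Option ℕ} (h : PortBound D o) :
    o ∈ (Finset.range D).insertNone := by
  rw [Finset.mem_insertNone]
  intro p hp
  exact Finset.mem_range.2 (h p hp)

theorem code_mem_codes {k D M : ℕ} {s : St} (hs : s ∈ algorithm.reachableStates k D M) :
    s.code ∈ codes M D (program M).length := by
  obtain ⟨N, -, rfl, rfl, place, t, a, rfl⟩ := hs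
  rw [exec_eq]
  obtain ⟨⟨h1, h2, h3, h4, h5, h6⟩, -⟩ := bounded_conf place t a
  simp only [codes, St.code, Finset.mem_product, Finset.mem_univ, Finset.mem_range]
  exact ⟨by omega, by omega, trivial, h2.mem, h3.mem, h4.mem, h5.mem, trivial, by omega⟩

/-- With `2 ^ M.size ≤ 2 * M`, the power of two in the geometric sum is at most `64 * M ^ 2`. A
polynomial length is what lets the clock fit into logarithmically many bits. -/
theorem length_program_le {M : ℕ} (hM : 0 < M) : (program M).length + 1 ≤ 2 ^ 11 * (M + 1) ^ 3 := by
  have h1 : (program M).length ≤ 10 * M.size * 2 ^ (2 * M.size + 4) := length_phases_le _ _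
  obtain ⟨j, hj⟩ := Nat.exists_eq_succ_of_ne_zero (Nat.size_pos.2 hM).ne'
  have h2 : 2 ^ j ≤ M := Nat.lt_size.1 (by omega)
  have h3 : M.size ≤ M := Nat.size_le.2 Nat.lt_two_pow_self
  have h4 : 2 ^ (2 * M.size + 4) = 64 * (2 ^ j) ^ 2 := by
    rw [hj, Nat.succ_eq_add_one]; ring
  rw [h4] at h1
  have h5 : 10 * M.size * (64 * (2 ^ j) ^ 2) ≤ 10 * M * (64 * M ^ 2) := by gcongr
  nlinarith [Nat.zero_le (M ^ 2)]

theorem ncard_reachableStates_le {k D M : ℕ} (hM : 0 < M) :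
    (algorithm.reachableStates k D M).Finite ∧
      (algorithm.reachableStates k D M).ncard ≤ 2 ^ 13 * (M + 1) ^ 5 * (D + 1) ^ 4 := by
  have hsub : St.code '' (algorithm.reachableStates k D M) ⊆
      ↑(codes M D (program M).length) := by
    rintro _ ⟨s, hs, rfl⟩
    exact code_mem_codes hs
  refine ⟨Set.Finite.of_finite_image ((Finset.finite_toSet _).subset hsub)
    St.code_injective.injOn, ?_⟩
  rw [← Set.ncard_image_of_injective _ St.code_injective]
  refine (Set.ncard_le_ncard hsub (Finset.finite_toSet _)).trans ?_
  rw [Set.ncard_coe_finset, card_codes]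
  calc 4 * ((program M).length + 1) * (M + 1) ^ 2 * (D + 1) ^ 4
      ≤ 4 * (2 ^ 11 * (M + 1) ^ 3) * (M + 1) ^ 2 * (D + 1) ^ 4 := by
        gcongr; exact length_program_le hM
    _ = _ := by ring

/-- The constant: 13 from the factor `2 ^ 13`, 5 from replacing `idMax + 1` by `2 * idMax` in the
fifth power, 4 from the four ports, and six logarithms of `idMax` at `2 * c` each. -/
theorem usesMemory {c : ℕ} {K : ℝ} (hc : N.idMax ≤ c * N.k ^ c) (hK : 22 + 12 * c ≤ K) :
    algorithm.UsesMemoryAtMost N.k N.Δ N.idMax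
      (K * Real.logb 2 (max 2 ((N.k : ℝ) + (N.Δ : ℝ)))) := by
  have hm : 0 < N.idMax := (k_pos N).trans_le (k_le_idMax N)
  obtain ⟨hfin, hcard⟩ := ncard_reachableStates_le (k := N.k) (D := N.Δ) hm
  refine ⟨hfin, ?_⟩
  set n := (algorithm.reachableStates N.k N.Δ N.idMax).ncard with hn
  set X : ℝ := max 2 ((N.k : ℝ) + (N.Δ : ℝ)) with hX
  have hk : (1 : ℝ) ≤ N.k := by exact_mod_cast k_pos N
  have hD : (0 : ℝ) ≤ N.Δ := by positivity
  have hm' : (1 : ℝ) ≤ N.idMax := by exact_mod_cast hm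
  have hx : 1 ≤ Real.logb 2 X := by
    rw [Real.le_logb_iff_rpow_le (by norm_num) (by positivity)]
    simp [hX]
  have hXk : (N.k : ℝ) + N.Δ ≤ X := le_max_right _ _
  have hlk : Real.logb 2 N.k ≤ Real.logb 2 X :=
    Real.logb_le_logb_of_le (by norm_num) (by linarith) (by linarith)
  have hlD : Real.logb 2 (N.Δ + 1) ≤ Real.logb 2 X :=
    Real.logb_le_logb_of_le (by norm_num) (by linarith) (by linarith)
  have hlm : Real.logb 2 N.idMax ≤ 2 * c * Real.logb 2 X := by
    have h1 := logb_idMax_le hc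
    have h2 : (c : ℝ) * Real.logb 2 N.k ≤ c * Real.logb 2 X := by gcongr
    have h3 : (c : ℝ) ≤ c * Real.logb 2 X := le_mul_of_one_le_right (by positivity) hx
    linarith
  have hlm1 : Real.logb 2 (N.idMax + 1) ≤ 1 + Real.logb 2 N.idMax := by
    have h1 : (N.idMax : ℝ) + 1 ≤ 2 * N.idMax := by linarith
    refine (Real.logb_le_logb_of_le (by norm_num) (by positivity) h1).trans ?_
    rw [Real.logb_mul (by norm_num) (by positivity), Real.logb_self_eq_one (by norm_num)]
  have hln : Real.logb 2 n ≤ 13 + 5 * Real.logb 2 (N.idMax + 1) + 4 * Real.logb 2 (N.Δ + 1) := by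
    have h1 : (n : ℝ) ≤ 2 ^ 13 * ((N.idMax : ℝ) + 1) ^ 5 * ((N.Δ : ℝ) + 1) ^ 4 := by
      exact_mod_cast hcard
    have h2 : Real.logb 2 (2 ^ 13 * ((N.idMax : ℝ) + 1) ^ 5 * ((N.Δ : ℝ) + 1) ^ 4) =
        13 + 5 * Real.logb 2 (N.idMax + 1) + 4 * Real.logb 2 (N.Δ + 1) := by
      rw [Real.logb_mul (by positivity) (by positivity), Real.logb_mul (by positivity)
        (by positivity), Real.logb_pow, Real.logb_pow, Real.logb_pow,
        Real.logb_self_eq_one (by norm_num)]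
      norm_num
    rw [← h2]
    -- As `Real.logb 2 0 = 0`, there is no need to show that some state is reachable.
    rcases Nat.eq_zero_or_pos n with h | h
    · rw [h, Nat.cast_zero, Real.logb_zero]
      refine Real.logb_nonneg (by norm_num) ?_
      have h3 : (1 : ℝ) ≤ ((N.idMax : ℝ) + 1) ^ 5 := one_le_pow₀ (by linarith)
      have h4 : (1 : ℝ) ≤ ((N.Δ : ℝ) + 1) ^ 4 := one_le_pow₀ (by linarith)
      nlinarith
    · exact Real.logb_le_logb_of_le (by norm_num) (by exact_mod_cast h) h1
  calc Real.logb 2 n + Real.logb 2 N.idMax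
      ≤ (22 + 12 * c) * Real.logb 2 X := by linarith
    _ ≤ K * Real.logb 2 X := by gcongr

end Dispersion

end

theorem theorem3 :
    ∃ 𝒜 : Algorithm, ∀ c : ℕ, ∃ K : ℝ, ∀ N : Network, N.idMax ≤ c * N.k ^ c →
      𝒜.DispersesWithin N
        (K * ((N.k : ℝ) * Real.logb 2 (max 2 (N.τ : ℝ)) * Real.logb 2 (N.k : ℝ))) ∧
      𝒜.UsesMemoryAtMost N.k N.Δ N.idMax
        (K * Real.logb 2 (max 2 ((N.k : ℝ) + (N.Δ : ℝ)))) :=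
  ⟨Dispersion.algorithm, fun c => ⟨240 * (2 * c + 1), fun _ hc =>
    ⟨Dispersion.disperses hc le_rfl,
      Dispersion.usesMemory hc (by
        have : (0 : ℝ) ≤ c := Nat.cast_nonneg c
        linarith)⟩⟩⟩
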